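/- Let $\mathbb O$ and $\mathbb O'$ be the octonions and the split octonions, with imaginary units $i,j,k,\ell,i\ell,j\ell,k\ell$ and $I,J,K,L,IL,JL,KL$ ($I^2=J^2=K^2=-1$, $L^2=1$; $\mathbb O'=\mathbb H\oplus\mathbb HL$ with $(a+bL)(c+dL)=(ac+\bar d b)+(da+b\bar c)L$, $IJ=K$; $\mathbb O$ is given by the same formula with $-\bar d b$ in place of $\bar d b$). Let $\mathfrak e_{8(-24)}=\mathfrak{su}(3,\mathbb O'\otimes\mathbb O)$ be the real vector space of tracefree anti-Hermitian $3\times3$ matrices over $\mathbb O'\otimes\mathbb O$, plus $\mathrm{Der}\,\mathbb O'\oplus\mathrm{Der}\,\mathbb O$, with Vinberg's bracket: derivations commute as operators and act entrywise on matrices, and for matrices $A,B$ $$[A,B]=(AB-BA)-\tfrac13\mathrm{tr}(AB-BA)\,\mathcal I+\tfrac13\sum_{m,n}D(a_{mn},b_{nm}),$$ $$D(a\otimes b,c\otimes d)=\mathrm{Re}(bd)\,D_{a,c}+\mathrm{Re}(ac)\,D_{b,d},\qquad D_{x,y}z=[[x,y],z]-3\bigl((xy)z-x(yz)\bigr).$$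 *Notation in $\mathfrak e_8$.* For imaginary $q\in\mathbb O'$ let $D_q=\mathrm{diag}(q,-q,0)$, $E_q=\mathrm{diag}(0,q,-q)$, $F_q=\mathrm{diag}(-q,0,q)$, and define the nested multiple of the identity $(p\circ q)\mathcal I=\frac14\bigl([D_p,D_q]+[E_p,E_q]+[F_p,F_q]\bigr)$. Put $G_Q=-2(QL\circ L)\mathcal I$ for imaginary $Q\perp L$, $G_L=2(K\circ KL)\mathcal I$, $A_L=-\frac23(I\circ IL-J\circ JL)\mathcal I$, $$A_I=\tfrac23(J\circ K-JL\circ KL)\mathcal I,\qquad A_{IL}=-\tfrac23(J\circ KL-JL\circ K)\mathcal I,$$ and define $A_J,A_{JL}$ and $A_K,A_{KL}$ by cyclic permutation of $I,J,K$. For $Q\in\{I,J,K\}$ put $Q_\pm=\frac12(Q\pm QL)$ and $A_{Q_\pm}=\frac12(A_Q\pm A_{QL})$. For $\mathcal X$ in the Albert algebra $H_3(\mathbb O)$ of Hermitian $3\times3$ octonionic matrices and $Q$ one of the six null labels $I_\pm,J_\pm,K_\pm$, let $Q\mathcal X$ be the matrix $Q\bigl(\mathcal X-\frac13(\mathrm{tr}\,\mathcal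 X)\mathcal I\bigr)$ plus $\frac13(\mathrm{tr}\,\mathcal X)\bigl(-\frac12G_Q\bigr)$. Let $\mathfrak e_{7(-25)}=\mathfrak{su}(3,\mathbb H'\otimes\mathbb O)\subset\mathfrak e_8$, with $\mathbb H'=\langle1,K,KL,L\rangle$, be the sum of the space of matrices in $\mathfrak e_8$ with entries in $\mathbb H'\otimes\mathbb O$, $\mathrm{Der}\,\mathbb O$, and the span of all $(P\circ Q)\mathcal I$ with $P,Q\in\mathrm{Im}\,\mathbb H'$. *Freudenthal's description.* Let $\mathfrak e_{6(-26)}$ consist of the pairs $\phi=(M,\delta)$ of a tracefree $3\times3$ octonionic matrix $M$ and $\delta\in\mathrm{Der}\,\mathbb O$, acting on $H_3(\mathbb O)$ by $\phi(\mathcal X)=M\mathcal X+\mathcal XM^\dagger+\delta(\mathcal X)$, with dual $\phi'=(-M^\dagger,\delta)$. Write $\mathcal X\circ\mathcal Y=\frac12(\mathcal X\mathcal Y+\mathcal Y\mathcal X)$ and $$\mathcal X*\mathcal Y=\mathcal X\circ\mathcal Y-\tfrac12\bigl((\mathrm{tr}\mathcal X)\mathcal Y+(\mathrm{tr}\mathcal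 Y)\mathcal X\bigr)+\tfrac12\bigl((\mathrm{tr}\mathcal X)(\mathrm{tr}\mathcal Y)-\mathrm{tr}(\mathcal X\circ\mathcal Y)\bigr)\mathcal I.$$ An element $\Theta=(\phi,\rho,\mathcal A,\mathcal B)$ with $\phi\in\mathfrak e_6$, $\rho\in\mathbb R$, $\mathcal A,\mathcal B\in H_3(\mathbb O)$ acts on $\mathcal P=(\mathcal X,\mathcal Y,p,q)$, where $\mathcal X,\mathcal Y\in H_3(\mathbb O)$ and $p,q\in\mathbb R$, by $$\Theta\cdot\mathcal P=\bigl(\phi(\mathcal X)+\tfrac13\rho\mathcal X+2\mathcal B*\mathcal Y+q\mathcal A,\ \ 2\mathcal A*\mathcal X+\phi'(\mathcal Y)-\tfrac13\rho\mathcal Y+p\mathcal B,\ \ \mathrm{tr}(\mathcal A\circ\mathcal Y)-\rho p,\ \ \mathrm{tr}(\mathcal B\circ\mathcal X)+\rho q\bigr).$$ *Identification.* Put $\phi_0=\frac12(M-M^\dagger)+\frac12L(M+M^\dagger)+\delta\in\mathfrak e_8$ and $$\Theta_0=\phi_0+\tfrac16\rho\,G_L+K_-\mathcal A-K_+\mathcal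 B,$$ $$\mathcal P_+=I_-\mathcal X+J_+\mathcal Y-\tfrac12pA_{I_+}-\tfrac12qA_{J_+},\qquad \mathcal P_-=J_-\mathcal X-I_+\mathcal Y-\tfrac12pA_{J_-}+\tfrac12qA_{I_-}.$$ **Theorem.** 1. $\mathfrak e_8$ is a Lie algebra of dimension $248$. 2. $\mathfrak e_7$ is a subalgebra of dimension $133$. The linear map $\Theta\mapsto\Theta_0$ is injective with image $\mathfrak e_7$, and for all $\Theta_1,\Theta_2$ there is $\Theta_3$ with $[(\Theta_1)_0,(\Theta_2)_0]=(\Theta_3)_0$ and $\Theta_3\cdot\mathcal P=\Theta_1\cdot(\Theta_2\cdot\mathcal P)-\Theta_2\cdot(\Theta_1\cdot\mathcal P)$ for all $\mathcal P$. 3. The span of $A_K,A_{KL},A_L$ has dimension $3$ and is the centralizer of $\mathfrak e_7$ in $\mathfrak e_8$. The map $\sigma\begin{pmatrix}a&b\\c&-a\end{pmatrix}=\frac a2A_L-\frac b2A_{K_-}+\frac c2A_{K_+}$ is an isomorphism of Lie algebras from $\mathfrak{sl}(2,\mathbb R)$ onto this span. 4. The linear maps $\mathcal P\mapsto\mathcal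 P_+$ and $\mathcal P\mapsto\mathcal P_-$ are injective with $56$-dimensional images, and $[\Theta_0,\mathcal P_\pm]=(\Theta\cdot\mathcal P)_\pm$ for all $\Theta$ and $\mathcal P$. 5. As a vector space, $\mathfrak e_8$ is the direct sum of $\mathfrak e_7$, the span of $A_K,A_{KL},A_L$, and the spaces of all $\mathcal P_+$ and of all $\mathcal P_-$; thus $248=133+3+2\times56$. 6. For every $\mathcal P$, $[A_L,\mathcal P_\pm]=\pm2\mathcal P_\pm$, and $\mathcal P_\pm$ form a doublet of $\mathfrak{sl}(2,\mathbb R)$: $[\sigma(g),v_0\mathcal P_++v_1\mathcal P_-]=(gv)_0\mathcal P_++(gv)_1\mathcal P_-$ for all $g\in\mathfrak{sl}(2,\mathbb R)$ and $v\in\mathbb R^2$. -/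

import Mathlib

open scoped TensorProduct Matrix

namespace MagicE8

noncomputable section

/-! ### Octonions and split octonions -/

/-- The Cayley-Dickson double `ℍ ⊕ ℍℓ` of Hamilton's quaternions with `ℓ² = ε`;
the pair `⟨a, b⟩` stands for `a + bℓ`. -/
@[ext] structure CD (ε : ℝ) where
  fst : Quaternion ℝ
  snd : Quaternion ℝ

namespace CD
variable {ε : ℝ}

instance : Zero (CD ε) := ⟨⟨0, 0⟩⟩
instance : One (CD ε) := ⟨⟨1, 0⟩⟩
instance : Add (CD ε) := ⟨fun x y => ⟨x.fst + y.fst, x.snd + y.snd⟩⟩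
instance : Neg (CD ε) := ⟨fun x => ⟨-x.fst, -x.snd⟩⟩
instance : Sub (CD ε) := ⟨fun x y => ⟨x.fst - y.fst, x.snd - y.snd⟩⟩
instance : SMul ℝ (CD ε) := ⟨fun r x => ⟨r • x.fst, r • x.snd⟩⟩
instance : Mul (CD ε) := ⟨fun x y =>
  ⟨x.fst * y.fst + ε • (star y.snd * x.snd), y.snd * x.fst + x.snd * star y.fst⟩⟩
instance : Star (CD ε) := ⟨fun x => ⟨star x.fst, -x.snd⟩⟩

@[simp] theorem zero_fst : (0 : CD ε).fst = 0 := rfl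
@[simp] theorem zero_snd : (0 : CD ε).snd = 0 := rfl
@[simp] theorem one_fst : (1 : CD ε).fst = 1 := rfl
@[simp] theorem one_snd : (1 : CD ε).snd = 0 := rfl
@[simp] theorem add_fst (x y : CD ε) : (x + y).fst = x.fst + y.fst := rfl
@[simp] theorem add_snd (x y : CD ε) : (x + y).snd = x.snd + y.snd := rfl
@[simp] theorem neg_fst (x : CD ε) : (-x).fst = -x.fst := rfl
@[simp] theorem neg_snd (x : CD ε) : (-x).snd = -x.snd := rfl
@[simp] theorem sub_fst (x y : CD ε) : (x - y).fst = x.fst - y.fst := rfl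
@[simp] theorem sub_snd (x y : CD ε) : (x - y).snd = x.snd - y.snd := rfl
@[simp] theorem smul_fst (r : ℝ) (x : CD ε) : (r • x).fst = r • x.fst := rfl
@[simp] theorem smul_snd (r : ℝ) (x : CD ε) : (r • x).snd = r • x.snd := rfl
@[simp] theorem mul_fst (x y : CD ε) :
    (x * y).fst = x.fst * y.fst + ε • (star y.snd * x.snd) := rfl
@[simp] theorem mul_snd (x y : CD ε) : (x * y).snd = y.snd * x.fst + x.snd * star y.fst := rfl
@[simp] theorem star_fst (x : CD ε) : (star x).fst = star x.fst := rfl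
@[simp] theorem star_snd (x : CD ε) : (star x).snd = -x.snd := rfl

instance : AddCommGroup (CD ε) where
  add_assoc x y z := by ext1 <;> simp [add_assoc]
  zero_add x := by ext1 <;> simp
  add_zero x := by ext1 <;> simp
  neg_add_cancel x := by ext1 <;> simp
  add_comm x y := by ext1 <;> simp [add_comm]
  sub_eq_add_neg x y := by ext1 <;> simp [sub_eq_add_neg]
  nsmul := nsmulRec
  zsmul := zsmulRec

instance : Module ℝ (CD ε) where
  one_smul x := by ext1 <;> simp
  mul_smul r s x := by ext1 <;> simp [mul_smul]
  smul_zero r := by ext1 <;> simp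
  smul_add r x y := by ext1 <;> simp
  add_smul r s x := by ext1 <;> simp [add_smul]
  zero_smul x := by ext1 <;> simp

instance : NonAssocRing (CD ε) where
  __ := (inferInstance : AddCommGroup (CD ε))
  left_distrib x y z := by ext1 <;> simp [mul_add, add_mul] <;> abel
  right_distrib x y z := by ext1 <;> simp [mul_add, add_mul] <;> abel
  zero_mul x := by ext1 <;> simp
  mul_zero x := by ext1 <;> simp
  one_mul x := by ext1 <;> simp
  mul_one x := by ext1 <;> simp

instance : SMulCommClass ℝ (CD ε) (CD ε) where
  smul_comm r x y := by ext1 <;> simp [smul_comm r ε]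

instance : IsScalarTower ℝ (CD ε) (CD ε) where
  smul_assoc r x y := by ext1 <;> simp [smul_comm r ε]

instance : StarRing (CD ε) where
  star_involutive x := by ext1 <;> simp
  star_mul x y := by ext1 <;> simp [add_comm]
  star_add x y := by ext1 <;> simp [add_comm]

instance : StarModule ℝ (CD ε) where
  star_smul r x := by ext1 <;> simp

end CD

/-- The octonions `𝕆`: `1, i, j, k` span the first quaternion summand, and `ℓ = ⟨0, 1⟩`,
`iℓ = ⟨0, i⟩`, `jℓ = ⟨0, j⟩`, `kℓ = ⟨0, k⟩`. -/
abbrev Oct := CD (-1)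

/-- The split octonions `𝕆'`. -/
abbrev SplitOct := CD 1

/-- The quaternion units. -/
def qi : Quaternion ℝ := ⟨0, 1, 0, 0⟩
def qj : Quaternion ℝ := ⟨0, 0, 1, 0⟩
def qk : Quaternion ℝ := ⟨0, 0, 0, 1⟩

@[simp] theorem qi_re : qi.re = 0 := rfl
@[simp] theorem qi_imI : qi.imI = 1 := rfl
@[simp] theorem qi_imJ : qi.imJ = 0 := rfl
@[simp] theorem qi_imK : qi.imK = 0 := rfl
@[simp] theorem qj_re : qj.re = 0 := rfl
@[simp] theorem qj_imI : qj.imI = 0 := rfl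
@[simp] theorem qj_imJ : qj.imJ = 1 := rfl
@[simp] theorem qj_imK : qj.imK = 0 := rfl
@[simp] theorem qk_re : qk.re = 0 := rfl
@[simp] theorem qk_imI : qk.imI = 0 := rfl
@[simp] theorem qk_imJ : qk.imJ = 0 := rfl
@[simp] theorem qk_imK : qk.imK = 1 := rfl

namespace SplitOct

/-- The imaginary units `I, J, K, L, IL, JL, KL` of the split octonions. -/
def I : SplitOct := ⟨qi, 0⟩
def J : SplitOct := ⟨qj, 0⟩
def K : SplitOct := ⟨qk, 0⟩
def L : SplitOct := ⟨0, 1⟩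
def IL : SplitOct := ⟨0, qi⟩
def JL : SplitOct := ⟨0, qj⟩
def KL : SplitOct := ⟨0, qk⟩

/-- The null split octonions `I_± = (I ± IL)/2`, and likewise for `J`, `K`. -/
def Ip : SplitOct := (1 / 2 : ℝ) • (I + IL)
def Im : SplitOct := (1 / 2 : ℝ) • (I - IL)
def Jp : SplitOct := (1 / 2 : ℝ) • (J + JL)
def Jm : SplitOct := (1 / 2 : ℝ) • (J - JL)
def Kp : SplitOct := (1 / 2 : ℝ) • (K + KL)
def Km : SplitOct := (1 / 2 : ℝ) • (K - KL)

end SplitOct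

/-- The imaginary part of an octonion (split or not). -/
def CD.imPart {ε : ℝ} (x : CD ε) : CD ε := (1 / 2 : ℝ) • (x - star x)

theorem CD.star_imPart {ε : ℝ} (x : CD ε) : star x.imPart = -x.imPart := by
  rw [CD.imPart, star_smul, star_sub, star_star, star_trivial, ← smul_neg, neg_sub]

/-! ### Derivations -/

/-- The derivations of `𝕆` (`ε = -1`) or of `𝕆'` (`ε = 1`). -/
def derAlg (ε : ℝ) : Submodule ℝ (Module.End ℝ (CD ε)) where
  carrier := {D | ∀ x y, D (x * y) = D x * y + x * D y}
  add_mem' {D E} hD hE x y := by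
    change ∀ x y, _ at hD hE
    simp only [LinearMap.add_apply]
    rw [hD, hE, add_mul, mul_add]; abel
  zero_mem' x y := by simp
  smul_mem' r D hD x y := by
    change ∀ x y, _ at hD
    simp only [LinearMap.smul_apply]
    rw [hD, smul_add, smul_mul_assoc, mul_smul_comm]

theorem derAlg_comm {ε : ℝ} {D E : Module.End ℝ (CD ε)} (hD : D ∈ derAlg ε) (hE : E ∈ derAlg ε) :
    D * E - E * D ∈ derAlg ε := by
  intro x y
  have h1 : ∀ x y, D (x * y) = D x * y + x * D y := hD
  have h2 : ∀ x y, E (x * y) = E x * y + x * E y := hE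
  simp only [LinearMap.sub_apply, Module.End.mul_apply, h1, h2, map_add, sub_mul, mul_sub]
  abel

/-- The endomorphism `z ↦ [[x, y], z] - 3 ((x y) z - x (y z))`. -/
def derFun (ε : ℝ) (x y : CD ε) : Module.End ℝ (CD ε) where
  toFun z := (x * y - y * x) * z - z * (x * y - y * x) - (3 : ℝ) • ((x * y) * z - x * (y * z))
  map_add' z w := by simp only [mul_add, add_mul, smul_add, smul_sub]; abel
  map_smul' r z := by
    simp only [mul_smul_comm, smul_mul_assoc, smul_sub, RingHom.id_apply, smul_comm r (3 : ℝ)]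

theorem CD.induct {ε : ℝ} {p : CD ε → Prop} (hadd : ∀ x y, p x → p y → p (x + y))
    (h₁ : ∀ a : Quaternion ℝ, p ⟨a, 0⟩) (h₂ : ∀ a : Quaternion ℝ, p ⟨0, a⟩) (x : CD ε) : p x := by
  have : x = ⟨x.fst, 0⟩ + ⟨0, x.snd⟩ := by ext1 <;> simp
  rw [this]; exact hadd _ _ (h₁ _) (h₂ _)

/-- `derFun` as a bilinear map. -/
def derBil (ε : ℝ) : CD ε →ₗ[ℝ] CD ε →ₗ[ℝ] Module.End ℝ (CD ε) :=
  LinearMap.mk₂ ℝ (derFun ε)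
    (fun x y z => by
      ext1 w
      simp only [derFun, LinearMap.coe_mk, AddHom.coe_mk, LinearMap.add_apply, mul_add, add_mul,
        sub_mul, mul_sub, smul_add, smul_sub]
      abel)
    (fun r x y => by
      ext1 w
      simp only [derFun, LinearMap.coe_mk, AddHom.coe_mk, LinearMap.smul_apply, mul_smul_comm,
        smul_mul_assoc, smul_sub, smul_comm r (3 : ℝ), sub_mul, mul_sub])
    (fun x y z => by
      ext1 w
      simp only [derFun, LinearMap.coe_mk, AddHom.coe_mk, LinearMap.add_apply, mul_add, add_mul,
        sub_mul, mul_sub, smul_add, smul_sub]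
      abel)
    (fun r x y => by
      ext1 w
      simp only [derFun, LinearMap.coe_mk, AddHom.coe_mk, LinearMap.smul_apply, mul_smul_comm,
        smul_mul_assoc, smul_sub, smul_comm r (3 : ℝ), sub_mul, mul_sub])

theorem derBil_apply {ε : ℝ} (x y z : CD ε) : derBil ε x y z =
    (x * y - y * x) * z - z * (x * y - y * x) - (3 : ℝ) • ((x * y) * z - x * (y * z)) := rfl


theorem CD.star_mul_mul {ε : ℝ} (x z : CD ε) : star x * (x * z) =
    (Quaternion.normSq x.fst - ε * Quaternion.normSq x.snd) • z := by
  have h₁ : ∀ a c : Quaternion ℝ, star a * (a * c) = Quaternion.normSq a • c := fun a c => by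
    rw [← mul_assoc, Quaternion.star_mul_self, Quaternion.coe_mul_eq_smul]
  have h₂ : ∀ a c : Quaternion ℝ, a * (star a * c) = Quaternion.normSq a • c := fun a c => by
    rw [← mul_assoc, Quaternion.self_mul_star, Quaternion.coe_mul_eq_smul]
  have h₃ : ∀ a : Quaternion ℝ, star a * a = Quaternion.normSq a • (1 : Quaternion ℝ) := fun a => by
    simpa using h₁ a 1
  have h₄ : ∀ a : Quaternion ℝ, a * star a = Quaternion.normSq a • (1 : Quaternion ℝ) := fun a => by
    simpa using h₂ a 1
  ext1 <;> simp [mul_add, add_mul, mul_assoc, h₁, h₂, h₃, h₄, sub_smul, mul_smul] <;> abel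

theorem CD.alt_left' {ε : ℝ} (x z : CD ε) : (x * x) * z = x * (x * z) := by
  have hs : x = (2 * x.fst.re) • (1 : CD ε) - star x := by
    ext1
    · simp [Quaternion.star_eq_two_re_sub, ← Quaternion.coe_mul_eq_smul]
    · simp
  have h1 := CD.star_mul_mul x 1
  rw [mul_one] at h1
  conv_lhs => rw [show x * x = ((2 * x.fst.re) • (1 : CD ε) - star x) * x by rw [← hs]]
  conv_rhs => rw [show x * (x * z) = ((2 * x.fst.re) • (1 : CD ε) - star x) * (x * z) by rw [← hs]]
  rw [sub_mul, sub_mul, sub_mul, h1, CD.star_mul_mul]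
  simp only [smul_mul_assoc, one_mul]

theorem CD.alt_left {ε : ℝ} (x y z : CD ε) :
    (x * y) * z - x * (y * z) + ((y * x) * z - y * (x * z)) = 0 := by
  have h1 := CD.alt_left' x z
  have h2 := CD.alt_left' y z
  have h3 := CD.alt_left' (x + y) z
  simp only [add_mul, mul_add, h1, h2] at h3
  linear_combination (norm := abel) h3

theorem CD.alt_right {ε : ℝ} (x y z : CD ε) :
    (x * y) * z - x * (y * z) + ((x * z) * y - x * (z * y)) = 0 := by
  have := congrArg star (CD.alt_left (star y) (star z) (star x))
  simp only [star_add, star_sub, star_mul, star_star, star_zero] at this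
  rw [← neg_eq_zero, ← this]; abel

theorem derBil_mem {ε : ℝ} (x y : CD ε) : derBil ε x y ∈ derAlg ε := by
  intro z w
  have L := @CD.alt_left ε
  have R := @CD.alt_right ε
  have Ll : ∀ w x y z : CD ε, w * ((x * y) * z) - w * (x * (y * z)) + (w * ((y * x) * z) - w * (y * (x * z))) = 0 := fun w x y z => by
    rw [← mul_sub, ← mul_sub, ← mul_add, L, mul_zero]
  have Rl : ∀ w x y z : CD ε, w * ((x * y) * z) - w * (x * (y * z)) + (w * ((x * z) * y) - w * (x * (z * y))) = 0 := fun w x y z => by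
    rw [← mul_sub, ← mul_sub, ← mul_add, R, mul_zero]
  have Lr : ∀ x y z w : CD ε, (x * y) * z * w - x * (y * z) * w + ((y * x) * z * w - y * (x * z) * w) = 0 := fun x y z w => by
    rw [← sub_mul, ← sub_mul, ← add_mul, L, zero_mul]
  simp only [derBil_apply, mul_sub, sub_mul, mul_smul_comm, smul_mul_assoc]
  linear_combination (norm := module) -(3/2 : ℝ) • L (y*z) x w -(3/2 : ℝ) • L x y (z*w) +(1/2 : ℝ) • L z (x*y) w +(3/2 : ℝ) • L (x*z) y w +(3/2 : ℝ) • Ll x z w y -(3/2 : ℝ) • Rl x w z y +(3/2 : ℝ) • Ll y x z w -(1 : ℝ) • R z w (x*y) +(3/2 : ℝ) • Lr y z x w -(1/2 : ℝ) • L (y*x) z w -(3/2 : ℝ) • Rl x y z w +(3/2 : ℝ) • Ll x y w z +(3/2 : ℝ) • Lr y x z w +(3/2 : ℝ) • Ll z y x w -(3/2 : ℝ) • Rl x z y w +(3/2 : ℝ) • L z x (y*w) -(3/2 : ℝ) • L x (z*y) w -(3/2 : ℝ) • L y z (x*w) -(3/2 : ℝ) • Lr z x y w +(3/2 : ℝ)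 • L (z*x) y w +(1 : ℝ) • R z (y*x) w
/-- The standard inner derivation `D_{x,y}`, bilinear in `x, y`. -/
def innerDer (ε : ℝ) : CD ε →ₗ[ℝ] CD ε →ₗ[ℝ] derAlg ε :=
  LinearMap.mk₂ ℝ (fun x y => ⟨derBil ε x y, derBil_mem x y⟩)
    (fun x y z => Subtype.ext (by simp)) (fun r x y => Subtype.ext (by simp))
    (fun x y z => Subtype.ext (by simp)) (fun r x y => Subtype.ext (by simp))

/-- The commutator of two derivations. -/
def derComm {ε : ℝ} (D E : derAlg ε) : derAlg ε :=
  ⟨D.1 * E.1 - E.1 * D.1, derAlg_comm D.2 E.2⟩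

/-- The bilinear form `(x, y) ↦ Re (x y)`. -/
def reMul (ε : ℝ) : CD ε →ₗ[ℝ] CD ε →ₗ[ℝ] ℝ :=
  LinearMap.mk₂ ℝ (fun x y => (x * y).fst.re)
    (fun x y z => by simp only [add_mul, CD.add_fst, Quaternion.re_add])
    (fun r x y => by simp only [smul_mul_assoc, CD.smul_fst, Quaternion.re_smul])
    (fun x y z => by simp only [mul_add, CD.add_fst, Quaternion.re_add])
    (fun r x y => by simp only [mul_smul_comm, CD.smul_fst, Quaternion.re_smul])

theorem der_one {ε : ℝ} {D : Module.End ℝ (CD ε)} (hD : D ∈ derAlg ε) : D 1 = 0 := by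
  have h := hD 1 1
  rw [mul_one, mul_one, one_mul] at h
  simpa using h

theorem CD.add_star {ε : ℝ} (x : CD ε) : x + star x = (2 * x.fst.re) • (1 : CD ε) := by
  ext1
  · simp [Quaternion.star_eq_two_re_sub, ← Quaternion.coe_mul_eq_smul]
  · simp

theorem CD.mul_add_mul {ε : ℝ} (x y : CD ε) (hx : x.fst.re = 0) :
    ∃ r : ℝ, x * y + y * x = r • (1 : CD ε) + (2 * y.fst.re) • x := by
  refine ⟨(x * y + y * x).fst.re, ?_⟩
  apply CD.ext
  · simp only [CD.add_fst, CD.smul_fst, CD.one_fst, CD.mul_fst]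
    ext <;> simp [hx, Quaternion.re_one, Quaternion.imI_one, Quaternion.imJ_one,
      Quaternion.imK_one] <;> ring
  · simp only [CD.add_snd, CD.smul_snd, CD.one_snd, CD.mul_snd]
    ext <;> simp [hx] <;> ring

theorem der_re {ε : ℝ} {D : Module.End ℝ (CD ε)} (hD : D ∈ derAlg ε) (x : CD ε) :
    (D x).fst.re = 0 := by
  obtain ⟨y, hy, hxy⟩ : ∃ y : CD ε, y.fst.re = 0 ∧ D x = D y := by
    refine ⟨x - x.fst.re • (1 : CD ε), ?_, ?_⟩
    · simp [Quaternion.re_one]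
    · rw [map_sub, map_smul, der_one hD, smul_zero, sub_zero]
  rw [hxy]
  obtain ⟨r, hr⟩ := CD.mul_add_mul y y hy
  obtain ⟨s, hs⟩ := CD.mul_add_mul y (D y) hy
  have h := congrArg D hr
  rw [hy, mul_zero, zero_smul, add_zero, map_smul, der_one hD, smul_zero, map_add, hD y y,
    add_comm (D y * y), hs, ← two_smul ℝ, smul_eq_zero_iff_right two_ne_zero] at h
  have h0 : s = 0 := by
    have := congrArg (fun z : CD ε => z.fst.re) h
    simpa [hy, Quaternion.re_one, Quaternion.re_zero] using this
  rw [h0, zero_smul, zero_add, smul_eq_zero] at h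
  rcases h with h | h
  · simpa using h
  · rw [h, map_zero]; rfl

theorem der_star {ε : ℝ} {D : Module.End ℝ (CD ε)} (hD : D ∈ derAlg ε) (x : CD ε) :
    D (star x) = star (D x) := by
  have h := congrArg D (CD.add_star x)
  have h' := CD.add_star (D x)
  rw [map_add, map_smul, der_one hD, smul_zero] at h
  rw [der_re hD, mul_zero, zero_smul] at h'
  exact add_left_cancel (h.trans h'.symm)

/-! ### The Lie algebra `𝔢₈ = 𝔰𝔲(3, 𝕆' ⊗ 𝕆)` -/

/-- `𝕆' ⊗ 𝕆`, with conjugation `star (a ⊗ b) = star a ⊗ star b`. -/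
abbrev OO := SplitOct ⊗[ℝ] Oct

/-- `3 × 3` matrices. -/
abbrev Mat3 (A : Type) := Matrix (Fin 3) (Fin 3) A

/-- The tracefree anti-Hermitian `3 × 3` matrices over `𝕆' ⊗ 𝕆`. -/
def sa3 : Submodule ℝ (Mat3 OO) where
  carrier := {A | Aᴴ = -A ∧ A.trace = 0}
  add_mem' {A B} hA hB := ⟨by rw [Matrix.conjTranspose_add, hA.1, hB.1, neg_add],
    by rw [Matrix.trace_add, hA.2, hB.2, add_zero]⟩
  zero_mem' := ⟨by simp, by simp⟩
  smul_mem' r A hA := ⟨by rw [Matrix.conjTranspose_smul, hA.1, star_trivial, smul_neg],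
    by rw [Matrix.trace_smul, hA.2, smul_zero]⟩

/-- The tracefree part `A - (tr A / 3) 𝓘` of a square matrix. -/
def tracefree {R : Type} [AddCommGroup R] [Module ℝ R] (A : Mat3 R) : Mat3 R :=
  A - Matrix.diagonal (fun _ => (1 / 3 : ℝ) • A.trace)

theorem trace_tracefree {R : Type} [AddCommGroup R] [Module ℝ R] (A : Mat3 R) :
    (tracefree A).trace = 0 := by
  rw [tracefree, Matrix.trace_sub, Matrix.trace_diagonal, Finset.sum_const, Finset.card_univ,
    Fintype.card_fin]
  module

theorem conjTranspose_tracefree {A : Mat3 OO} (hA : Aᴴ = -A) :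
    (tracefree A)ᴴ = -tracefree A := by
  have h : star A.trace = -A.trace := by
    rw [← Matrix.trace_conjTranspose, hA, Matrix.trace_neg]
  rw [tracefree, Matrix.conjTranspose_sub, Matrix.diagonal_conjTranspose, hA, neg_sub]
  have : star (fun _ : Fin 3 => (1 / 3 : ℝ) • A.trace) = fun _ => -((1 / 3 : ℝ) • A.trace) := by
    funext i
    rw [Pi.star_apply, star_smul, h, star_trivial, smul_neg]
  rw [this, ← Matrix.diagonal_neg]
  abel

/-- The tracefree part `(A B - B A)'` of the matrix commutator. -/
def matComm (A B : sa3) : sa3 :=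
  ⟨tracefree (A.1 * B.1 - B.1 * A.1), conjTranspose_tracefree (by
    rw [Matrix.conjTranspose_sub, Matrix.conjTranspose_mul, Matrix.conjTranspose_mul, A.2.1, B.2.1]
    simp), trace_tracefree _⟩

/-- The action of a pair of derivations on `𝕆' ⊗ 𝕆`. -/
def derTensor (D : derAlg 1) (E : derAlg (-1)) : OO →ₗ[ℝ] OO :=
  TensorProduct.map D.1 LinearMap.id + TensorProduct.map LinearMap.id E.1

theorem derTensor_star (D : derAlg 1) (E : derAlg (-1)) (x : OO) :
    derTensor D E (star x) = star (derTensor D E x) := by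
  induction x using TensorProduct.induction_on with
  | zero => simp
  | tmul a b => simp [derTensor, der_star D.2, der_star E.2]
  | add x y hx hy => rw [star_add, map_add, hx, hy, map_add, star_add]

/-- The entrywise action of a pair of derivations on matrices. -/
def derMat (D : derAlg 1) (E : derAlg (-1)) (A : sa3) : sa3 :=
  ⟨A.1.map (derTensor D E), by
    ext i j
    have h := congrFun (congrFun A.2.1 i) j
    simp only [Matrix.conjTranspose_apply, Matrix.neg_apply] at h
    simp only [Matrix.conjTranspose_apply, Matrix.neg_apply, Matrix.map_apply,
      ← derTensor_star, h, map_neg], by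
    have h := congrArg (derTensor D E) A.2.2
    simpa [Matrix.trace, map_sum] using h⟩

/-- `(a ⊗ b, c ⊗ d) ↦ Re (b d) D_{a,c}`. -/
def leftDer (δ ε : ℝ) : CD δ ⊗[ℝ] CD ε →ₗ[ℝ] CD δ ⊗[ℝ] CD ε →ₗ[ℝ] derAlg δ :=
  (TensorProduct.map₂ (innerDer δ) (reMul ε)).compr₂ (TensorProduct.rid ℝ (derAlg δ)).toLinearMap

/-- `(a ⊗ b, c ⊗ d) ↦ Re (a c) D_{b,d}`. -/
def rightDer (δ ε : ℝ) : CD δ ⊗[ℝ] CD ε →ₗ[ℝ] CD δ ⊗[ℝ] CD ε →ₗ[ℝ] derAlg ε :=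
  (TensorProduct.map₂ (reMul δ) (innerDer ε)).compr₂ (TensorProduct.lid ℝ (derAlg ε)).toLinearMap

/-- The underlying vector space of `𝔢₈`: tracefree anti-Hermitian `3 × 3` matrices over
`𝕆' ⊗ 𝕆`, together with `𝔤₂₍₂₎ = Der 𝕆'` and `𝔤₂ = Der 𝕆`. -/
abbrev E8 := sa3 × derAlg 1 × derAlg (-1)

/-- Vinberg's bracket. Derivations act entrywise on matrices, and
`[A, B] = (A B - B A)' + (1/3) ∑ᵢⱼ D(aᵢⱼ, bⱼᵢ)` for matrices `A`, `B`, where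
`D(a ⊗ b, c ⊗ d) = Re (b d) D_{a,c} + Re (a c) D_{b,d}`. -/
def e8Fun (x y : E8) : E8 :=
  (matComm x.1 y.1 + derMat x.2.1 x.2.2 y.1 - derMat y.2.1 y.2.2 x.1,
   derComm x.2.1 y.2.1 + (1 / 3 : ℝ) • ∑ i, ∑ j, leftDer 1 (-1) (x.1.1 i j) (y.1.1 j i),
   derComm x.2.2 y.2.2 + (1 / 3 : ℝ) • ∑ i, ∑ j, rightDer 1 (-1) (x.1.1 i j) (y.1.1 j i))

theorem tracefree_add {R : Type} [AddCommGroup R] [Module ℝ R] (A B : Mat3 R) :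
    tracefree (A + B) = tracefree A + tracefree B := by
  ext i j
  by_cases h : i = j
  · subst h; simp [tracefree]; abel
  · simp [tracefree, h]

theorem tracefree_smul {R : Type} [AddCommGroup R] [Module ℝ R] (r : ℝ) (A : Mat3 R) :
    tracefree (r • A) = r • tracefree A := by
  ext i j
  by_cases h : i = j
  · subst h; simp [tracefree, smul_sub, smul_comm r]
  · simp [tracefree, h]

theorem matComm_add_left (A B C : sa3) : matComm (A + B) C = matComm A C + matComm B C := by
  apply Subtype.ext
  simp only [matComm, Submodule.coe_add, ← tracefree_add]
  congr 1
  rw [add_mul, mul_add]; abel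

theorem matComm_add_right (A B C : sa3) : matComm A (B + C) = matComm A B + matComm A C := by
  apply Subtype.ext
  simp only [matComm, Submodule.coe_add, ← tracefree_add]
  congr 1
  rw [add_mul, mul_add]; abel

theorem matComm_smul_left (r : ℝ) (A B : sa3) : matComm (r • A) B = r • matComm A B := by
  apply Subtype.ext
  simp only [matComm, Submodule.coe_smul, ← tracefree_smul]
  congr 1
  rw [Matrix.smul_mul, Matrix.mul_smul, smul_sub]

theorem matComm_smul_right (r : ℝ) (A B : sa3) : matComm A (r • B) = r • matComm A B := by
  apply Subtype.ext
  simp only [matComm, Submodule.coe_smul, ← tracefree_smul]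
  congr 1
  rw [Matrix.smul_mul, Matrix.mul_smul, smul_sub]

theorem derMat_add_left (D D' : derAlg 1) (E E' : derAlg (-1)) (A : sa3) :
    derMat (D + D') (E + E') A = derMat D E A + derMat D' E' A := by
  apply Subtype.ext
  ext i j
  simp only [derMat, derTensor, Submodule.coe_add, Matrix.map_apply, Matrix.add_apply,
    LinearMap.add_apply, TensorProduct.map_add_left, TensorProduct.map_add_right]
  abel

theorem derMat_smul_left (r : ℝ) (D : derAlg 1) (E : derAlg (-1)) (A : sa3) :
    derMat (r • D) (r • E) A = r • derMat D E A := by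
  apply Subtype.ext
  ext i j
  simp only [derMat, derTensor, Submodule.coe_smul, Matrix.map_apply, Matrix.smul_apply,
    LinearMap.add_apply, LinearMap.smul_apply, TensorProduct.map_smul_left,
    TensorProduct.map_smul_right, smul_add]

theorem derMat_add_right (D : derAlg 1) (E : derAlg (-1)) (A B : sa3) :
    derMat D E (A + B) = derMat D E A + derMat D E B := by
  apply Subtype.ext
  ext i j
  simp only [derMat, Submodule.coe_add, Matrix.map_apply, Matrix.add_apply, map_add]

theorem derMat_smul_right (r : ℝ) (D : derAlg 1) (E : derAlg (-1)) (A : sa3) :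
    derMat D E (r • A) = r • derMat D E A := by
  apply Subtype.ext
  ext i j
  simp only [derMat, Submodule.coe_smul, Matrix.map_apply, Matrix.smul_apply, map_smul]

theorem derComm_add_left {ε : ℝ} (D E F : derAlg ε) :
    derComm (D + E) F = derComm D F + derComm E F := by
  apply Subtype.ext
  simp only [derComm, Submodule.coe_add, add_mul, mul_add]
  abel

theorem derComm_add_right {ε : ℝ} (D E F : derAlg ε) :
    derComm D (E + F) = derComm D E + derComm D F := by
  apply Subtype.ext
  simp only [derComm, Submodule.coe_add, add_mul, mul_add]
  abel

theorem derComm_smul_left {ε : ℝ} (r : ℝ) (D E : derAlg ε) :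
    derComm (r • D) E = r • derComm D E := by
  apply Subtype.ext
  simp only [derComm, Submodule.coe_smul, smul_mul_assoc, mul_smul_comm, smul_sub]

theorem derComm_smul_right {ε : ℝ} (r : ℝ) (D E : derAlg ε) :
    derComm D (r • E) = r • derComm D E := by
  apply Subtype.ext
  simp only [derComm, Submodule.coe_smul, smul_mul_assoc, mul_smul_comm, smul_sub]

/-- The bracket `e8Fun` as a bilinear map. -/
def e8Bracket : E8 →ₗ[ℝ] E8 →ₗ[ℝ] E8 :=
  LinearMap.mk₂ ℝ e8Fun
    (fun x y z => by
      refine Prod.ext ?_ (Prod.ext ?_ ?_)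
      · simp only [e8Fun, Prod.fst_add, Prod.snd_add, matComm_add_left, derMat_add_left,
          derMat_add_right]
        abel
      · simp only [e8Fun, Prod.fst_add, Prod.snd_add, derComm_add_left, Submodule.coe_add,
          Matrix.add_apply, map_add, LinearMap.add_apply, Finset.sum_add_distrib, smul_add]
        abel
      · simp only [e8Fun, Prod.fst_add, Prod.snd_add, derComm_add_left, Submodule.coe_add,
          Matrix.add_apply, map_add, LinearMap.add_apply, Finset.sum_add_distrib, smul_add]
        abel)
    (fun r x y => by
      refine Prod.ext ?_ (Prod.ext ?_ ?_)
      · simp only [e8Fun, Prod.smul_fst, Prod.smul_snd, matComm_smul_left, derMat_smul_left,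
          derMat_smul_right, smul_sub, smul_add]
      · simp only [e8Fun, Prod.smul_fst, Prod.smul_snd, derComm_smul_left, Submodule.coe_smul,
          Matrix.smul_apply, map_smul, LinearMap.smul_apply, ← Finset.smul_sum, smul_add,
          smul_comm r (1 / 3 : ℝ)]
      · simp only [e8Fun, Prod.smul_fst, Prod.smul_snd, derComm_smul_left, Submodule.coe_smul,
          Matrix.smul_apply, map_smul, LinearMap.smul_apply, ← Finset.smul_sum, smul_add,
          smul_comm r (1 / 3 : ℝ)])
    (fun x y z => by
      refine Prod.ext ?_ (Prod.ext ?_ ?_)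
      · simp only [e8Fun, Prod.fst_add, Prod.snd_add, matComm_add_right, derMat_add_left,
          derMat_add_right]
        abel
      · simp only [e8Fun, Prod.fst_add, Prod.snd_add, derComm_add_right, Submodule.coe_add,
          Matrix.add_apply, map_add, Finset.sum_add_distrib, smul_add]
        abel
      · simp only [e8Fun, Prod.fst_add, Prod.snd_add, derComm_add_right, Submodule.coe_add,
          Matrix.add_apply, map_add, Finset.sum_add_distrib, smul_add]
        abel)
    (fun r x y => by
      refine Prod.ext ?_ (Prod.ext ?_ ?_)
      · simp only [e8Fun, Prod.smul_fst, Prod.smul_snd, matComm_smul_right, derMat_smul_left,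
          derMat_smul_right, smul_sub, smul_add]
      · simp only [e8Fun, Prod.smul_fst, Prod.smul_snd, derComm_smul_right, Submodule.coe_smul,
          Matrix.smul_apply, map_smul, ← Finset.smul_sum, smul_add, smul_comm r (1 / 3 : ℝ)]
      · simp only [e8Fun, Prod.smul_fst, Prod.smul_snd, derComm_smul_right, Submodule.coe_smul,
          Matrix.smul_apply, map_smul, ← Finset.smul_sum, smul_add, smul_comm r (1 / 3 : ℝ)])

instance : Bracket E8 E8 := ⟨fun x y => e8Bracket x y⟩

/-! ### Diagonal and nested elements -/

/-- For `q ∈ Im 𝕆'`, the diagonal matrix with entries `a₀ q, a₁ q, a₂ q`, where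
`a₀ + a₁ + a₂ = 0`. -/
def diagElt (a : Fin 3 → ℝ) (ha : ∑ i, a i = 0) (q : SplitOct) : E8 :=
  (⟨Matrix.diagonal (fun i => a i • (q.imPart ⊗ₜ[ℝ] (1 : Oct))), by
    rw [Matrix.diagonal_conjTranspose, Matrix.diagonal_neg]
    congr 1
    funext i
    rw [Pi.star_apply, star_smul, TensorProduct.star_tmul, CD.star_imPart, star_one,
      TensorProduct.neg_tmul, smul_neg, star_trivial], by
    rw [Matrix.trace_diagonal, ← Finset.sum_smul, ha, zero_smul]⟩, 0, 0)

/-- `D_q = diag(q, -q, 0)`. -/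
def D (q : SplitOct) : E8 := diagElt ![1, -1, 0] (by simp [Fin.sum_univ_three]) q

/-- `E_q = diag(0, q, -q)`. -/
def E (q : SplitOct) : E8 := diagElt ![0, 1, -1] (by simp [Fin.sum_univ_three]) q

/-- `F_q = diag(-q, 0, q)`. -/
def F (q : SplitOct) : E8 := diagElt ![-1, 0, 1] (by simp [Fin.sum_univ_three]) q

/-- The nested multiple `(p ∘ q) 𝓘` of the identity matrix, defined by
`2 (p ∘ q) 𝓘 = D_{p,q} + E_{p,q} + F_{p,q}` with `D_{p,q} = [D_p, D_q] / 2`,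
`E_{p,q} = [E_p, E_q] / 2` and `F_{p,q} = [F_p, F_q] / 2`. -/
def nested (p q : SplitOct) : E8 :=
  (1 / 2 : ℝ) • ((1 / 2 : ℝ) • ⁅D p, D q⁆ + (1 / 2 : ℝ) • ⁅E p, E q⁆ + (1 / 2 : ℝ) • ⁅F p, F q⁆)

open SplitOct

/-- `G_Q = -2 (QL ∘ L) 𝓘`, for imaginary `Q` orthogonal to `L`. -/
def G (Q : SplitOct) : E8 := (-2 : ℝ) • nested (Q * L) L

/-- `G_L`, which acts on `Im 𝕆'` with eigenvalues `±4` on `K_±` and `∓2` on `I_±` and `J_±`. -/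
def G_L : E8 := (2 : ℝ) • nested K KL

/-- The elements `A_Q` of `𝔤₂₍₂₎`, which annihilate `L`. -/
def A_I : E8 := (2 / 3 : ℝ) • (nested J K - nested JL KL)
def A_J : E8 := (2 / 3 : ℝ) • (nested K I - nested KL IL)
def A_K : E8 := (2 / 3 : ℝ) • (nested I J - nested IL JL)
def A_IL : E8 := (-2 / 3 : ℝ) • (nested J KL - nested JL K)
def A_JL : E8 := (-2 / 3 : ℝ) • (nested K IL - nested KL I)
def A_KL : E8 := (-2 / 3 : ℝ) • (nested I JL - nested IL J)

/-- `A_L`, which acts on `Im 𝕆'` with eigenvalues `∓2` on `I_±`, `±2` on `J_±` and `0` on `K_±`. -/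
def A_L : E8 := (-2 / 3 : ℝ) • (nested I IL - nested J JL)

/-- `A_{I_±} = (A_I ± A_{IL}) / 2`, and likewise for `J`, `K`. -/
def A_Ip : E8 := (1 / 2 : ℝ) • (A_I + A_IL)
def A_Im : E8 := (1 / 2 : ℝ) • (A_I - A_IL)
def A_Jp : E8 := (1 / 2 : ℝ) • (A_J + A_JL)
def A_Jm : E8 := (1 / 2 : ℝ) • (A_J - A_JL)
def A_Kp : E8 := (1 / 2 : ℝ) • (A_K + A_KL)
def A_Km : E8 := (1 / 2 : ℝ) • (A_K - A_KL)

/-! ### The Albert algebra -/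

/-- The Albert algebra `H₃(𝕆)` of Hermitian `3 × 3` octonionic matrices. -/
def albert : Submodule ℝ (Mat3 Oct) where
  carrier := {X | Xᴴ = X}
  add_mem' {X Y} hX hY := by
    change (X + Y)ᴴ = X + Y
    rw [Matrix.conjTranspose_add, show Xᴴ = X from hX, show Yᴴ = Y from hY]
  zero_mem' := by simp
  smul_mem' r X hX := by
    change (r • X)ᴴ = r • X
    rw [Matrix.conjTranspose_smul, show Xᴴ = X from hX, star_trivial]

/-- The Albert algebra as a type. -/
abbrev H3 := ↥albert

/-- The (real) trace. -/
def tr : H3 →ₗ[ℝ] ℝ where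
  toFun X := X.1.trace.fst.re
  map_add' X Y := by simp
  map_smul' r X := by simp

/-- The identity matrix `𝓘`. -/
def one3 : H3 := ⟨1, Matrix.conjTranspose_one⟩

/-- The Jordan product `X ∘ Y = (X Y + Y X) / 2`. -/
def jordan (X Y : H3) : H3 :=
  ⟨(1 / 2 : ℝ) • (X.1 * Y.1 + Y.1 * X.1), by
    change _ᴴ = _
    rw [Matrix.conjTranspose_smul, Matrix.conjTranspose_add, Matrix.conjTranspose_mul,
      Matrix.conjTranspose_mul, show X.1ᴴ = X.1 from X.2, show Y.1ᴴ = Y.1 from Y.2,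
      star_trivial, add_comm]⟩

/-- The Freudenthal product `X * Y`. -/
def freud (X Y : H3) : H3 :=
  jordan X Y - (1 / 2 : ℝ) • (tr X • Y + tr Y • X) +
    ((1 / 2 : ℝ) * (tr X * tr Y - tr (jordan X Y))) • one3

/-! ### `𝔢₆` and Freudenthal's description of `𝔢₇` -/

/-- Tracefree `3 × 3` octonionic matrices: the sum of the boosts (Hermitian) and the rotations
(anti-Hermitian). -/
def boostRot : Submodule ℝ (Mat3 Oct) where
  carrier := {M | M.trace = 0}
  add_mem' {M N} hM hN := by
    change (M + N).trace = 0
    rw [Matrix.trace_add, show M.trace = 0 from hM, show N.trace = 0 from hN, add_zero]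
  zero_mem' := by simp
  smul_mem' r M hM := by
    change (r • M).trace = 0
    rw [Matrix.trace_smul, show M.trace = 0 from hM, smul_zero]

/-- `𝔢₆₍₋₂₆₎`: boosts, rotations, and derivations of `𝕆`. -/
abbrev E6 := boostRot × derAlg (-1)

/-- The action of `𝔢₆` on the Albert algebra: `X ↦ M X + X M†` for boosts and rotations `M`,
and entrywise for derivations. -/
def e6Act (φ : E6) (X : H3) : H3 :=
  ⟨φ.1.1 * X.1 + X.1 * φ.1.1ᴴ + X.1.map φ.2.1, by
    change _ᴴ = _
    have hX : X.1ᴴ = X.1 := X.2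
    have h : (X.1.map φ.2.1)ᴴ = X.1.map φ.2.1 := by
      refine Matrix.ext fun i j => ?_
      have h := congrFun (congrFun hX i) j
      rw [Matrix.conjTranspose_apply] at h
      rw [Matrix.conjTranspose_apply, Matrix.map_apply, Matrix.map_apply, ← der_star φ.2.2, h]
    rw [Matrix.conjTranspose_add, Matrix.conjTranspose_add, Matrix.conjTranspose_mul,
      Matrix.conjTranspose_mul, Matrix.conjTranspose_conjTranspose, hX, h,
      add_comm (X.1 * φ.1.1ᴴ)]⟩

/-- The dual `φ'`: `M' = -M†` for boosts and rotations, `D' = D` for derivations. -/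
def e6Dual (φ : E6) : E6 :=
  (⟨-φ.1.1ᴴ, by
    change (-φ.1.1ᴴ).trace = 0
    rw [Matrix.trace_neg, Matrix.trace_conjTranspose, show φ.1.1.trace = 0 from φ.1.2,
      star_zero, neg_zero]⟩, φ.2)

/-- Freudenthal's elements `Θ = (φ, ρ, A, B)` of `𝔢₇`. -/
abbrev Theta := E6 × ℝ × H3 × H3

/-- Freudenthal's elements `𝒫 = (X, Y, p, q)` of the minimal representation of `𝔢₇`. -/
abbrev Tower := H3 × H3 × ℝ × ℝ

/-- Freudenthal's action of `𝔢₇` on its minimal representation. -/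
def freudAct : Theta → Tower → Tower := fun (φ, ρ, A, B) (X, Y, p, q) =>
  (e6Act φ X + (1 / 3 * ρ) • X + (2 : ℝ) • freud B Y + q • A,
   (2 : ℝ) • freud A X + e6Act (e6Dual φ) Y - (1 / 3 * ρ) • Y + p • B,
   tr (jordan A Y) - ρ * p,
   tr (jordan B X) + ρ * q)

/-! ### The identification inside `𝔢₈` -/

/-- The octonionic matrix `M` with the label `Q`, that is, the matrix with entries `Q ⊗ mᵢⱼ`. -/
def label (Q : SplitOct) (M : Mat3 Oct) : Mat3 OO := M.map (fun m => Q ⊗ₜ[ℝ] m)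

theorem trace_label (Q : SplitOct) (M : Mat3 Oct) : (label Q M).trace = Q ⊗ₜ[ℝ] M.trace := by
  simp [Matrix.trace, label, TensorProduct.tmul_sum]

theorem conjTranspose_label (Q : SplitOct) (M : Mat3 Oct) :
    (label Q M)ᴴ = label (star Q) Mᴴ := by
  ext i j
  simp [label]

theorem label_neg_left (Q : SplitOct) (M : Mat3 Oct) : label (-Q) M = -label Q M := by
  ext i j
  simp [label, TensorProduct.neg_tmul]

theorem label_neg_right (Q : SplitOct) (M : Mat3 Oct) : label Q (-M) = -label Q M := by
  ext i j
  simp [label, TensorProduct.tmul_neg]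

theorem label_zero (Q : SplitOct) : label Q 0 = 0 := by
  ext i j
  simp [label]

theorem label_add (Q : SplitOct) (M N : Mat3 Oct) : label Q (M + N) = label Q M + label Q N := by
  ext i j
  simp [label, TensorProduct.tmul_add]

theorem label_smul (Q : SplitOct) (r : ℝ) (M : Mat3 Oct) : label Q (r • M) = r • label Q M := by
  ext i j
  simp [label]

theorem conjTranspose_tracefree_herm {M : Mat3 Oct} (hM : Mᴴ = M) :
    (tracefree M)ᴴ = tracefree M := by
  have h : star M.trace = M.trace := by
    rw [← Matrix.trace_conjTranspose, hM]
  rw [tracefree, Matrix.conjTranspose_sub, Matrix.diagonal_conjTranspose, hM]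
  congr 2
  funext i
  rw [Pi.star_apply, star_smul, h, star_trivial]

/-- The matrix `Q X₀`, for imaginary `Q`, where `X₀` is the tracefree part of `X`. -/
def labMat (Q : SplitOct) : H3 →ₗ[ℝ] sa3 where
  toFun X := ⟨label Q.imPart (tracefree X.1), by
    rw [conjTranspose_label, CD.star_imPart, label_neg_left, conjTranspose_tracefree_herm X.2], by
    rw [trace_label, trace_tracefree, TensorProduct.tmul_zero]⟩
  map_add' X Y := Subtype.ext (by
    simp only [Submodule.coe_add, tracefree_add, label_add])
  map_smul' r X := Subtype.ext (by
    simp only [Submodule.coe_smul, tracefree_smul, label_smul, RingHom.id_apply])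

/-- The copy of the Albert algebra with label `Q`, for imaginary `Q` orthogonal to `L`:
`Q X = Q X₀ + (tr X / 3) (Q 𝓘)`, where the matrix `Q 𝓘` is interpreted as `-G_Q / 2`. -/
def lab (Q : SplitOct) : H3 →ₗ[ℝ] E8 where
  toFun X := (labMat Q X, 0, 0) + (1 / 3 * tr X) • ((-1 / 2 : ℝ) • G Q)
  map_add' X Y := by
    have h : ((labMat Q (X + Y), 0, 0) : E8) = (labMat Q X, 0, 0) + (labMat Q Y, 0, 0) := by
      simp
    rw [h, map_add]
    module
  map_smul' r X := by
    have h : ((labMat Q (r • X), 0, 0) : E8) = r • (labMat Q X, 0, 0) := by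
      simp
    rw [h, map_smul, RingHom.id_apply, smul_eq_mul]
    module

/-- The element `φ₀` of `𝔢₈` for `φ ∈ 𝔢₆`: a rotation `M` is sent to `M`, a boost `M` to `L M`,
and a derivation of `𝕆` to itself. -/
def phi0 : E6 →ₗ[ℝ] E8 where
  toFun φ := (⟨label 1 ((1 / 2 : ℝ) • (φ.1.1 - φ.1.1ᴴ)) + label L ((1 / 2 : ℝ) • (φ.1.1 + φ.1.1ᴴ)),
    by
      have hL : star L = -L := by ext <;> simp [L]
      rw [Matrix.conjTranspose_add, conjTranspose_label, conjTranspose_label, hL, star_one,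
        Matrix.conjTranspose_smul, Matrix.conjTranspose_smul, Matrix.conjTranspose_sub,
        Matrix.conjTranspose_add, Matrix.conjTranspose_conjTranspose, label_neg_left,
        star_trivial, ← neg_sub φ.1.1, smul_neg, label_neg_right, add_comm φ.1.1ᴴ, neg_add],
    by
      have h : φ.1.1.trace = 0 := φ.1.2
      rw [Matrix.trace_add, trace_label, trace_label, Matrix.trace_smul, Matrix.trace_smul,
        Matrix.trace_sub, Matrix.trace_add, Matrix.trace_conjTranspose, h]
      simp⟩, 0, φ.2)
  map_add' φ ψ := by
    refine Prod.ext (Subtype.ext ?_) (Prod.ext ?_ rfl)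
    · simp only [Prod.fst_add, Submodule.coe_add, Matrix.conjTranspose_add, label_smul, label_add,
        sub_eq_add_neg, label_neg_right, neg_add]
      module
    · simp
  map_smul' r φ := by
    refine Prod.ext (Subtype.ext ?_) (Prod.ext ?_ rfl)
    · simp only [Prod.smul_fst, Submodule.coe_smul, Matrix.conjTranspose_smul, label_smul,
        label_add, sub_eq_add_neg, label_neg_right, star_trivial, RingHom.id_apply]
      module
    · simp

/-- `Θ₀ = φ₀ + (ρ / 6) G_L + K₋ A - K₊ B`. -/
def theta0 : Theta →ₗ[ℝ] E8 where
  toFun Θ := phi0 Θ.1 + (1 / 6 * Θ.2.1) • G_L + lab Km Θ.2.2.1 - lab Kp Θ.2.2.2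
  map_add' Θ Θ' := by
    simp only [Prod.fst_add, Prod.snd_add, map_add]; module
  map_smul' r Θ := by
    simp only [Prod.smul_fst, Prod.smul_snd, map_smul, RingHom.id_apply, smul_eq_mul]; module

/-- `𝒫₊ = I₋ X + J₊ Y - (p / 2) A_{I₊} - (q / 2) A_{J₊}`. -/
def towerP : Tower →ₗ[ℝ] E8 where
  toFun P := lab Im P.1 + lab Jp P.2.1 - (1 / 2 * P.2.2.1) • A_Ip - (1 / 2 * P.2.2.2) • A_Jp
  map_add' P P' := by
    simp only [Prod.fst_add, Prod.snd_add, map_add]; module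
  map_smul' r P := by
    simp only [Prod.smul_fst, Prod.smul_snd, map_smul, RingHom.id_apply, smul_eq_mul]; module

/-- `𝒫₋ = J₋ X - I₊ Y - (p / 2) A_{J₋} + (q / 2) A_{I₋}`. -/
def towerM : Tower →ₗ[ℝ] E8 where
  toFun P := lab Jm P.1 - lab Ip P.2.1 - (1 / 2 * P.2.2.1) • A_Jm + (1 / 2 * P.2.2.2) • A_Im
  map_add' P P' := by
    simp only [Prod.fst_add, Prod.snd_add, map_add]; module
  map_smul' r P := by
    simp only [Prod.smul_fst, Prod.smul_snd, map_smul, RingHom.id_apply, smul_eq_mul]; module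

/-! ### The subalgebras `𝔢₇` and `𝔰𝔩(2, ℝ)` -/

/-- `ℍ' ⊗ 𝕆`, where `ℍ'` is spanned by `1, K, KL, L`. -/
def HO : Submodule ℝ OO :=
  Submodule.span ℝ {t | ∃ P ∈ Submodule.span ℝ {1, K, KL, L}, ∃ x : Oct, t = P ⊗ₜ[ℝ] x}

/-- The tracefree anti-Hermitian matrices over `ℍ' ⊗ 𝕆`, together with the derivations of `𝕆`. -/
def e7Mat : Submodule ℝ E8 where
  carrier := {x | (∀ i j, x.1.1 i j ∈ HO) ∧ x.2.1 = 0}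
  add_mem' hx hy := ⟨fun i j => HO.add_mem (hx.1 i j) (hy.1 i j), by
    rw [Prod.snd_add, Prod.fst_add, hx.2, hy.2, add_zero]⟩
  zero_mem' := ⟨fun _ _ => HO.zero_mem, rfl⟩
  smul_mem' r x hx := ⟨fun i j => HO.smul_mem r (hx.1 i j), by
    rw [Prod.smul_snd, Prod.smul_fst, hx.2, smul_zero]⟩

/-- `𝔢₇₍₋₂₅₎ = 𝔰𝔲(3, ℍ' ⊗ 𝕆)`: the elements of `𝔢₈` built from `ℍ' ⊗ 𝕆`, where the derivations
of `ℍ'` are the nested elements `(P ∘ Q) 𝓘` with `P, Q ∈ Im ℍ'`. -/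
def e7 : Submodule ℝ E8 :=
  e7Mat ⊔ Submodule.span ℝ {x | ∃ P ∈ Submodule.span ℝ {K, KL, L},
    ∃ Q ∈ Submodule.span ℝ {K, KL, L}, x = nested P Q}

/-- The span of `A_K`, `A_{KL}`, `A_L`. -/
def sl2 : Submodule ℝ E8 := Submodule.span ℝ {A_K, A_KL, A_L}

/-- The linear map from `𝔰𝔩(2, ℝ)` to `𝔢₈` with
`(a, b; c, -a) ↦ (a / 2) A_L - (b / 2) A_{K₋} + (c / 2) A_{K₊}`. -/
def sl2Map : LieAlgebra.SpecialLinear.sl (Fin 2) ℝ →ₗ[ℝ] E8 where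
  toFun g := (1 / 2 * g.1 0 0) • A_L - (1 / 2 * g.1 0 1) • A_Km + (1 / 2 * g.1 1 0) • A_Kp
  map_add' g h := by
    change (1 / 2 * (g.1 0 0 + h.1 0 0)) • A_L - (1 / 2 * (g.1 0 1 + h.1 0 1)) • A_Km +
      (1 / 2 * (g.1 1 0 + h.1 1 0)) • A_Kp = _
    module
  map_smul' r g := by
    change (1 / 2 * (r * g.1 0 0)) • A_L - (1 / 2 * (r * g.1 0 1)) • A_Km +
      (1 / 2 * (r * g.1 1 0)) • A_Kp = _
    rw [RingHom.id_apply]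
    module

end

end MagicE8

open scoped TensorProduct Matrix

namespace MagicE8

noncomputable section

/-! The theorem has two halves: the Jacobi identity for Vinberg's bracket, and the recognition of
Freudenthal's formulas inside it.

Jacobi identity. The elements `x` for which `ad x` is a derivation of the bracket form a subspace
closed under the bracket (`bracket_mem_jacobiSet`), so generators suffice. Derivations of the two
algebras qualify because the bracket is built equivariantly (`der_mem_jacobiSet`). Real
antisymmetric matrices qualify because real numbers associate with everything
(`realMat_mem_jacobiSet`). The essential case is a tracefree matrix `diag(s₀ u, s₁ u, s₂ u)` with
`u` anti-Hermitian (`diagonal_mem_jacobiSet`). Although `𝕆' ⊗ 𝕆` is not alternative, such a `u` has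
the form `q ⊗ 1 + 1 ⊗ p` and alternates with everything. The commutator then fails to be a
derivation of the matrix product by associators with weights `s m + s p + s n`, which are zero for
distinct indices; the rest is absorbed by the trace and derivation terms of the bracket. Brackets of
these matrices produce all off-diagonal ones.

Identification. A nested multiple of the identity is half an inner derivation of `𝕆'` (`nested_eq`),
so the elements `G` and `A` act on labels by evaluation. The null labels satisfy `L Q = Q` for `I₋,
J₋, K₋` and `L Q = -Q` for `I₊, J₊, K₊`, whence `φ₀` acts on labelled Albert elements by `φ` or by
`φ'` (`phi0_lab`, `phi0_lab_dual`). Labels of equal sign and different letters multiply to the third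
letter with the opposite sign, which yields the Freudenthal product (`lab_bracket_freud`); with
opposite signs they multiply to zero and only a trace times some `A` survives (`lab_bracket_trace`).
Together these are Freudenthal's action (`theta0_towerP`, `theta0_towerM`).

Structure. `ad A_L` has eigenvalue `0` on `𝔢₇` and `A_L`, `±4` on `A_{K∓}`, and `±2` on the towers.
This makes the sum of the four pieces direct (`decomp_injective`), and `133 + 3 + 56 + 56 = 248`
makes it everything. Hence `𝔢₇` is the common centralizer of `A_L` and `A_{K₋}`, so it is a
subalgebra, and Freudenthal's commutation relations follow from the Jacobi identity on a faithful
tower. The centralizer of `𝔢₇` is found with `G_L`, which has no zero weight on the towers, and the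
faithfulness of `𝔢₆` on the Albert algebra (`e6Act_faithful`). -/

/-- The associator `(x y) z - x (y z)`. -/
def assoc {R : Type} [NonUnitalNonAssocRing R] (x y z : R) : R := (x * y) * z - x * (y * z)

/-! ### Alternativity and the trace form of the Cayley-Dickson doubles -/

namespace CD
variable {ε : ℝ}

theorem assoc_swap_left (x y z : CD ε) : assoc x y z = -assoc y x z :=
  eq_neg_of_add_eq_zero_left (alt_left x y z)

theorem assoc_swap_right (x y z : CD ε) : assoc x y z = -assoc x z y :=
  eq_neg_of_add_eq_zero_left (alt_right x y z)

theorem assoc_rotate (x y z : CD ε) : assoc x y z = assoc y z x := by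
  rw [assoc_swap_left, assoc_swap_right, neg_neg]

theorem star_eq (x : CD ε) : star x = (2 * x.fst.re) • (1 : CD ε) - x :=
  eq_sub_of_add_eq' (add_star x)

/-- An associator with a real entry vanishes, and conjugation is negation up to a real number. -/
theorem assoc_star_left (x y z : CD ε) : assoc (star x) y z = -assoc x y z := by
  simp only [assoc, star_eq x, sub_mul, smul_mul_assoc, one_mul]
  abel

theorem assoc_star_mid (x y z : CD ε) : assoc x (star y) z = -assoc x y z := by
  rw [assoc_swap_left, assoc_star_left, assoc_swap_left y, neg_neg]

theorem assoc_star_right (x y z : CD ε) : assoc x y (star z) = -assoc x y z := by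
  rw [assoc_swap_right, assoc_star_mid, assoc_swap_right x z, neg_neg]

theorem re_mul_comm (x y : CD ε) : (x * y).fst.re = (y * x).fst.re := by
  simp
  ring

/-- With `re_mul_comm` this makes the real part of a triple product independent of the bracketing
and cyclic, so that it can serve as a common coefficient in the cyclic identities for `D(x, y)`. -/
theorem re_mul_assoc (x y z : CD ε) : ((x * y) * z).fst.re = (x * (y * z)).fst.re := by
  simp
  ring

theorem re_star (x : CD ε) : (star x).fst.re = x.fst.re := by simp

theorem re_one : (1 : CD ε).fst.re = 1 := rfl

theorem re_zero : (0 : CD ε).fst.re = 0 := rfl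

theorem star_eq_neg_iff {x : CD ε} : star x = -x ↔ x.fst.re = 0 := by
  constructor
  · intro h
    have h := congrArg (fun y : CD ε => y.fst.re) h
    simp at h
    linarith
  · intro h
    rw [star_eq, h]
    simp

theorem imPart_eq (x : CD ε) : x.imPart = x - x.fst.re • (1 : CD ε) := by
  rw [imPart, star_eq]
  module

theorem eq_re_add_imPart (x : CD ε) : x = x.fst.re • (1 : CD ε) + x.imPart := by
  rw [imPart_eq]
  abel

theorem imPart_of_re {x : CD ε} (h : x.fst.re = 0) : x.imPart = x := by
  rw [imPart_eq, h, zero_smul, sub_zero]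

theorem re_imPart (x : CD ε) : x.imPart.fst.re = 0 := by
  simp [imPart]

end CD

/-! ### Inner derivations of the octonions -/

theorem reMul_apply {ε : ℝ} (x y : CD ε) : reMul ε x y = (x * y).fst.re := rfl

theorem innerDer_apply {ε : ℝ} (x y z : CD ε) : (innerDer ε x y).1 z =
    (x * y - y * x) * z - z * (x * y - y * x) - (3 : ℝ) • assoc x y z := rfl

theorem innerDer_swap {ε : ℝ} (x y : CD ε) : innerDer ε x y = -innerDer ε y x := by
  apply Subtype.ext
  ext1 z
  rw [Submodule.coe_neg, LinearMap.neg_apply, innerDer_apply, innerDer_apply,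
    CD.assoc_swap_left x y]
  simp only [sub_mul, mul_sub]
  module

theorem innerDer_self {ε : ℝ} (x : CD ε) : innerDer ε x x = 0 := by
  apply Subtype.ext
  ext1 z
  simp [innerDer_apply, assoc, CD.alt_left']

theorem innerDer_one_left {ε : ℝ} (x : CD ε) : innerDer ε 1 x = 0 := by
  apply Subtype.ext
  ext1 z
  rw [innerDer_apply, assoc]
  simp

theorem innerDer_one_right {ε : ℝ} (x : CD ε) : innerDer ε x 1 = 0 := by
  rw [innerDer_swap, innerDer_one_left, neg_zero]

theorem innerDer_star_left {ε : ℝ} (x y : CD ε) : innerDer ε (star x) y = -innerDer ε x y := by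
  rw [CD.star_eq, map_sub, map_smul, LinearMap.sub_apply, LinearMap.smul_apply,
    innerDer_one_left, smul_zero, zero_sub]

theorem innerDer_star_right {ε : ℝ} (x y : CD ε) : innerDer ε x (star y) = -innerDer ε x y := by
  rw [innerDer_swap, innerDer_star_left, innerDer_swap y x, neg_neg]

theorem innerDer_imPart {ε : ℝ} (x y : CD ε) :
    innerDer ε x.imPart y.imPart = innerDer ε x y := by
  simp only [CD.imPart_eq, map_sub, map_smul, LinearMap.sub_apply, LinearMap.smul_apply,
    innerDer_one_left, innerDer_one_right, smul_zero, sub_zero]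

/-- An identity of alternative algebras: evaluated at `w`, the left side is a rational combination
of linearized alternative laws, either with a product substituted for one entry or multiplied by one
further letter. It is the source of the derivation components of the Jacobi identity for three
matrices. -/
theorem innerDer_cyclic {ε : ℝ} (x y z : CD ε) :
    innerDer ε (x * y) z + innerDer ε (y * z) x + innerDer ε (z * x) y = 0 := by
  apply Subtype.ext
  ext1 w
  have L := @CD.alt_left ε
  have R := @CD.alt_right ε
  have Ll : ∀ w x y z : CD ε, w * ((x * y) * z) - w * (x * (y * z)) +
      (w * ((y * x) * z) - w * (y * (x * z))) = 0 := fun w x y z => by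
    rw [← mul_sub, ← mul_sub, ← mul_add, L, mul_zero]
  have Rl : ∀ w x y z : CD ε, w * ((x * y) * z) - w * (x * (y * z)) +
      (w * ((x * z) * y) - w * (x * (z * y))) = 0 := fun w x y z => by
    rw [← mul_sub, ← mul_sub, ← mul_add, R, mul_zero]
  have Lr : ∀ x y z w : CD ε, (x * y) * z * w - x * (y * z) * w +
      ((y * x) * z * w - y * (x * z) * w) = 0 := fun x y z w => by
    rw [← sub_mul, ← sub_mul, ← add_mul, L, zero_mul]
  have Rr : ∀ x y z w : CD ε, (x * y) * z * w - x * (y * z) * w +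
      ((x * z) * y * w - x * (z * y) * w) = 0 := fun x y z w => by
    rw [← sub_mul, ← sub_mul, ← add_mul, R, zero_mul]
  simp only [Submodule.coe_add, LinearMap.add_apply, innerDer_apply, assoc, mul_sub, sub_mul,
    Submodule.coe_zero, LinearMap.zero_apply]
  linear_combination (norm := module) (-1 : ℝ) • Rl w y x z + (-1 : ℝ) • Ll w x z y + (1 : ℝ) • Rl w x y z + (1 : ℝ) • Ll w x y z + (-3 : ℝ) • Rr y x w z + (-3 : ℝ) • L (w*x) y z + (-3 : ℝ) • Ll y x w z + (3 : ℝ) • R y (x*z) w + (3 : ℝ) • Rl y x z w + (-3/2 : ℝ) • Lr y z x w + (3 : ℝ) • R x (y*z) w + (-3 : ℝ) • L x w (y*z) + (3 : ℝ) • L (x*y) w z + (-3 : ℝ) • R (x*y) z w + (3 : ℝ) • Lr x w y z + (-3 : ℝ) • Rr x y w z + (3 : ℝ) • Lr x y w z + (-3 : ℝ) • R x (y*w) z + (1 : ℝ) • Rr y x z w + (2 : ℝ) • Rr x y z w + (3 : ℝ) • L (y*w) x z + (-3/2 : ℝ) • L x y (z*w) + (3/2 : ℝ) • Ll x y z w +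 (3/2 : ℝ) • L (z*y) x w + (-3/2 : ℝ) • L (y*z) x w + (1/2 : ℝ) • Lr x y z w + (3/2 : ℝ) • L x z (y*w) + (3/2 : ℝ) • L y z (x*w) + (-3/2 : ℝ) • L (x*y) z w + (-3/2 : ℝ) • Ll z x y w + (-3/2 : ℝ) • L (y*x) z w + (-1/2 : ℝ) • Lr x z y w + (-3/2 : ℝ) • Ll y x z w + (-3/2 : ℝ) • L (x*z) y w + (-3/2 : ℝ) • L (z*x) y w

theorem derAlg_mul {ε : ℝ} (D : derAlg ε) (x y : CD ε) : D.1 (x * y) = D.1 x * y + x * D.1 y :=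
  D.2 x y

theorem derComm_apply {ε : ℝ} (D E : derAlg ε) (x : CD ε) :
    (derComm D E).1 x = D.1 (E.1 x) - E.1 (D.1 x) := rfl

theorem derComm_swap {ε : ℝ} (D E : derAlg ε) : derComm D E = -derComm E D := by
  apply Subtype.ext
  ext1 x
  simp [derComm_apply]

theorem derComm_jacobi {ε : ℝ} (D E F : derAlg ε) :
    derComm D (derComm E F) = derComm (derComm D E) F + derComm E (derComm D F) := by
  apply Subtype.ext
  ext1 x
  simp only [derComm_apply, Submodule.coe_add, LinearMap.add_apply, map_sub]
  abel

/-- The value of an inner derivation is a polynomial in its three arguments, to which the Leibniz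
rule applies. Commutators in `Der 𝕆'` reduce through this to the action on two labels. -/
theorem derComm_innerDer {ε : ℝ} (D : derAlg ε) (x y : CD ε) :
    derComm D (innerDer ε x y) = innerDer ε (D.1 x) y + innerDer ε x (D.1 y) := by
  apply Subtype.ext
  ext1 z
  simp only [derComm_apply, Submodule.coe_add, LinearMap.add_apply, innerDer_apply, assoc, map_sub,
    map_smul, derAlg_mul, mul_sub, sub_mul, mul_add, add_mul]
  module

/-- Derivations take imaginary values, in particular on the product of `x` and `y`. -/
theorem reMul_der {ε : ℝ} (D : derAlg ε) (x y : CD ε) :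
    reMul ε (D.1 x) y + reMul ε x (D.1 y) = 0 := by
  rw [reMul_apply, reMul_apply, ← Quaternion.re_add, ← CD.add_fst, ← derAlg_mul, der_re D.2]

/-! ### Associators and derivations of `𝕆' ⊗ 𝕆` -/

section Associator
variable {R : Type} [NonUnitalNonAssocRing R]

theorem assoc_add_left (x x' y z : R) : assoc (x + x') y z = assoc x y z + assoc x' y z := by
  simp only [assoc, add_mul]
  abel

theorem assoc_add_mid (x y y' z : R) : assoc x (y + y') z = assoc x y z + assoc x y' z := by
  simp only [assoc, add_mul, mul_add]
  abel

theorem assoc_add_right (x y z z' : R) : assoc x y (z + z') = assoc x y z + assoc x y z' := by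
  simp only [assoc, mul_add]
  abel

theorem assoc_neg_mid (x y z : R) : assoc x (-y) z = -assoc x y z := by
  simp only [assoc, mul_neg, neg_mul]
  abel

theorem assoc_neg_right (x y z : R) : assoc x y (-z) = -assoc x y z := by
  simp only [assoc, mul_neg]
  abel

end Associator

theorem OO_tmul_mul (a c : SplitOct) (b d : Oct) :
    (a ⊗ₜ[ℝ] b : OO) * (c ⊗ₜ[ℝ] d) = (a * c) ⊗ₜ[ℝ] (b * d) :=
  Algebra.TensorProduct.tmul_mul_tmul a c b d

theorem assoc_left (q a c : SplitOct) (b d : Oct) :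
    assoc (q ⊗ₜ[ℝ] (1 : Oct) : OO) (a ⊗ₜ[ℝ] b) (c ⊗ₜ[ℝ] d) = assoc q a c ⊗ₜ[ℝ] (b * d) := by
  simp only [assoc, OO_tmul_mul, one_mul, TensorProduct.sub_tmul]

theorem assoc_right (p b d : Oct) (a c : SplitOct) :
    assoc ((1 : SplitOct) ⊗ₜ[ℝ] p : OO) (a ⊗ₜ[ℝ] b) (c ⊗ₜ[ℝ] d) = (a * c) ⊗ₜ[ℝ] assoc p b d := by
  simp only [assoc, OO_tmul_mul, one_mul, TensorProduct.tmul_sub]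

theorem leftDer_tmul (a c : SplitOct) (b d : Oct) :
    leftDer 1 (-1) (a ⊗ₜ[ℝ] b) (c ⊗ₜ[ℝ] d) = (b * d).fst.re • innerDer 1 a c := by
  simp [leftDer, reMul_apply]

theorem rightDer_tmul (a c : SplitOct) (b d : Oct) :
    rightDer 1 (-1) (a ⊗ₜ[ℝ] b) (c ⊗ₜ[ℝ] d) = (a * c).fst.re • innerDer (-1) b d := by
  simp [rightDer, reMul_apply]

theorem derTensor_tmul (D : derAlg 1) (E : derAlg (-1)) (a : SplitOct) (b : Oct) :
    derTensor D E (a ⊗ₜ[ℝ] b) = D.1 a ⊗ₜ[ℝ] b + a ⊗ₜ[ℝ] E.1 b := by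
  simp [derTensor]

theorem derTensor_add (D D' : derAlg 1) (E E' : derAlg (-1)) (x : OO) :
    derTensor (D + D') (E + E') x = derTensor D E x + derTensor D' E' x := by
  simp only [derTensor, Submodule.coe_add, LinearMap.add_apply, TensorProduct.map_add_left,
    TensorProduct.map_add_right]
  abel

theorem derTensor_smul (r : ℝ) (D : derAlg 1) (E : derAlg (-1)) (x : OO) :
    derTensor (r • D) (r • E) x = r • derTensor D E x := by
  simp only [derTensor, Submodule.coe_smul, LinearMap.add_apply, LinearMap.smul_apply,
    TensorProduct.map_smul_left, TensorProduct.map_smul_right, smul_add]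

/-- The action on `𝕆' ⊗ 𝕆` of a pair of derivations, as a linear map. -/
def derTensorHom : derAlg 1 × derAlg (-1) →ₗ[ℝ] Module.End ℝ OO where
  toFun d := derTensor d.1 d.2
  map_add' _ _ := LinearMap.ext fun x => derTensor_add _ _ _ _ x
  map_smul' r _ := LinearMap.ext fun x => derTensor_smul r _ _ x

/-- The derivation `D(x, y)` of `𝕆' ⊗ 𝕆`, bilinear in `x` and `y`. -/
def pairDer : OO →ₗ[ℝ] OO →ₗ[ℝ] Module.End ℝ OO :=
  LinearMap.mk₂ ℝ (fun x y => derTensorHom (leftDer 1 (-1) x y, rightDer 1 (-1) x y))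
    (fun x y z => by rw [← map_add, map_add, map_add]; rfl)
    (fun r x y => by rw [← map_smul, map_smul, map_smul]; rfl)
    (fun x y z => by rw [← map_add, map_add, map_add]; rfl)
    (fun r x y => by rw [← map_smul, map_smul, map_smul]; rfl)

theorem pairDer_apply (x y z : OO) :
    pairDer x y z = derTensor (leftDer 1 (-1) x y) (rightDer 1 (-1) x y) z := rfl

theorem pairDer_tmul (a c e : SplitOct) (b d f : Oct) :
    pairDer (a ⊗ₜ[ℝ] b) (c ⊗ₜ[ℝ] d) (e ⊗ₜ[ℝ] f) =
      (b * d).fst.re • ((innerDer 1 a c).1 e ⊗ₜ[ℝ] f) +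
        (a * c).fst.re • (e ⊗ₜ[ℝ] (innerDer (-1) b d).1 f) := by
  rw [pairDer_apply, leftDer_tmul, rightDer_tmul, derTensor_tmul]
  simp [TensorProduct.smul_tmul']

theorem derTensor_mul (D : derAlg 1) (E : derAlg (-1)) (x y : OO) :
    derTensor D E (x * y) = derTensor D E x * y + x * derTensor D E y := by
  induction x using TensorProduct.induction_on with
  | zero => simp
  | add x x' hx hx' =>
    rw [add_mul, map_add, hx, hx', map_add, add_mul, add_mul]
    abel
  | tmul a b =>
    induction y using TensorProduct.induction_on with
    | zero => simp
    | add y y' hy hy' =>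
      rw [mul_add, map_add, hy, hy', map_add, mul_add, mul_add]
      abel
    | tmul c d =>
      simp only [OO_tmul_mul, derTensor_tmul, derAlg_mul, add_mul, mul_add, TensorProduct.add_tmul,
        TensorProduct.tmul_add]
      abel

/-- Only `D` occurs on the left, yet `E` may be added on the right: its two contributions to the
coefficient cancel, because `E` is skew for the trace form. This puts both derivations on an equal
footing in the action on matrices. -/
theorem derComm_leftDer (D : derAlg 1) (E : derAlg (-1)) (x y : OO) :
    derComm D (leftDer 1 (-1) x y) =
      leftDer 1 (-1) (derTensor D E x) y + leftDer 1 (-1) x (derTensor D E y) := by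
  induction x using TensorProduct.induction_on with
  | zero => simp [derComm]
  | add x x' hx hx' =>
    simp only [map_add, LinearMap.add_apply, derComm_add_right, hx, hx']
    abel
  | tmul a b =>
    induction y using TensorProduct.induction_on with
    | zero => simp [derComm]
    | add y y' hy hy' =>
      simp only [map_add, derComm_add_right, hy, hy']
      abel
    | tmul c d =>
      have h := reMul_der E b d
      simp only [reMul_apply] at h
      simp only [derTensor_tmul, map_add, LinearMap.add_apply, leftDer_tmul, derComm_smul_right,
        derComm_innerDer, smul_add]
      rw [show (b * E.1 d).fst.re = -(E.1 b * d).fst.re by linarith]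
      module

theorem derComm_rightDer (D : derAlg 1) (E : derAlg (-1)) (x y : OO) :
    derComm E (rightDer 1 (-1) x y) =
      rightDer 1 (-1) (derTensor D E x) y + rightDer 1 (-1) x (derTensor D E y) := by
  induction x using TensorProduct.induction_on with
  | zero => simp [derComm]
  | add x x' hx hx' =>
    simp only [map_add, LinearMap.add_apply, derComm_add_right, hx, hx']
    abel
  | tmul a b =>
    induction y using TensorProduct.induction_on with
    | zero => simp [derComm]
    | add y y' hy hy' =>
      simp only [map_add, derComm_add_right, hy, hy']
      abel
    | tmul c d =>
      have h := reMul_der D a c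
      simp only [reMul_apply] at h
      simp only [derTensor_tmul, map_add, LinearMap.add_apply, rightDer_tmul, derComm_smul_right,
        derComm_innerDer, smul_add]
      rw [show (a * D.1 c).fst.re = -(D.1 a * c).fst.re by linarith]
      module

/-- A linear statement about `𝕆' ⊗ 𝕆` holds if it holds for pure tensors. -/
theorem OO_induct {p : OO → Prop} (h : ∀ a b, p (a ⊗ₜ[ℝ] b)) (hadd : ∀ x y, p x → p y → p (x + y))
    (x : OO) : p x :=
  TensorProduct.induction_on x (by simpa using h 0 0) h hadd

/-- On pure tensors the three coefficients are the same number `Re (b d f)`, by cyclicity of the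
trace form, so the claim reduces to `innerDer_cyclic`. -/
theorem leftDer_cyclic (x y z : OO) :
    leftDer 1 (-1) (x * y) z + leftDer 1 (-1) (y * z) x + leftDer 1 (-1) (z * x) y = 0 := by
  induction x using OO_induct with
  | hadd x x' hx hx' =>
    simp only [add_mul, mul_add, map_add, LinearMap.add_apply]
    linear_combination (norm := module) hx + hx'
  | h a b =>
    induction y using OO_induct with
    | hadd y y' hy hy' =>
      simp only [add_mul, mul_add, map_add, LinearMap.add_apply]
      linear_combination (norm := module) hy + hy'
    | h c d =>
      induction z using OO_induct with
      | hadd z z' hz hz' =>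
        simp only [add_mul, mul_add, map_add, LinearMap.add_apply]
        linear_combination (norm := module) hz + hz'
      | h e f =>
        simp only [OO_tmul_mul, leftDer_tmul]
        rw [CD.re_mul_comm (d * f), ← CD.re_mul_assoc b, CD.re_mul_comm (f * b),
          ← CD.re_mul_assoc d f b, CD.re_mul_comm (d * f) b, ← CD.re_mul_assoc b d f,
          ← smul_add, ← smul_add, innerDer_cyclic, smul_zero]

theorem rightDer_cyclic (x y z : OO) :
    rightDer 1 (-1) (x * y) z + rightDer 1 (-1) (y * z) x + rightDer 1 (-1) (z * x) y = 0 := by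
  induction x using OO_induct with
  | hadd x x' hx hx' =>
    simp only [add_mul, mul_add, map_add, LinearMap.add_apply]
    linear_combination (norm := module) hx + hx'
  | h a b =>
    induction y using OO_induct with
    | hadd y y' hy hy' =>
      simp only [add_mul, mul_add, map_add, LinearMap.add_apply]
      linear_combination (norm := module) hy + hy'
    | h c d =>
      induction z using OO_induct with
      | hadd z z' hz hz' =>
        simp only [add_mul, mul_add, map_add, LinearMap.add_apply]
        linear_combination (norm := module) hz + hz'
      | h e f =>
        simp only [OO_tmul_mul, rightDer_tmul]
        rw [CD.re_mul_comm (c * e), ← CD.re_mul_assoc a, CD.re_mul_comm (e * a),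
          ← CD.re_mul_assoc c e a, CD.re_mul_comm (c * e) a, ← CD.re_mul_assoc a c e,
          ← smul_add, ← smul_add, innerDer_cyclic, smul_zero]

theorem leftDer_swap (x y : OO) : leftDer 1 (-1) x y = -leftDer 1 (-1) y x := by
  induction x using OO_induct with
  | hadd x x' hx hx' =>
    rw [map_add, map_add, LinearMap.add_apply, hx, hx', neg_add]
  | h a b =>
    induction y using OO_induct with
    | hadd y y' hy hy' => rw [map_add, map_add, LinearMap.add_apply, hy, hy', neg_add]
    | h c d => rw [leftDer_tmul, leftDer_tmul, innerDer_swap a, CD.re_mul_comm b, smul_neg]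

theorem rightDer_swap (x y : OO) : rightDer 1 (-1) x y = -rightDer 1 (-1) y x := by
  induction x using OO_induct with
  | hadd x x' hx hx' =>
    rw [map_add, map_add, LinearMap.add_apply, hx, hx', neg_add]
  | h a b =>
    induction y using OO_induct with
    | hadd y y' hy hy' => rw [map_add, map_add, LinearMap.add_apply, hy, hy', neg_add]
    | h c d => rw [rightDer_tmul, rightDer_tmul, innerDer_swap b, CD.re_mul_comm a, smul_neg]

/-! ### Anti-Hermitian elements of `𝕆' ⊗ 𝕆` -/

/-- The elements of `𝕆' ⊗ 𝕆` which alternate with everything. -/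
structure IsAlternative (u : OO) : Prop where
  assoc_mid : ∀ x y, assoc x u y = -assoc u x y
  assoc_right : ∀ x y, assoc x y u = assoc u x y

theorem IsAlternative.add {u v : OO} (hu : IsAlternative u) (hv : IsAlternative v) :
    IsAlternative (u + v) where
  assoc_mid x y := by
    rw [assoc_add_mid, assoc_add_left, hu.assoc_mid, hv.assoc_mid, neg_add]
  assoc_right x y := by
    rw [assoc_add_right, assoc_add_left, hu.assoc_right, hv.assoc_right]

/-- The tensor product is not alternative, but an associator containing `q ⊗ 1` is an associator in
the first factor tensored with a plain product in the second. -/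
theorem isAlternative_left (q : SplitOct) : IsAlternative (q ⊗ₜ[ℝ] 1) where
  assoc_mid x y := by
    induction x using OO_induct with
    | hadd x x' hx hx' => rw [assoc_add_left, assoc_add_mid, hx, hx', neg_add]
    | h a b =>
      induction y using OO_induct with
      | hadd y y' hy hy' => rw [assoc_add_right, assoc_add_right, hy, hy', neg_add]
      | h c d =>
        rw [assoc_left, CD.assoc_swap_left, TensorProduct.neg_tmul, neg_neg]
        simp only [assoc, OO_tmul_mul, one_mul, mul_one, TensorProduct.sub_tmul]
  assoc_right x y := by
    induction x using OO_induct with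
    | hadd x x' hx hx' => rw [assoc_add_left, assoc_add_mid, hx, hx']
    | h a b =>
      induction y using OO_induct with
      | hadd y y' hy hy' => rw [assoc_add_mid, assoc_add_right, hy, hy']
      | h c d =>
        rw [assoc_left, CD.assoc_rotate]
        simp only [assoc, OO_tmul_mul, mul_one, TensorProduct.sub_tmul]

theorem isAlternative_right (p : Oct) : IsAlternative (1 ⊗ₜ[ℝ] p) where
  assoc_mid x y := by
    induction x using OO_induct with
    | hadd x x' hx hx' => rw [assoc_add_left, assoc_add_mid, hx, hx', neg_add]
    | h a b =>
      induction y using OO_induct with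
      | hadd y y' hy hy' => rw [assoc_add_right, assoc_add_right, hy, hy', neg_add]
      | h c d =>
        rw [assoc_right, CD.assoc_swap_left, TensorProduct.tmul_neg, neg_neg]
        simp only [assoc, OO_tmul_mul, one_mul, mul_one, TensorProduct.tmul_sub]
  assoc_right x y := by
    induction x using OO_induct with
    | hadd x x' hx hx' => rw [assoc_add_left, assoc_add_mid, hx, hx']
    | h a b =>
      induction y using OO_induct with
      | hadd y y' hy hy' => rw [assoc_add_mid, assoc_add_right, hy, hy']
      | h c d =>
        rw [assoc_right, CD.assoc_rotate]
        simp only [assoc, OO_tmul_mul, mul_one, TensorProduct.tmul_sub]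

/-- Split both factors into real and imaginary parts. Conjugation fixes the real part and the doubly
imaginary part, so only the components with exactly one imaginary factor survive. -/
theorem sub_star_eq (x : OO) : ∃ (q : SplitOct) (p : Oct), q.fst.re = 0 ∧ p.fst.re = 0 ∧
    x - star x = q ⊗ₜ[ℝ] 1 + 1 ⊗ₜ[ℝ] p := by
  induction x using OO_induct with
  | hadd x y hx hy =>
    obtain ⟨q, p, hq, hp, h⟩ := hx
    obtain ⟨q', p', hq', hp', h'⟩ := hy
    refine ⟨q + q', p + p', by simp [hq, hq'], by simp [hp, hp'], ?_⟩
    rw [star_add, add_sub_add_comm, h, h', TensorProduct.add_tmul, TensorProduct.tmul_add]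
    abel
  | h a b =>
    refine ⟨(2 * b.fst.re) • a.imPart, (2 * a.fst.re) • b.imPart, by simp [CD.re_imPart],
      by simp [CD.re_imPart], ?_⟩
    rw [TensorProduct.star_tmul, CD.star_eq, CD.star_eq, CD.imPart_eq, CD.imPart_eq]
    simp only [TensorProduct.sub_tmul, TensorProduct.tmul_sub, TensorProduct.tmul_smul,
      ← TensorProduct.smul_tmul', smul_sub]
    module

theorem exists_of_star_eq_neg {v : OO} (hv : star v = -v) :
    ∃ (q : SplitOct) (p : Oct), q.fst.re = 0 ∧ p.fst.re = 0 ∧ v = q ⊗ₜ[ℝ] 1 + 1 ⊗ₜ[ℝ] p := by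
  obtain ⟨q, p, hq, hp, h⟩ := sub_star_eq ((1 / 2 : ℝ) • v)
  refine ⟨q, p, hq, hp, ?_⟩
  rw [← h, star_smul, hv, star_trivial]
  module

theorem isAlternative_of_star {v : OO} (hv : star v = -v) : IsAlternative v := by
  obtain ⟨q, p, -, -, rfl⟩ := exists_of_star_eq_neg hv
  exact (isAlternative_left q).add (isAlternative_right p)

/-- The combination of two associators of `u`, `x`, `y` which is fixed by conjugation. -/
def symAssoc (u x y : OO) : OO := assoc u x y - assoc u (star y) (star x)

theorem symAssoc_add_left (u v x y : OO) :
    symAssoc (u + v) x y = symAssoc u x y + symAssoc v x y := by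
  simp only [symAssoc, assoc_add_left]
  abel

theorem symAssoc_add_mid (u x x' y : OO) :
    symAssoc u (x + x') y = symAssoc u x y + symAssoc u x' y := by
  simp only [symAssoc, assoc_add_mid, star_add, assoc_add_right]
  abel

theorem symAssoc_add_right (u x y y' : OO) :
    symAssoc u x (y + y') = symAssoc u x y + symAssoc u x y' := by
  simp only [symAssoc, assoc_add_mid, star_add, assoc_add_right]
  abel

/-- Exchanging and conjugating `x` and `y` negates the associator in the first factor and conjugates
the product `b d`; the difference therefore carries `b d + star (b d)`. This is the coefficient with
which Vinberg's `D` weights the first factor. -/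
theorem symAssoc_left (q a c : SplitOct) (b d : Oct) :
    symAssoc (q ⊗ₜ[ℝ] 1) (a ⊗ₜ[ℝ] b) (c ⊗ₜ[ℝ] d) =
      (2 * (b * d).fst.re) • (assoc q a c ⊗ₜ[ℝ] 1) := by
  rw [symAssoc, TensorProduct.star_tmul, TensorProduct.star_tmul, assoc_left, assoc_left,
    CD.assoc_star_mid, CD.assoc_star_right, neg_neg, CD.assoc_swap_right q c, ← star_mul,
    TensorProduct.neg_tmul, sub_neg_eq_add, ← TensorProduct.tmul_add, CD.add_star,
    TensorProduct.tmul_smul]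

theorem symAssoc_right (p b d : Oct) (a c : SplitOct) :
    symAssoc (1 ⊗ₜ[ℝ] p) (a ⊗ₜ[ℝ] b) (c ⊗ₜ[ℝ] d) =
      (2 * (a * c).fst.re) • ((1 : SplitOct) ⊗ₜ[ℝ] assoc p b d) := by
  rw [symAssoc, TensorProduct.star_tmul, TensorProduct.star_tmul, assoc_right, assoc_right,
    CD.assoc_star_mid, CD.assoc_star_right, neg_neg, CD.assoc_swap_right p d, ← star_mul,
    TensorProduct.tmul_neg, sub_neg_eq_add, ← TensorProduct.add_tmul, CD.add_star,
    TensorProduct.smul_tmul']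

theorem symAssoc_star {u : OO} (hu : star u = -u) (x y : OO) :
    symAssoc u (star x) (star y) = symAssoc u x y := by
  obtain ⟨q, p, -, -, rfl⟩ := exists_of_star_eq_neg hu
  rw [symAssoc_add_left, symAssoc_add_left]
  induction x using OO_induct with
  | hadd x x' hx hx' =>
    simp only [star_add, symAssoc_add_mid]
    linear_combination (norm := abel) hx + hx'
  | h a b =>
    induction y using OO_induct with
    | hadd y y' hy hy' =>
      simp only [star_add, symAssoc_add_right]
      linear_combination (norm := abel) hy + hy'
    | h c d =>
      simp only [TensorProduct.star_tmul, symAssoc_left, symAssoc_right, CD.assoc_star_mid,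
        CD.assoc_star_right, neg_neg]
      rw [← star_mul, ← star_mul, CD.re_star, CD.re_star, CD.re_mul_comm d, CD.re_mul_comm c]

/-- With `u = q ⊗ 1 + 1 ⊗ p` and `v` likewise, the mixed terms vanish on both sides: such elements
commute and associate, and `D` has an entry `1`. What is left is the definition of the inner
derivation in each factor. -/
theorem pairDer_skew {u v : OO} (hu : star u = -u) (hv : star v = -v) (y : OO) :
    pairDer u v y = (u * v - v * u) * y - y * (u * v - v * u) - (3 : ℝ) • assoc u v y := by
  obtain ⟨q, p, hq, hp, rfl⟩ := exists_of_star_eq_neg hu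
  obtain ⟨q', p', hq', hp', rfl⟩ := exists_of_star_eq_neg hv
  induction y using OO_induct with
  | hadd y y' hy hy' =>
    simp only [map_add, mul_add, add_mul, mul_sub, sub_mul, assoc_add_right] at hy hy' ⊢
    linear_combination (norm := module) hy + hy'
  | h e f =>
    simp only [map_add, LinearMap.add_apply, pairDer_tmul, innerDer_one_left, innerDer_one_right,
      assoc_add_left, assoc_add_mid, assoc_left, assoc_right]
    simp only [innerDer_apply, mul_one, one_mul, CD.re_one, hq, hp, hq', hp', OO_tmul_mul, add_mul,
      mul_add, sub_mul, mul_sub, TensorProduct.sub_tmul, TensorProduct.tmul_sub, assoc, one_smul,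
      TensorProduct.tmul_smul, ← TensorProduct.smul_tmul', Submodule.coe_zero,
      LinearMap.zero_apply, TensorProduct.tmul_zero, TensorProduct.zero_tmul, smul_zero]
    module

/-- For general `x` and `y` the derivation is not expressible by commutators and associators as in
`pairDer_skew`, but its value at `u`, symmetrized under conjugation of both arguments, is. This
controls the diagonal entries of the Jacobi identity, where a trace correction and a derivation term
meet. -/
theorem comm_add_pairDer {u : OO} (hu : star u = -u) (x y : OO) :
    (u * (x * y - y * x + (star x * star y - star y * star x)) -
      (x * y - y * x + (star x * star y - star y * star x)) * u) +
      (pairDer x y u + pairDer (star x) (star y) u) = (-3 : ℝ) • symAssoc u x y := by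
  obtain ⟨q, p, hq, hp, rfl⟩ := exists_of_star_eq_neg hu
  induction x using OO_induct with
  | hadd x x' hx hx' =>
    simp only [star_add, symAssoc_add_mid, map_add, LinearMap.add_apply, mul_add, add_mul, mul_sub,
      sub_mul] at hx hx' ⊢
    linear_combination (norm := module) hx + hx'
  | h a b =>
    induction y using OO_induct with
    | hadd y y' hy hy' =>
      simp only [star_add, symAssoc_add_right, map_add, LinearMap.add_apply, mul_add, add_mul,
        mul_sub, sub_mul] at hy hy' ⊢
      linear_combination (norm := module) hy + hy'
    | h c d =>
      have h1 : ∀ (a c : SplitOct) (b d : Oct),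
          star (a ⊗ₜ[ℝ] b : OO) * star (c ⊗ₜ[ℝ] d) = star (c * a) ⊗ₜ[ℝ] star (d * b) :=
        fun a c b d => by
          rw [TensorProduct.star_tmul, TensorProduct.star_tmul, OO_tmul_mul, star_mul, star_mul]
      have h2 : pairDer (star (a ⊗ₜ[ℝ] b)) (star (c ⊗ₜ[ℝ] d)) = pairDer (a ⊗ₜ[ℝ] b) (c ⊗ₜ[ℝ] d) := by
        refine LinearMap.ext fun z => ?_
        rw [pairDer_apply, pairDer_apply, TensorProduct.star_tmul, TensorProduct.star_tmul,
          leftDer_tmul, leftDer_tmul, rightDer_tmul, rightDer_tmul]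
        simp only [innerDer_star_left, innerDer_star_right, neg_neg, ← star_mul, CD.re_star]
        rw [CD.re_mul_comm d, CD.re_mul_comm c]
      rw [h1, h1, h2, symAssoc_add_left, symAssoc_left, symAssoc_right, map_add, pairDer_tmul,
        pairDer_tmul, der_one (innerDer _ _ _).2, der_one (innerDer _ _ _).2, innerDer_apply,
        innerDer_apply, CD.star_eq, CD.star_eq, CD.star_eq, CD.star_eq, CD.re_mul_comm d b,
        CD.re_mul_comm c a, OO_tmul_mul, OO_tmul_mul, CD.assoc_rotate q, CD.assoc_rotate p]
      simp only [TensorProduct.sub_tmul, TensorProduct.tmul_sub, OO_tmul_mul, add_mul, mul_add,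
        sub_mul, mul_sub, one_mul, mul_one, smul_mul_assoc, mul_smul_comm, TensorProduct.tmul_smul,
        ← TensorProduct.smul_tmul', TensorProduct.tmul_zero, TensorProduct.zero_tmul, smul_sub,
        assoc]
      module

/-! ### Bilinearity, antisymmetry and components of the bracket -/

theorem bracket_eq (x y : E8) : ⁅x, y⁆ = e8Bracket x y := rfl

theorem bracket_add (x y z : E8) : ⁅x, y + z⁆ = ⁅x, y⁆ + ⁅x, z⁆ := map_add (e8Bracket x) y z

theorem add_bracket (x y z : E8) : ⁅x + y, z⁆ = ⁅x, z⁆ + ⁅y, z⁆ := by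
  simp only [bracket_eq, map_add, LinearMap.add_apply]

theorem bracket_smul (r : ℝ) (x y : E8) : ⁅x, r • y⁆ = r • ⁅x, y⁆ := map_smul (e8Bracket x) r y

theorem smul_bracket (r : ℝ) (x y : E8) : ⁅r • x, y⁆ = r • ⁅x, y⁆ := by
  simp only [bracket_eq, map_smul, LinearMap.smul_apply]

theorem bracket_neg (x y : E8) : ⁅x, -y⁆ = -⁅x, y⁆ := map_neg (e8Bracket x) y

theorem neg_bracket (x y : E8) : ⁅-x, y⁆ = -⁅x, y⁆ := by
  simp only [bracket_eq, map_neg, LinearMap.neg_apply]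

theorem bracket_sub (x y z : E8) : ⁅x, y - z⁆ = ⁅x, y⁆ - ⁅x, z⁆ := map_sub (e8Bracket x) y z

theorem sub_bracket (x y z : E8) : ⁅x - y, z⁆ = ⁅x, z⁆ - ⁅y, z⁆ := by
  simp only [bracket_eq, map_sub, LinearMap.sub_apply]

theorem bracket_zero (x : E8) : ⁅x, (0 : E8)⁆ = 0 := map_zero (e8Bracket x)

theorem zero_bracket (x : E8) : ⁅(0 : E8), x⁆ = 0 := by
  simp only [bracket_eq, map_zero, LinearMap.zero_apply]

/-- The component in `Der 𝕆'` of the bracket of two matrices, up to a factor. -/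
def matLeft (A B : Mat3 OO) : derAlg 1 := ∑ i, ∑ j, leftDer 1 (-1) (A i j) (B j i)

/-- The component in `Der 𝕆` of the bracket of two matrices, up to a factor. -/
def matRight (A B : Mat3 OO) : derAlg (-1) := ∑ i, ∑ j, rightDer 1 (-1) (A i j) (B j i)

theorem bracket_mk (A B : sa3) (d d' : derAlg 1) (e e' : derAlg (-1)) :
    ⁅((A, d, e) : E8), ((B, d', e') : E8)⁆ =
      (matComm A B + derMat d e B - derMat d' e' A,
        derComm d d' + (1 / 3 : ℝ) • matLeft A.1 B.1,
        derComm e e' + (1 / 3 : ℝ) • matRight A.1 B.1) := rfl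

theorem matLeft_swap (A B : Mat3 OO) : matLeft A B = -matLeft B A := by
  rw [matLeft, matLeft, Finset.sum_comm, ← Finset.sum_neg_distrib]
  refine Finset.sum_congr rfl fun i _ => ?_
  rw [← Finset.sum_neg_distrib]
  exact Finset.sum_congr rfl fun j _ => leftDer_swap _ _

theorem matRight_swap (A B : Mat3 OO) : matRight A B = -matRight B A := by
  rw [matRight, matRight, Finset.sum_comm, ← Finset.sum_neg_distrib]
  refine Finset.sum_congr rfl fun i _ => ?_
  rw [← Finset.sum_neg_distrib]
  exact Finset.sum_congr rfl fun j _ => rightDer_swap _ _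

theorem tracefree_neg {R : Type} [AddCommGroup R] [Module ℝ R] (A : Mat3 R) :
    tracefree (-A) = -tracefree A := by
  simpa using tracefree_smul (-1 : ℝ) A

theorem tracefree_sub {R : Type} [AddCommGroup R] [Module ℝ R] (A B : Mat3 R) :
    tracefree (A - B) = tracefree A - tracefree B := by
  rw [sub_eq_add_neg, tracefree_add, tracefree_neg, ← sub_eq_add_neg]

theorem tracefree_of_trace {R : Type} [AddCommGroup R] [Module ℝ R] {A : Mat3 R}
    (h : A.trace = 0) : tracefree A = A := by
  simp [tracefree, h]

theorem matComm_swap (A B : sa3) : matComm A B = -matComm B A := by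
  apply Subtype.ext
  rw [Submodule.coe_neg, matComm, matComm, ← tracefree_neg, neg_sub]

theorem bracket_swap (x y : E8) : ⁅x, y⁆ = -⁅y, x⁆ := by
  obtain ⟨A, d, e⟩ := x
  obtain ⟨B, d', e'⟩ := y
  rw [bracket_mk, bracket_mk]
  refine Prod.ext ?_ (Prod.ext ?_ ?_)
  · simp only [Prod.fst_neg]
    rw [matComm_swap A]
    abel
  · simp only [Prod.fst_neg, Prod.snd_neg]
    rw [derComm_swap d, matLeft_swap A.1, smul_neg, neg_add]
  · simp only [Prod.snd_neg]
    rw [derComm_swap e, matRight_swap A.1, smul_neg, neg_add]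

theorem bracket_self (x : E8) : ⁅x, x⁆ = 0 := by
  have h := bracket_swap x x
  rw [eq_neg_iff_add_eq_zero, ← two_smul ℝ, smul_eq_zero_iff_right two_ne_zero] at h
  exact h

theorem sum_rotate {M : Type} [AddCommMonoid M] (f : Fin 3 → Fin 3 → Fin 3 → M) :
    ∑ i, ∑ j, ∑ k, f i j k = ∑ i, ∑ j, ∑ k, f k i j := by
  have h : ∀ i, ∑ j, ∑ k, f k i j = ∑ k, ∑ j, f k i j := fun i => Finset.sum_comm
  simp only [h]
  rw [Finset.sum_comm]

/-- The scalar identity `leftDer_cyclic`, summed over index triples after the indices of the second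
and third sums have been rotated into agreement with the first. -/
theorem matLeft_cyclic (A B C : Mat3 OO) :
    matLeft (A * B) C + matLeft (B * C) A + matLeft (C * A) B = 0 := by
  have h : ∀ A B C : Mat3 OO, matLeft (A * B) C =
      ∑ i, ∑ j, ∑ k, leftDer 1 (-1) (A i k * B k j) (C j i) := fun A B C => by
    simp only [matLeft, Matrix.mul_apply, map_sum, LinearMap.coe_sum, Finset.sum_apply]
  rw [h, h, h, sum_rotate fun i j k => leftDer 1 (-1) (B i k * C k j) (A j i),
    sum_rotate fun i j k => leftDer 1 (-1) (C i k * A k j) (B j i),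
    sum_rotate fun i j k => leftDer 1 (-1) (C k j * A j i) (B i k)]
  simp only [← Finset.sum_add_distrib]
  exact Finset.sum_eq_zero fun i _ => Finset.sum_eq_zero fun j _ => Finset.sum_eq_zero fun k _ =>
    leftDer_cyclic _ _ _

theorem matRight_cyclic (A B C : Mat3 OO) :
    matRight (A * B) C + matRight (B * C) A + matRight (C * A) B = 0 := by
  have h : ∀ A B C : Mat3 OO, matRight (A * B) C =
      ∑ i, ∑ j, ∑ k, rightDer 1 (-1) (A i k * B k j) (C j i) := fun A B C => by
    simp only [matRight, Matrix.mul_apply, map_sum, LinearMap.coe_sum, Finset.sum_apply]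
  rw [h, h, h, sum_rotate fun i j k => rightDer 1 (-1) (B i k * C k j) (A j i),
    sum_rotate fun i j k => rightDer 1 (-1) (C i k * A k j) (B j i),
    sum_rotate fun i j k => rightDer 1 (-1) (C k j * A j i) (B i k)]
  simp only [← Finset.sum_add_distrib]
  exact Finset.sum_eq_zero fun i _ => Finset.sum_eq_zero fun j _ => Finset.sum_eq_zero fun k _ =>
    rightDer_cyclic _ _ _

theorem matLeft_sub_left (A B C : Mat3 OO) : matLeft (A - B) C = matLeft A C - matLeft B C := by
  simp only [matLeft, Matrix.sub_apply, map_sub, LinearMap.sub_apply, Finset.sum_sub_distrib]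

theorem matRight_sub_left (A B C : Mat3 OO) : matRight (A - B) C = matRight A C - matRight B C := by
  simp only [matRight, Matrix.sub_apply, map_sub, LinearMap.sub_apply, Finset.sum_sub_distrib]

theorem matLeft_diagonal (s : Fin 3 → OO) (C : Mat3 OO) :
    matLeft (Matrix.diagonal s) C = ∑ i, leftDer 1 (-1) (s i) (C i i) := by
  refine Finset.sum_congr rfl fun i _ => ?_
  rw [Finset.sum_eq_single i (fun j _ h => by
    rw [Matrix.diagonal_apply_ne' _ h, map_zero, LinearMap.zero_apply]) (by simp),
    Matrix.diagonal_apply_eq]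

theorem matRight_diagonal (s : Fin 3 → OO) (C : Mat3 OO) :
    matRight (Matrix.diagonal s) C = ∑ i, rightDer 1 (-1) (s i) (C i i) := by
  refine Finset.sum_congr rfl fun i _ => ?_
  rw [Finset.sum_eq_single i (fun j _ h => by
    rw [Matrix.diagonal_apply_ne' _ h, map_zero, LinearMap.zero_apply]) (by simp),
    Matrix.diagonal_apply_eq]

/-- The scalar part of `A` pairs with the sum of the diagonal entries of `C`, which is zero. -/
theorem matLeft_tracefree (A : Mat3 OO) {C : Mat3 OO} (hC : C.trace = 0) :
    matLeft (tracefree A) C = matLeft A C := by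
  rw [tracefree, matLeft_sub_left, matLeft_diagonal, ← map_sum,
    show ∑ i, C i i = C.trace from rfl, hC, map_zero, sub_zero]

theorem matRight_tracefree (A : Mat3 OO) {C : Mat3 OO} (hC : C.trace = 0) :
    matRight (tracefree A) C = matRight A C := by
  rw [tracefree, matRight_sub_left, matRight_diagonal, ← map_sum,
    show ∑ i, C i i = C.trace from rfl, hC, map_zero, sub_zero]

/-- Trace corrections drop out by `matLeft_tracefree`, and the remaining matrix products cancel by
two instances of the cyclic identity. -/
theorem matLeft_jacobi (A B C : sa3) :
    matLeft A.1 (matComm B C).1 =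
      matLeft (matComm A B).1 C.1 + matLeft B.1 (matComm A C).1 := by
  rw [matLeft_swap A.1, matLeft_swap B.1]
  simp only [matComm, matLeft_tracefree _ A.2.2, matLeft_tracefree _ B.2.2,
    matLeft_tracefree _ C.2.2, matLeft_sub_left]
  linear_combination (norm := abel) matLeft_cyclic B.1 A.1 C.1 - matLeft_cyclic A.1 B.1 C.1

theorem matRight_jacobi (A B C : sa3) :
    matRight A.1 (matComm B C).1 =
      matRight (matComm A B).1 C.1 + matRight B.1 (matComm A C).1 := by
  rw [matRight_swap A.1, matRight_swap B.1]
  simp only [matComm, matRight_tracefree _ A.2.2, matRight_tracefree _ B.2.2,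
    matRight_tracefree _ C.2.2, matRight_sub_left]
  linear_combination (norm := abel) matRight_cyclic B.1 A.1 C.1 - matRight_cyclic A.1 B.1 C.1

/-! ### The subalgebra of elements satisfying the Jacobi identity -/

/-- The elements of `𝔢₈` whose adjoint action is a derivation of the bracket. -/
def jacobiSet : Submodule ℝ E8 where
  carrier := {x | ∀ y z : E8, ⁅x, ⁅y, z⁆⁆ = ⁅⁅x, y⁆, z⁆ + ⁅y, ⁅x, z⁆⁆}
  add_mem' {x x'} hx hx' y z := by
    simp only [add_bracket, bracket_add, hx y z, hx' y z]
    abel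
  zero_mem' y z := by simp only [zero_bracket, bracket_zero, add_zero]
  smul_mem' r x hx y z := by
    simp only [smul_bracket, bracket_smul, hx y z, smul_add]

/-- If `ad x` is a derivation, then `ad ⁅x, y⁆` is the commutator of `ad x` and `ad y`, and a
commutator of derivations is a derivation. The Jacobi identity thus needs to be checked on
generators only. -/
theorem bracket_mem_jacobiSet {x y : E8} (hx : x ∈ jacobiSet) (hy : y ∈ jacobiSet) :
    ⁅x, y⁆ ∈ jacobiSet := by
  intro z w
  have h : ∀ v, ⁅⁅x, y⁆, v⁆ = ⁅x, ⁅y, v⁆⁆ - ⁅y, ⁅x, v⁆⁆ := fun v => by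
    rw [hx y v, add_sub_cancel_right]
  rw [h, h z, h w, hy z w, hx z w, bracket_add, bracket_add, hx ⁅y, z⁆ w, hx z ⁅y, w⁆,
    hy ⁅x, z⁆ w, hy z ⁅x, w⁆, sub_bracket, bracket_sub]
  abel

theorem derMat_derComm (d d' : derAlg 1) (e e' : derAlg (-1)) (A : sa3) :
    derMat (derComm d d') (derComm e e') A =
      derMat d e (derMat d' e' A) - derMat d' e' (derMat d e A) := by
  apply Subtype.ext
  ext i j
  change derTensor _ _ (A.1 i j) =
    derTensor d e (derTensor d' e' (A.1 i j)) - derTensor d' e' (derTensor d e (A.1 i j))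
  induction A.1 i j using OO_induct with
  | hadd x y hx hy =>
    simp only [map_add, hx, hy]
    abel
  | h a b =>
    simp only [derTensor_tmul, map_add, derComm_apply, TensorProduct.sub_tmul,
      TensorProduct.tmul_sub]
    abel

theorem tracefree_map (f : OO →ₗ[ℝ] OO) (A : Mat3 OO) :
    (tracefree A).map f = tracefree (A.map f) := by
  ext i j
  by_cases h : i = j
  · subst h
    simp [tracefree, Matrix.trace]
  · simp [tracefree, h]

theorem derMat_matComm (d : derAlg 1) (e : derAlg (-1)) (A B : sa3) :
    derMat d e (matComm A B) = matComm (derMat d e A) B + matComm A (derMat d e B) := by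
  apply Subtype.ext
  simp only [derMat, matComm, tracefree_map, Submodule.coe_add, ← tracefree_add]
  congr 1
  ext i j
  simp only [Matrix.map_apply, Matrix.sub_apply, Matrix.add_apply, Matrix.mul_apply, map_sub,
    map_sum, derTensor_mul, Finset.sum_add_distrib]
  abel

theorem derComm_matLeft (d : derAlg 1) (e : derAlg (-1)) (A B : sa3) :
    derComm d (matLeft A.1 B.1) =
      matLeft (derMat d e A).1 B.1 + matLeft A.1 (derMat d e B).1 := by
  have h : ∀ f : Fin 3 → derAlg 1, derComm d (∑ i, f i) = ∑ i, derComm d (f i) := fun f => by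
    simp only [Fin.sum_univ_three, derComm_add_right]
  simp only [matLeft, h, derComm_leftDer d e, Finset.sum_add_distrib]
  rfl

theorem derComm_matRight (d : derAlg 1) (e : derAlg (-1)) (A B : sa3) :
    derComm e (matRight A.1 B.1) =
      matRight (derMat d e A).1 B.1 + matRight A.1 (derMat d e B).1 := by
  have h : ∀ f : Fin 3 → derAlg (-1), derComm e (∑ i, f i) = ∑ i, derComm e (f i) := fun f => by
    simp only [Fin.sum_univ_three, derComm_add_right]
  simp only [matRight, h, derComm_rightDer d e, Finset.sum_add_distrib]
  rfl

theorem derMat_zero (A : sa3) : derMat 0 0 A = 0 := by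
  simpa using derMat_smul_left 0 0 0 A

theorem derComm_zero_left {ε : ℝ} (D : derAlg ε) : derComm 0 D = 0 := by
  simpa using derComm_smul_left 0 0 D

theorem derComm_zero_right {ε : ℝ} (D : derAlg ε) : derComm D 0 = 0 := by
  simpa using derComm_smul_right 0 D 0

theorem matComm_zero_left (A : sa3) : matComm 0 A = 0 := by
  simpa using matComm_smul_left 0 0 A

theorem derMat_mat_zero (d : derAlg 1) (e : derAlg (-1)) : derMat d e 0 = 0 := by
  simpa using derMat_smul_right 0 d e 0

theorem matLeft_zero_left (A : Mat3 OO) : matLeft 0 A = 0 := by simp [matLeft]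

theorem matRight_zero_left (A : Mat3 OO) : matRight 0 A = 0 := by simp [matRight]

theorem derMat_sub_right (d : derAlg 1) (e : derAlg (-1)) (A B : sa3) :
    derMat d e (A - B) = derMat d e A - derMat d e B := by
  rw [sub_eq_add_neg, derMat_add_right, ← neg_one_smul ℝ B, derMat_smul_right]
  module

theorem der_bracket (d d' : derAlg 1) (e e' : derAlg (-1)) (B : sa3) :
    ⁅((0, d, e) : E8), ((B, d', e') : E8)⁆ = (derMat d e B, derComm d d', derComm e e') := by
  rw [bracket_mk, matComm_zero_left, derMat_mat_zero, Submodule.coe_zero, matLeft_zero_left,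
    matRight_zero_left]
  simp

theorem mat_bracket (A B : sa3) :
    ⁅((A, 0, 0) : E8), ((B, 0, 0) : E8)⁆ =
      (matComm A B, (1 / 3 : ℝ) • matLeft A.1 B.1, (1 / 3 : ℝ) • matRight A.1 B.1) := by
  rw [bracket_mk, derMat_zero, derMat_zero, derComm_zero_left, derComm_zero_left]
  simp

/-- Every ingredient of the bracket, namely matrix product, trace and `D(x, y)`, is equivariant
under pairs of derivations. -/
theorem der_mem_jacobiSet (d : derAlg 1) (e : derAlg (-1)) : ((0, d, e) : E8) ∈ jacobiSet := by
  rintro ⟨A, d₁, e₁⟩ ⟨B, d₂, e₂⟩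
  rw [bracket_mk A B d₁ d₂ e₁ e₂, der_bracket, der_bracket, der_bracket, bracket_mk, bracket_mk]
  refine Prod.ext ?_ (Prod.ext ?_ ?_)
  · simp only [Prod.fst_add, derMat_add_right, derMat_sub_right, derMat_matComm, derMat_derComm]
    abel
  · simp only [Prod.fst_add, Prod.snd_add, derComm_add_right, derComm_smul_right,
      derComm_matLeft d e, derComm_jacobi d d₁ d₂]
    module
  · simp only [Prod.snd_add, derComm_add_right, derComm_smul_right,
      derComm_matRight d e, derComm_jacobi e e₁ e₂]
    module

/-- Derivations already lie in `jacobiSet`, so by antisymmetry the identity holds as soon as one of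
the other two entries is a derivation. -/
theorem mem_jacobiSet_of_mat {x : E8}
    (h : ∀ A B : sa3, ⁅x, ⁅((A, 0, 0) : E8), ((B, 0, 0) : E8)⁆⁆ =
      ⁅⁅x, ((A, 0, 0) : E8)⁆, ((B, 0, 0) : E8)⁆ + ⁅((A, 0, 0) : E8), ⁅x, ((B, 0, 0) : E8)⁆⁆) :
    x ∈ jacobiSet := by
  have hd : ∀ (d : derAlg 1) (e : derAlg (-1)) (z : E8), ⁅x, ⁅((0, d, e) : E8), z⁆⁆ =
      ⁅⁅x, ((0, d, e) : E8)⁆, z⁆ + ⁅((0, d, e) : E8), ⁅x, z⁆⁆ := fun d e z => by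
    rw [der_mem_jacobiSet d e x z, bracket_swap x ((0, d, e) : E8), neg_bracket]
    abel
  have hd' : ∀ (d : derAlg 1) (e : derAlg (-1)) (z : E8), ⁅x, ⁅z, ((0, d, e) : E8)⁆⁆ =
      ⁅⁅x, z⁆, ((0, d, e) : E8)⁆ + ⁅z, ⁅x, ((0, d, e) : E8)⁆⁆ := fun d e z => by
    rw [bracket_swap z, bracket_neg, hd, bracket_swap ⁅x, z⁆, bracket_swap z]
    abel
  rintro ⟨A, d, e⟩ ⟨B, d', e'⟩
  have h1 : ((A, d, e) : E8) = (A, 0, 0) + (0, d, e) := by simp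
  have h2 : ((B, d', e') : E8) = (B, 0, 0) + (0, d', e') := by simp
  rw [h1, h2]
  simp only [add_bracket, bracket_add]
  rw [h, hd, hd, hd']
  abel

/-- The two derivation components hold for all matrices by `matLeft_jacobi` and `matRight_jacobi`;
the hypothesis is the matrix component. -/
theorem mat_mem_jacobiSet {X : sa3}
    (h : ∀ A B : sa3, matComm X (matComm A B) -
        (1 / 3 : ℝ) • derMat (matLeft A.1 B.1) (matRight A.1 B.1) X =
      matComm (matComm X A) B + (1 / 3 : ℝ) • derMat (matLeft X.1 A.1) (matRight X.1 A.1) B +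
      (matComm A (matComm X B) -
        (1 / 3 : ℝ) • derMat (matLeft X.1 B.1) (matRight X.1 B.1) A)) :
    ((X, 0, 0) : E8) ∈ jacobiSet := by
  refine mem_jacobiSet_of_mat fun A B => ?_
  rw [mat_bracket, mat_bracket, mat_bracket, bracket_mk, bracket_mk, bracket_mk]
  refine Prod.ext ?_ (Prod.ext ?_ ?_)
  · have h := h A B
    simp only [Prod.fst_add, derMat_smul_left, derMat_zero]
    linear_combination (norm := abel) h
  · simp only [Prod.fst_add, Prod.snd_add, derComm_zero_left, derComm_zero_right,
      matLeft_jacobi X A B]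
    module
  · simp only [Prod.snd_add, derComm_zero_left, derComm_zero_right, matRight_jacobi X A B]
    module

/-! ### The Jacobi identity for real matrices -/

theorem mul_assoc_of_entries {R : Type} [NonUnitalNonAssocSemiring R] {A B C : Mat3 R}
    (h : ∀ i j k l, (A i j * B j k) * C k l = A i j * (B j k * C k l)) :
    (A * B) * C = A * (B * C) := by
  ext i l
  simp only [Matrix.mul_apply, Finset.sum_mul, Finset.mul_sum, h]
  exact Finset.sum_comm

/-- The real matrix `r`, as a matrix over `𝕆' ⊗ 𝕆`. -/
def realMat (r : Mat3 ℝ) : Mat3 OO := r.map fun t => t • (1 : OO)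

section RealMat
variable (r : Mat3 ℝ) (A B : Mat3 OO)

theorem realMat_mul_assoc : (realMat r * A) * B = realMat r * (A * B) :=
  mul_assoc_of_entries fun i j k l => by
    simp only [realMat, Matrix.map_apply, smul_mul_assoc, one_mul]

theorem mul_realMat_assoc : (A * realMat r) * B = A * (realMat r * B) :=
  mul_assoc_of_entries fun i j k l => by
    simp only [realMat, Matrix.map_apply, smul_mul_assoc, one_mul, mul_smul_comm, mul_one]

theorem mul_assoc_realMat : (A * B) * realMat r = A * (B * realMat r) :=
  mul_assoc_of_entries fun i j k l => by
    simp only [realMat, Matrix.map_apply, mul_smul_comm, mul_one]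

theorem trace_realMat_mul : (realMat r * A).trace = (A * realMat r).trace := by
  simp only [Matrix.trace, Matrix.diag, Matrix.mul_apply, realMat, Matrix.map_apply,
    smul_mul_assoc, one_mul, mul_smul_comm, mul_one]
  exact Finset.sum_comm

theorem leftDer_smul_one (t : ℝ) (x : OO) : leftDer 1 (-1) (t • 1) x = 0 := by
  rw [map_smul, LinearMap.smul_apply]
  induction x using OO_induct with
  | hadd x y hx hy => rw [map_add, smul_add, hx, hy, add_zero]
  | h a b =>
    rw [Algebra.TensorProduct.one_def, leftDer_tmul, innerDer_one_left, smul_zero, smul_zero]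

theorem rightDer_smul_one (t : ℝ) (x : OO) : rightDer 1 (-1) (t • 1) x = 0 := by
  rw [map_smul, LinearMap.smul_apply]
  induction x using OO_induct with
  | hadd x y hx hy => rw [map_add, smul_add, hx, hy, add_zero]
  | h a b =>
    rw [Algebra.TensorProduct.one_def, rightDer_tmul, innerDer_one_left, smul_zero, smul_zero]

theorem matLeft_realMat : matLeft (realMat r) A = 0 :=
  Finset.sum_eq_zero fun _ _ => Finset.sum_eq_zero fun _ _ => leftDer_smul_one _ _

theorem matRight_realMat : matRight (realMat r) A = 0 :=
  Finset.sum_eq_zero fun _ _ => Finset.sum_eq_zero fun _ _ => rightDer_smul_one _ _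

theorem realMat_comm_tracefree : realMat r * tracefree A - tracefree A * realMat r =
    realMat r * A - A * realMat r := by
  have h : ∀ t : OO, realMat r * Matrix.diagonal (fun _ => t) =
      Matrix.diagonal (fun _ => t) * realMat r := fun t => by
    ext i j
    simp [Matrix.diagonal_mul, Matrix.mul_diagonal, realMat]
  rw [tracefree, mul_sub, sub_mul, h]
  abel

theorem derTensor_one (d : derAlg 1) (e : derAlg (-1)) : derTensor d e 1 = 0 := by
  rw [Algebra.TensorProduct.one_def, derTensor_tmul, der_one d.2, der_one e.2]
  simp

end RealMat

theorem matComm_realMat {X : sa3} {r : Mat3 ℝ} (hX : X.1 = realMat r) (A : sa3) :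
    (matComm X A).1 = realMat r * A.1 - A.1 * realMat r := by
  change tracefree (X.1 * A.1 - A.1 * X.1) = _
  rw [hX]
  exact tracefree_of_trace (by rw [Matrix.trace_sub, trace_realMat_mul, sub_self])

/-- Real numbers associate with everything and are annihilated by derivations. Hence the commutator
with `X` is an honest derivation of the matrix product, commuting with the passage to tracefree
parts, and all terms `D(X, ·)` are zero. -/
theorem realMat_mem_jacobiSet {X : sa3} {r : Mat3 ℝ} (hX : X.1 = realMat r) :
    ((X, 0, 0) : E8) ∈ jacobiSet := by
  refine mat_mem_jacobiSet fun A B => ?_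
  have hd : ∀ d e, derMat d e X = 0 := fun d e => by
    apply Subtype.ext
    ext i j
    change derTensor d e (X.1 i j) = 0
    rw [hX, realMat, Matrix.map_apply, map_smul, derTensor_one, smul_zero]
  rw [hd, hX, matLeft_realMat, matRight_realMat, matLeft_realMat, matRight_realMat, derMat_zero,
    derMat_zero]
  simp only [smul_zero, add_zero, sub_zero]
  apply Subtype.ext
  rw [matComm_realMat hX, Submodule.coe_add]
  change realMat r * tracefree (A.1 * B.1 - B.1 * A.1) -
    tracefree (A.1 * B.1 - B.1 * A.1) * realMat r =
    tracefree ((matComm X A).1 * B.1 - B.1 * (matComm X A).1) +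
      tracefree (A.1 * (matComm X B).1 - (matComm X B).1 * A.1)
  rw [realMat_comm_tracefree, matComm_realMat hX, matComm_realMat hX, ← tracefree_add,
    ← tracefree_of_trace (A := realMat r * _ - _) (by
      rw [Matrix.trace_sub, trace_realMat_mul, sub_self])]
  congr 1
  simp only [mul_sub, sub_mul, realMat_mul_assoc, mul_realMat_assoc, mul_assoc_realMat]
  abel

/-! ### The Jacobi identity for diagonal matrices -/

section Diagonal
variable {u : OO} {s : Fin 3 → ℝ}

theorem diagonal_commutator_apply (A : Mat3 OO) (m n : Fin 3) :
    (Matrix.diagonal (fun i => s i • u) * A - A * Matrix.diagonal (fun i => s i • u)) m n =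
      s m • (u * A m n) - s n • (A m n * u) := by
  rw [Matrix.sub_apply, Matrix.diagonal_mul, Matrix.mul_diagonal, smul_mul_assoc, mul_smul_comm]

/-- Collecting by weight gives associators with `u` in first place (weight `s m`), in the middle (`s
p`) and last (`s n`). Since `u` alternates, up to sign they are a single associator. When the `s i`
sum to zero, three distinct indices contribute nothing. -/
theorem diagonal_derivation_defect (hu : IsAlternative u) (A B : Mat3 OO) (m n : Fin 3) :
    (Matrix.diagonal (fun i => s i • u) * (A * B) - (A * B) * Matrix.diagonal (fun i => s i • u) -
      (Matrix.diagonal (fun i => s i • u) * A - A * Matrix.diagonal (fun i => s i • u)) * B -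
      A * (Matrix.diagonal (fun i => s i • u) * B - B * Matrix.diagonal (fun i => s i • u))) m n =
      -∑ p, (s m + s p + s n) • assoc u (A m p) (B p n) := by
  rw [Matrix.sub_apply, Matrix.sub_apply, diagonal_commutator_apply, Matrix.mul_apply (M := A),
    Matrix.mul_apply, Matrix.mul_apply]
  simp only [diagonal_commutator_apply]
  rw [Finset.mul_sum, Finset.sum_mul, Finset.smul_sum, Finset.smul_sum, ← Finset.sum_sub_distrib,
    ← Finset.sum_sub_distrib, ← Finset.sum_sub_distrib, ← Finset.sum_neg_distrib]
  refine Finset.sum_congr rfl fun p _ => ?_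
  have h1 := hu.assoc_mid (A m p) (B p n)
  have h2 := hu.assoc_right (A m p) (B p n)
  simp only [assoc, sub_mul, mul_sub, smul_mul_assoc, mul_smul_comm] at h1 h2 ⊢
  linear_combination (norm := module) s p • h1 - s n • h2

theorem trace_diagonal_commutator (A : Mat3 OO) :
    (Matrix.diagonal (fun i => s i • u) * A - A * Matrix.diagonal (fun i => s i • u)).trace =
      ∑ p, s p • (u * A p p - A p p * u) := by
  simp only [Matrix.trace, Matrix.diag, diagonal_commutator_apply, smul_sub]

theorem derMat_apply (d : derAlg 1) (e : derAlg (-1)) (A : sa3) (i j : Fin 3) :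
    (derMat d e A).1 i j = derTensor d e (A.1 i j) := rfl

theorem derTensor_sum {ι : Type} (t : Finset ι) (d : ι → derAlg 1) (e : ι → derAlg (-1)) (x : OO) :
    derTensor (∑ i ∈ t, d i) (∑ i ∈ t, e i) x = ∑ i ∈ t, derTensor (d i) (e i) x := by
  have h := congrArg (fun f : Module.End ℝ OO => f x) (map_sum derTensorHom (fun i => (d i, e i)) t)
  rw [show ∑ i ∈ t, (d i, e i) = (∑ i ∈ t, d i, ∑ i ∈ t, e i) from
    Prod.ext (Prod.fst_sum) (Prod.snd_sum)] at h
  simpa [derTensorHom] using h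

theorem derTensor_matLeft (A B : Mat3 OO) (y : OO) :
    derTensor (matLeft A B) (matRight A B) y = ∑ i, ∑ j, pairDer (A i j) (B j i) y := by
  rw [matLeft, matRight, derTensor_sum]
  refine Finset.sum_congr rfl fun i _ => ?_
  rw [derTensor_sum]
  rfl

theorem derTensor_matLeft_diagonal (A : Mat3 OO) (y : OO) :
    derTensor (matLeft (Matrix.diagonal fun i => s i • u) A)
      (matRight (Matrix.diagonal fun i => s i • u) A) y = ∑ i, s i • pairDer u (A i i) y := by
  rw [matLeft_diagonal, matRight_diagonal, derTensor_sum]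
  refine Finset.sum_congr rfl fun i _ => ?_
  rw [← pairDer_apply, map_smul, LinearMap.smul_apply, LinearMap.smul_apply]

theorem sa3_star (A : sa3) (i j : Fin 3) : star (A.1 i j) = -A.1 j i :=
  congrFun (congrFun A.2.1 j) i

/-- For anti-Hermitian matrices, conjugating the entries at `(i, j)` and `(j, i)` exchanges them up
to sign. Summing `comm_add_pairDer` over all positions therefore counts everything twice, whence
half of `-3`. -/
theorem comm_trace_add_derTensor (hu : star u = -u) (A B : sa3) :
    (u * (A.1 * B.1 - B.1 * A.1).trace - (A.1 * B.1 - B.1 * A.1).trace * u) +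
      derTensor (matLeft A.1 B.1) (matRight A.1 B.1) u =
      (-3 / 2 : ℝ) • ∑ i, ∑ j, symAssoc u (A.1 i j) (B.1 j i) := by
  have hn : ∀ x y : OO, -x * -y = x * y := fun x y => neg_mul_neg x y
  have h := fun i j => comm_add_pairDer hu (A.1 i j) (B.1 j i)
  simp only [sa3_star, map_neg, LinearMap.neg_apply, neg_neg, hn] at h
  have hs : ∀ f g : Fin 3 → Fin 3 → OO, (∀ i j, f i j = g i j) →
      ∑ i, ∑ j, f i j = ∑ i, ∑ j, g i j := fun f g h => by simp only [h]
  have h := hs _ _ h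
  have hp : ∑ i, ∑ j, pairDer (A.1 j i) (B.1 i j) u = ∑ i, ∑ j, pairDer (A.1 i j) (B.1 j i) u :=
    Finset.sum_comm
  have ht : ∑ i, ∑ j, (A.1 i j * B.1 j i - B.1 j i * A.1 i j +
      (A.1 j i * B.1 i j - B.1 i j * A.1 j i)) = (2 : ℝ) • (A.1 * B.1 - B.1 * A.1).trace := by
    simp only [Matrix.trace, Matrix.diag, Matrix.sub_apply, Matrix.mul_apply, Finset.sum_sub_distrib,
      Finset.sum_add_distrib]
    rw [Finset.sum_comm (f := fun i j => B.1 j i * A.1 i j),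
      Finset.sum_comm (f := fun i j => A.1 j i * B.1 i j)]
    module
  simp only [Finset.sum_add_distrib (f := fun i => _ - _), Finset.sum_add_distrib, hp,
    Finset.sum_sub_distrib, ← Finset.mul_sum, ← Finset.sum_mul, ← Finset.smul_sum] at h
  simp only [Finset.sum_add_distrib, Finset.sum_sub_distrib] at ht
  rw [ht] at h
  rw [derTensor_matLeft]
  simp only [mul_smul_comm, smul_mul_assoc] at h
  linear_combination (norm := module) (1 / 2 : ℝ) • h

theorem const_diagonal_mul (t : OO) (A : Mat3 OO) (m n : Fin 3) :
    (Matrix.diagonal (fun _ => t) * A : Mat3 OO) m n = t * A m n := Matrix.diagonal_mul _ _ _ _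

theorem mul_const_diagonal (t : OO) (A : Mat3 OO) (m n : Fin 3) :
    (A * Matrix.diagonal (fun _ => t) : Mat3 OO) m n = A m n * t := Matrix.mul_diagonal _ _ _ _

theorem tracefree_apply (A : Mat3 OO) (m n : Fin 3) :
    tracefree A m n = A m n - if m = n then (1 / 3 : ℝ) • A.trace else 0 := by
  rw [tracefree, Matrix.sub_apply, Matrix.diagonal_apply]

end Diagonal

theorem tracefree_mul_apply (P B : Mat3 OO) (m n : Fin 3) :
    (tracefree P * B) m n = (P * B) m n - ((1 / 3 : ℝ) • P.trace) * B m n := by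
  rw [tracefree, sub_mul, Matrix.sub_apply, const_diagonal_mul]

theorem mul_tracefree_apply (P B : Mat3 OO) (m n : Fin 3) :
    (B * tracefree P) m n = (B * P) m n - B m n * ((1 / 3 : ℝ) • P.trace) := by
  rw [tracefree, mul_sub, Matrix.sub_apply, mul_const_diagonal]

theorem matComm_val (A B : sa3) : (matComm A B).1 = tracefree (A.1 * B.1 - B.1 * A.1) := rfl

section Diagonal
variable {u : OO} {s : Fin 3 → ℝ}

/-- The failure of the commutator with `diag(s₀ u, s₁ u, s₂ u)` to be a derivation. -/
theorem matComm_diagonal_defect (hu : IsAlternative u) {X : sa3}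
    (hX : X.1 = Matrix.diagonal fun i => s i • u) (A B : sa3) :
    ∃ κ : OO, ∀ m n : Fin 3,
      (matComm X (matComm A B)).1 m n - (matComm (matComm X A) B).1 m n -
        (matComm A (matComm X B)).1 m n =
      -∑ p, (s m + s p + s n) •
          (assoc u (A.1 m p) (B.1 p n) - assoc u (B.1 m p) (A.1 p n)) +
        (1 / 3 : ℝ) • ((∑ p, s p • (u * A.1 p p - A.1 p p * u)) * B.1 m n -
          B.1 m n * ∑ p, s p • (u * A.1 p p - A.1 p p * u)) -
        (1 / 3 : ℝ) • ((∑ p, s p • (u * B.1 p p - B.1 p p * u)) * A.1 m n -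
          A.1 m n * ∑ p, s p • (u * B.1 p p - B.1 p p * u)) -
        if m = n then (s m * (1 / 3)) • (u * (A.1 * B.1 - B.1 * A.1).trace -
          (A.1 * B.1 - B.1 * A.1).trace * u) + κ else 0 := by
  -- The scalar `κ` gathers the three outermost trace corrections. It is the same at every diagonal
  -- position, so its value never matters.
  refine ⟨(1 / 3 : ℝ) • (X.1 * (matComm A B).1 - (matComm A B).1 * X.1).trace -
    (1 / 3 : ℝ) • ((matComm X A).1 * B.1 - B.1 * (matComm X A).1).trace -
    (1 / 3 : ℝ) • (A.1 * (matComm X B).1 - (matComm X B).1 * A.1).trace, fun m n => ?_⟩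
  have h1 := diagonal_derivation_defect (s := s) hu A.1 B.1 m n
  have h2 := diagonal_derivation_defect (s := s) hu B.1 A.1 m n
  rw [← trace_diagonal_commutator, ← trace_diagonal_commutator, ← hX]
  rw [← hX] at h1 h2
  have h3 : (X.1 * (matComm A B).1 - (matComm A B).1 * X.1) m n =
      (X.1 * (A.1 * B.1) - A.1 * B.1 * X.1) m n - (X.1 * (B.1 * A.1) - B.1 * A.1 * X.1) m n -
      if m = n then (s m * (1 / 3)) • (u * (A.1 * B.1 - B.1 * A.1).trace -
          (A.1 * B.1 - B.1 * A.1).trace * u) else 0 := by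
    rw [hX, diagonal_commutator_apply, diagonal_commutator_apply, diagonal_commutator_apply,
      matComm_val, tracefree_apply, Matrix.sub_apply]
    split_ifs with h
    · subst h
      simp only [mul_sub, sub_mul, mul_smul_comm, smul_mul_assoc, smul_sub]
      module
    · simp only [mul_sub, sub_mul, smul_sub, sub_zero]
      abel
  rw [matComm_val X, tracefree_apply, h3, matComm_val (matComm X A), tracefree_apply,
    matComm_val A (matComm X B), tracefree_apply]
  simp only [smul_sub, Finset.sum_sub_distrib]
  rw [Matrix.sub_apply (A := (matComm X A).1 * B.1), Matrix.sub_apply (A := A.1 * (matComm X B).1),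
    matComm_val X A, matComm_val X B, tracefree_mul_apply, mul_tracefree_apply, tracefree_mul_apply,
    mul_tracefree_apply]
  simp only [Matrix.sub_apply, smul_mul_assoc, mul_smul_comm] at h1 h2 ⊢
  split_ifs with h
  · linear_combination (norm := module) h1 - h2
  · linear_combination (norm := module) h1 - h2

end Diagonal

theorem sum_eq_of_ne {M : Type} [AddCommMonoid M] {m n k : Fin 3} (h1 : m ≠ n) (h2 : m ≠ k)
    (h3 : n ≠ k) (f : Fin 3 → M) : ∑ p, f p = f m + f n + f k := by
  rw [show (Finset.univ : Finset (Fin 3)) = {m, n, k} by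
    revert m n k; decide, Finset.sum_insert (by simp [h1, h2]), Finset.sum_pair h3, add_assoc]

theorem exists_third (m n : Fin 3) (h : m ≠ n) : ∃ k : Fin 3, m ≠ k ∧ n ≠ k := by
  revert m n; decide

theorem comm_sub_pairDer {u v : OO} (hu : star u = -u) (hv : star v = -v) (y : OO) :
    (u * v - v * u) * y - y * (u * v - v * u) - pairDer u v y = (3 : ℝ) • assoc u v y := by
  rw [pairDer_skew hu hv]
  abel

/-- Let `Z` be the difference of the two sides of the Jacobi identity. All its entries are
combinations of associators with `u`, apart from a scalar on the diagonal. The off-diagonal entries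
vanish, the diagonal entries agree with each other, and `Z` has trace zero. -/
theorem diagonal_mem_jacobiSet {u : OO} {s : Fin 3 → ℝ} (hu : star u = -u) (hs : ∑ i, s i = 0)
    {X : sa3} (hX : X.1 = Matrix.diagonal fun i => s i • u) : ((X, 0, 0) : E8) ∈ jacobiSet := by
  refine mat_mem_jacobiSet fun A B => ?_
  have hu' := isAlternative_of_star hu
  obtain ⟨κ, hκ⟩ := matComm_diagonal_defect hu' hX A B
  set Q : OO := u * (A.1 * B.1 - B.1 * A.1).trace - (A.1 * B.1 - B.1 * A.1).trace * u +
    derTensor (matLeft A.1 B.1) (matRight A.1 B.1) u with hQ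
  set Z : sa3 := matComm X (matComm A B) -
      (1 / 3 : ℝ) • derMat (matLeft A.1 B.1) (matRight A.1 B.1) X -
      (matComm (matComm X A) B + (1 / 3 : ℝ) • derMat (matLeft X.1 A.1) (matRight X.1 A.1) B +
      (matComm A (matComm X B) -
        (1 / 3 : ℝ) • derMat (matLeft X.1 B.1) (matRight X.1 B.1) A)) with hZ
  -- A trace correction is a commutator with commutators of `u` and diagonal entries; subtracting
  -- the matching derivation leaves bare associators, by `pairDer_skew`. The factor `3` there meets
  -- the `1/3` of the bracket.
  have hcorr : ∀ (A : sa3) (y : OO), (1 / 3 : ℝ) • ((∑ p, s p • (u * A.1 p p - A.1 p p * u)) * y -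
      y * ∑ p, s p • (u * A.1 p p - A.1 p p * u)) -
      (1 / 3 : ℝ) • derTensor (matLeft X.1 A.1) (matRight X.1 A.1) y =
      ∑ p, s p • assoc u (A.1 p p) y := fun A y => by
    rw [hX, derTensor_matLeft_diagonal, ← smul_sub, Finset.sum_mul, Finset.mul_sum,
      ← Finset.sum_sub_distrib, ← Finset.sum_sub_distrib, Finset.smul_sum]
    refine Finset.sum_congr rfl fun p _ => ?_
    have h := comm_sub_pairDer hu (sa3_star A p p) y
    simp only [smul_mul_assoc, mul_smul_comm]
    linear_combination (norm := module) ((1 / 3 : ℝ) * s p) • h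
  have hent : ∀ m n, Z.1 m n = -∑ p, (s m + s p + s n) •
          (assoc u (A.1 m p) (B.1 p n) - assoc u (B.1 m p) (A.1 p n)) +
        ∑ p, s p • assoc u (A.1 p p) (B.1 m n) - ∑ p, s p • assoc u (B.1 p p) (A.1 m n) -
        if m = n then (s m * (1 / 3)) • Q + κ else 0 := fun m n => by
    rw [← hcorr A, ← hcorr B]
    have h := hκ m n
    have hd : derTensor (matLeft A.1 B.1) (matRight A.1 B.1) (X.1 m n) =
        if m = n then s m • derTensor (matLeft A.1 B.1) (matRight A.1 B.1) u else 0 := by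
      rw [hX, Matrix.diagonal_apply]
      split_ifs
      · rw [map_smul]
      · rw [map_zero]
    simp only [hZ, AddSubgroupClass.coe_sub, Submodule.coe_add, Submodule.coe_smul,
      Matrix.sub_apply, Matrix.add_apply, Matrix.smul_apply, derMat_apply, hd, hQ]
    split_ifs at h ⊢
    · linear_combination (norm := module) h
    · linear_combination (norm := module) h
  have hA : ∑ p, A.1 p p = 0 := A.2.2
  have hB : ∑ p, B.1 p p = 0 := B.2.2
  -- With `k` the third index, the term `p = k` has weight `s m + s k + s n = 0`. In the terms `p =
  -- m` and `p = n`, tracelessness removes the `(k, k)` entries, and the anti-Hermitian diagonal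
  -- entries can be moved within the associators.
  have hoff : ∀ m n, m ≠ n → Z.1 m n = 0 := fun m n h => by
    obtain ⟨k, hk1, hk2⟩ := exists_third m n h
    rw [hent, if_neg h]
    rw [sum_eq_of_ne h hk1 hk2] at hs hA hB ⊢
    rw [sum_eq_of_ne h hk1 hk2, sum_eq_of_ne h hk1 hk2]
    have hs' : s k = -(s m + s n) := eq_neg_of_add_eq_zero_right hs
    have hA' : A.1 k k = -(A.1 m m + A.1 n n) := eq_neg_of_add_eq_zero_right hA
    have hB' : B.1 k k = -(B.1 m m + B.1 n n) := eq_neg_of_add_eq_zero_right hB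
    have h1 := (isAlternative_of_star (sa3_star A n n)).assoc_mid u (B.1 m n)
    have h1' := (isAlternative_of_star (sa3_star A n n)).assoc_right u (B.1 m n)
    have h2 := (isAlternative_of_star (sa3_star B n n)).assoc_mid u (A.1 m n)
    have h2' := (isAlternative_of_star (sa3_star B n n)).assoc_right u (A.1 m n)
    rw [hs', hA', hB']
    simp only [assoc_neg_mid, assoc_add_mid, h1, h1', h2, h2']
    module
  have hW : ∀ i j, assoc u (A.1 i j) (B.1 j i) - assoc u (B.1 i j) (A.1 j i) =
      symAssoc u (A.1 i j) (B.1 j i) := fun i j => by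
    rw [symAssoc, sa3_star, sa3_star, assoc_neg_mid, assoc_neg_right, neg_neg]
  have hWs : ∀ i j, symAssoc u (A.1 i j) (B.1 j i) = symAssoc u (A.1 j i) (B.1 i j) := fun i j => by
    rw [← symAssoc_star hu, sa3_star, sa3_star, ← hW, symAssoc, star_neg, star_neg, sa3_star,
      sa3_star]
    simp only [assoc_neg_mid, assoc_neg_right, neg_neg]
  have hWd : ∀ i, symAssoc u (A.1 i i) (B.1 i i) = (2 : ℝ) • assoc u (A.1 i i) (B.1 i i) :=
    fun i => by
      have h1 := (isAlternative_of_star (sa3_star B i i)).assoc_mid u (A.1 i i)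
      have h1' := (isAlternative_of_star (sa3_star B i i)).assoc_right u (A.1 i i)
      rw [← hW, h1, ← h1']
      module
  -- Comparing two diagonal entries eliminates `κ`. The trace term in `Q` becomes a sum of
  -- symmetrized associators, which match those produced by the defect of the commutator.
  have hdiag : ∀ m n, m ≠ n → Z.1 m m = Z.1 n n := fun m n h => by
    obtain ⟨k, hk1, hk2⟩ := exists_third m n h
    have h1 : ∀ i j, assoc u (B.1 i i) (A.1 j j) = -assoc u (A.1 j j) (B.1 i i) := fun i j => by
      rw [(isAlternative_of_star (sa3_star B i i)).assoc_mid u (A.1 j j),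
        (isAlternative_of_star (sa3_star B i i)).assoc_right u (A.1 j j)]
    rw [hent, hent, if_pos rfl, if_pos rfl, hQ, comm_trace_add_derTensor hu]
    simp only [hW, h1]
    have hs3 := fun f : Fin 3 → OO => sum_eq_of_ne h hk1 hk2 f
    rw [sum_eq_of_ne h hk1 hk2] at hs hA hB
    simp only [hs3]
    have hs' : s k = -(s m + s n) := eq_neg_of_add_eq_zero_right hs
    have hA' : A.1 k k = -(A.1 m m + A.1 n n) := eq_neg_of_add_eq_zero_right hA
    have hB' : B.1 k k = -(B.1 m m + B.1 n n) := eq_neg_of_add_eq_zero_right hB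
    rw [hWs n m, hWs k m, hWs k n, hWd, hWd, hWd, hs', hA', hB']
    simp only [assoc_neg_mid, assoc_add_mid, assoc_neg_right, assoc_add_right]
    module
  have htr : ∑ p, Z.1 p p = 0 := Z.2.2
  have hZ0 : Z = 0 := by
    apply Subtype.ext
    ext m n
    by_cases h : m = n
    · subst h
      obtain ⟨n, hn⟩ : ∃ n, m ≠ n := ⟨m + 1, by revert m; decide⟩
      obtain ⟨k, hk1, hk2⟩ := exists_third m n hn
      rw [sum_eq_of_ne hn hk1 hk2, ← hdiag m n hn, ← hdiag m k hk1] at htr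
      change Z.1 m m = 0
      linear_combination (norm := module) (1 / 3 : ℝ) • htr
    · exact hoff m n h
  exact sub_eq_zero.mp hZ0

/-! ### Generation of all matrices by real and diagonal ones -/

/-- The embedding of matrices into `𝔢₈`. -/
def matHom : sa3 →ₗ[ℝ] E8 := LinearMap.inl ℝ sa3 (derAlg 1 × derAlg (-1))

theorem matHom_apply (A : sa3) : matHom A = (A, 0, 0) := rfl

/-- The matrix with off-diagonal entries `x` and `-star x` in positions `(i, j)` and `(j, i)`. -/
def offDiag (i j : Fin 3) (h : i ≠ j) : OO →ₗ[ℝ] sa3 where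
  toFun x := ⟨Matrix.single i j x - Matrix.single j i (star x), by
    rw [Matrix.conjTranspose_sub, Matrix.conjTranspose_single, Matrix.conjTranspose_single,
      star_star, neg_sub], by
    rw [Matrix.trace_sub, Matrix.trace_single_eq_of_ne _ _ _ h,
      Matrix.trace_single_eq_of_ne _ _ _ h.symm, sub_zero]⟩
  map_add' x y := Subtype.ext (by
    simp only [star_add, Matrix.single_add, Submodule.coe_add]
    abel)
  map_smul' r x := Subtype.ext (by
    simp only [star_smul, star_trivial, ← Matrix.smul_single, Submodule.coe_smul, RingHom.id_apply,
      smul_sub])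

theorem offDiag_val (i j : Fin 3) (h : i ≠ j) (x : OO) :
    (offDiag i j h x).1 = Matrix.single i j x - Matrix.single j i (star x) := rfl

/-- The diagonal matrix with entries `u` and `-u` in the positions `i` and `j`. -/
def onDiag (i j : Fin 3) (u : OO) (hu : star u = -u) : sa3 :=
  ⟨Matrix.single i i u - Matrix.single j j u, by
    rw [Matrix.conjTranspose_sub, Matrix.conjTranspose_single, Matrix.conjTranspose_single, hu,
      ← Matrix.single_neg, ← Matrix.single_neg]
    abel, by
    rw [Matrix.trace_sub, Matrix.trace_single_eq_same, Matrix.trace_single_eq_same, sub_self]⟩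

theorem onDiag_mem_jacobiSet (i j : Fin 3) (u : OO) (hu : star u = -u) :
    matHom (onDiag i j u hu) ∈ jacobiSet := by
  refine diagonal_mem_jacobiSet (s := Pi.single i 1 - Pi.single j 1) hu
    (by simp [Finset.sum_sub_distrib]) ?_
  change Matrix.single i i u - Matrix.single j j u = _
  rw [← Matrix.diagonal_single, ← Matrix.diagonal_single, Matrix.diagonal_sub]
  congr 1
  funext k
  simp only [Pi.sub_apply, sub_smul, Pi.single_apply]
  split_ifs <;> simp

theorem offDiag_one_eq (i j : Fin 3) (h : i ≠ j) :
    (offDiag i j h 1).1 = realMat (Matrix.single i j 1 - Matrix.single j i 1) := by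
  ext m n
  rw [offDiag_val, star_one, realMat, Matrix.map_apply, Matrix.sub_apply, Matrix.sub_apply,
    Matrix.single_apply, Matrix.single_apply, Matrix.single_apply, Matrix.single_apply, sub_smul]
  split_ifs <;> simp

theorem offDiag_one_mem_jacobiSet (i j : Fin 3) (h : i ≠ j) :
    matHom (offDiag i j h 1) ∈ jacobiSet :=
  realMat_mem_jacobiSet (offDiag_one_eq i j h)

/-- Bracketing the real rotation in the `(i, j)` plane with `diag(u, -u)` in these positions gives
`-2` times this matrix, and no derivation. -/
theorem offDiag_skew_mem_jacobiSet (i j : Fin 3) (h : i ≠ j) {u : OO} (hu : star u = -u) :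
    matHom (offDiag i j h u) ∈ jacobiSet := by
  have h1 := bracket_mem_jacobiSet (offDiag_one_mem_jacobiSet i j h) (onDiag_mem_jacobiSet i j u hu)
  have h2 : ⁅matHom (offDiag i j h 1), matHom (onDiag i j u hu)⁆ =
      (-2 : ℝ) • matHom (offDiag i j h u) := by
    rw [matHom_apply, matHom_apply, mat_bracket, offDiag_one_eq, matLeft_realMat, matRight_realMat,
      smul_zero, smul_zero, ← map_smul, matHom_apply]
    congr 1
    apply Subtype.ext
    rw [matComm_realMat (offDiag_one_eq i j h), ← offDiag_one_eq i j h, Submodule.coe_smul,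
      offDiag_val, offDiag_val, onDiag, hu, star_one, ← Matrix.single_neg]
    simp only [sub_mul, mul_sub, Matrix.single_mul_single_same, Matrix.single_mul_single_of_ne _ _ _ _ h,
      Matrix.single_mul_single_of_ne _ _ _ _ h.symm, one_mul, mul_one]
    module
  rw [h2] at h1
  exact (Submodule.smul_mem_iff _ (by norm_num)).mp h1

theorem star_tmul_one {q : SplitOct} (hq : star q = -q) :
    star (q ⊗ₜ[ℝ] (1 : Oct) : OO) = -(q ⊗ₜ[ℝ] (1 : Oct)) := by
  rw [TensorProduct.star_tmul, hq, star_one, TensorProduct.neg_tmul]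

theorem star_one_tmul {p : Oct} (hp : star p = -p) :
    star ((1 : SplitOct) ⊗ₜ[ℝ] p : OO) = -((1 : SplitOct) ⊗ₜ[ℝ] p) := by
  rw [TensorProduct.star_tmul, hp, star_one, TensorProduct.tmul_neg]

/-- A doubly imaginary entry is reached through the third index `k`, as the product of `q ⊗ 1` at
`(i, k)` with `1 ⊗ p` at `(k, j)`. No derivation arises, since in each factor one argument of `D` is
`1`. -/
theorem offDiag_tmul_mem_jacobiSet (i j : Fin 3) (h : i ≠ j) {q : SplitOct} {p : Oct}
    (hq : star q = -q) (hp : star p = -p) : matHom (offDiag i j h (q ⊗ₜ[ℝ] p)) ∈ jacobiSet := by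
  obtain ⟨k, hik, hjk⟩ := exists_third i j h
  have hq' := star_tmul_one hq
  have hp' := star_one_tmul hp
  have h1 := bracket_mem_jacobiSet (offDiag_skew_mem_jacobiSet i k hik hq')
    (offDiag_skew_mem_jacobiSet k j hjk.symm hp')
  have ha : ∀ m n, ∃ a : SplitOct, (offDiag i k hik (q ⊗ₜ[ℝ] 1)).1 m n = a ⊗ₜ[ℝ] 1 :=
    fun m n => ⟨(Matrix.single i k q + Matrix.single k i q : Mat3 SplitOct) m n, by
      rw [offDiag_val, hq', ← Matrix.single_neg, sub_neg_eq_add, Matrix.add_apply, Matrix.add_apply,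
        TensorProduct.add_tmul]
      simp only [Matrix.single_apply]
      split_ifs <;> simp⟩
  have hb : ∀ m n, ∃ b : Oct, (offDiag k j hjk.symm (1 ⊗ₜ[ℝ] p)).1 m n = 1 ⊗ₜ[ℝ] b :=
    fun m n => ⟨(Matrix.single k j p + Matrix.single j k p : Mat3 Oct) m n, by
      rw [offDiag_val, hp', ← Matrix.single_neg, sub_neg_eq_add, Matrix.add_apply, Matrix.add_apply,
        TensorProduct.tmul_add]
      simp only [Matrix.single_apply]
      split_ifs <;> simp⟩
  have h2 : ⁅matHom (offDiag i k hik (q ⊗ₜ[ℝ] 1)), matHom (offDiag k j hjk.symm (1 ⊗ₜ[ℝ] p))⁆ =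
      matHom (offDiag i j h (q ⊗ₜ[ℝ] p)) := by
    rw [matHom_apply, matHom_apply, mat_bracket, matHom_apply]
    refine Prod.ext (Subtype.ext ?_) (Prod.ext ?_ ?_)
    · have hs : star (q ⊗ₜ[ℝ] p : OO) = q ⊗ₜ[ℝ] p := by
        rw [TensorProduct.star_tmul, hq, hp, TensorProduct.neg_tmul, TensorProduct.tmul_neg, neg_neg]
      have hv : (offDiag i k hik (q ⊗ₜ[ℝ] 1)).1 * (offDiag k j hjk.symm (1 ⊗ₜ[ℝ] p)).1 -
          (offDiag k j hjk.symm (1 ⊗ₜ[ℝ] p)).1 * (offDiag i k hik (q ⊗ₜ[ℝ] 1)).1 =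
          (offDiag i j h (q ⊗ₜ[ℝ] p)).1 := by
        simp only [offDiag_val, hq', hp', hs, ← Matrix.single_neg, sub_neg_eq_add, add_mul, mul_add,
          Matrix.single_mul_single_same, Matrix.single_mul_single_of_ne _ _ _ _ h,
          Matrix.single_mul_single_of_ne _ _ _ _ h.symm, Matrix.single_mul_single_of_ne _ _ _ _ hik,
          Matrix.single_mul_single_of_ne _ _ _ _ hik.symm,
          Matrix.single_mul_single_of_ne _ _ _ _ hjk,
          Matrix.single_mul_single_of_ne _ _ _ _ hjk.symm, OO_tmul_mul, one_mul, mul_one]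
        abel
      change tracefree _ = _
      rw [hv]
      exact tracefree_of_trace (offDiag i j h _).2.2
    · change (1 / 3 : ℝ) • matLeft _ _ = 0
      rw [matLeft, Finset.sum_eq_zero, smul_zero]
      refine fun m _ => Finset.sum_eq_zero fun n _ => ?_
      obtain ⟨a, ha⟩ := ha m n
      obtain ⟨b, hb⟩ := hb n m
      rw [ha, hb, leftDer_tmul, innerDer_one_right, smul_zero]
    · change (1 / 3 : ℝ) • matRight _ _ = 0
      rw [matRight, Finset.sum_eq_zero, smul_zero]
      refine fun m _ => Finset.sum_eq_zero fun n _ => ?_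
      obtain ⟨a, ha⟩ := ha m n
      obtain ⟨b, hb⟩ := hb n m
      rw [ha, hb, rightDer_tmul, innerDer_one_left, smul_zero]
  rwa [h2] at h1

theorem tmul_eq_re_imPart (a : SplitOct) (b : Oct) : (a ⊗ₜ[ℝ] b : OO) =
    (a.fst.re * b.fst.re) • (1 : OO) + b.fst.re • (a.imPart ⊗ₜ[ℝ] (1 : Oct)) +
      a.fst.re • ((1 : SplitOct) ⊗ₜ[ℝ] b.imPart) + a.imPart ⊗ₜ[ℝ] b.imPart := by
  conv_lhs => rw [CD.eq_re_add_imPart a, CD.eq_re_add_imPart b]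
  simp only [TensorProduct.add_tmul, TensorProduct.tmul_add, TensorProduct.tmul_smul,
    ← TensorProduct.smul_tmul', Algebra.TensorProduct.one_def]
  module

theorem offDiag_one_tmul_mem_jacobiSet (i j : Fin 3) (h : i ≠ j) {p : Oct} (hp : star p = -p) :
    matHom (offDiag i j h ((1 : SplitOct) ⊗ₜ[ℝ] p)) ∈ jacobiSet :=
  offDiag_skew_mem_jacobiSet i j h (star_one_tmul hp)

theorem tmul_mem_of_imPart {S : Submodule ℝ OO} {a : SplitOct} {b : Oct} (h1 : (1 : OO) ∈ S)
    (h2 : a.imPart ⊗ₜ[ℝ] (1 : Oct) ∈ S) (h3 : (1 : SplitOct) ⊗ₜ[ℝ] b.imPart ∈ S)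
    (h4 : a.imPart ⊗ₜ[ℝ] b.imPart ∈ S) : a ⊗ₜ[ℝ] b ∈ S := by
  rw [tmul_eq_re_imPart]
  exact S.add_mem (S.add_mem (S.add_mem (S.smul_mem _ h1) (S.smul_mem _ h2)) (S.smul_mem _ h3)) h4

theorem offDiag_mem_jacobiSet (i j : Fin 3) (h : i ≠ j) (x : OO) :
    matHom (offDiag i j h x) ∈ jacobiSet := by
  have hS : ∀ x, x ∈ jacobiSet.comap (matHom ∘ₗ offDiag i j h) := by
    intro x
    induction x using OO_induct with
    | hadd x y hx hy => exact Submodule.add_mem _ hx hy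
    | h a b =>
      refine tmul_mem_of_imPart ?_ ?_ ?_ ?_ <;> rw [Submodule.mem_comap, LinearMap.comp_apply]
      · exact offDiag_one_mem_jacobiSet i j h
      · exact offDiag_skew_mem_jacobiSet i j h (star_tmul_one (CD.star_imPart a))
      · exact offDiag_one_tmul_mem_jacobiSet i j h (CD.star_imPart b)
      · exact offDiag_tmul_mem_jacobiSet i j h (CD.star_imPart a) (CD.star_imPart b)
  have h := hS x
  rwa [Submodule.mem_comap, LinearMap.comp_apply] at h

theorem sa3_decomposition (A : sa3) : A = offDiag 0 1 (by decide) (A.1 0 1) +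
    offDiag 0 2 (by decide) (A.1 0 2) + offDiag 1 2 (by decide) (A.1 1 2) +
    onDiag 0 2 (A.1 0 0) (sa3_star A 0 0) + onDiag 1 2 (A.1 1 1) (sa3_star A 1 1) := by
  have h : A.1 2 2 = -(A.1 0 0 + A.1 1 1) := by
    have h : ∑ p, A.1 p p = 0 := A.2.2
    rw [Fin.sum_univ_three] at h
    exact eq_neg_of_add_eq_zero_right h
  apply Subtype.ext
  ext m n
  simp only [Submodule.coe_add, offDiag_val, onDiag, Matrix.add_apply, Matrix.sub_apply,
    Matrix.single_apply, sa3_star]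
  fin_cases m <;> fin_cases n <;> simp [h]
  exact add_comm _ _

theorem mem_jacobiSet (x : E8) : x ∈ jacobiSet := by
  obtain ⟨A, d, e⟩ := x
  have h : ((A, d, e) : E8) = matHom A + (0, d, e) := by simp [matHom_apply]
  rw [h, sa3_decomposition A]
  simp only [map_add]
  exact add_mem (add_mem (add_mem (add_mem (add_mem (offDiag_mem_jacobiSet _ _ _ _)
    (offDiag_mem_jacobiSet _ _ _ _)) (offDiag_mem_jacobiSet _ _ _ _))
    (onDiag_mem_jacobiSet _ _ _ _)) (onDiag_mem_jacobiSet _ _ _ _)) (der_mem_jacobiSet d e)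

theorem jacobi (x y z : E8) : ⁅x, ⁅y, z⁆⁆ = ⁅⁅x, y⁆, z⁆ + ⁅y, ⁅x, z⁆⁆ := mem_jacobiSet x y z

/-! ### Coordinates and dimensions -/

section QuaternionUnits

@[simp] theorem quaternion_re_one : (1 : Quaternion ℝ).re = 1 := rfl
@[simp] theorem quaternion_imI_one : (1 : Quaternion ℝ).imI = 0 := rfl
@[simp] theorem quaternion_imJ_one : (1 : Quaternion ℝ).imJ = 0 := rfl
@[simp] theorem quaternion_imK_one : (1 : Quaternion ℝ).imK = 0 := rfl
@[simp] theorem quaternion_re_zero : (0 : Quaternion ℝ).re = 0 := rfl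
@[simp] theorem quaternion_imI_zero : (0 : Quaternion ℝ).imI = 0 := rfl
@[simp] theorem quaternion_imJ_zero : (0 : Quaternion ℝ).imJ = 0 := rfl
@[simp] theorem quaternion_imK_zero : (0 : Quaternion ℝ).imK = 0 := rfl

/-- The quaternion with the given components. -/
def quat (a b c d : ℝ) : Quaternion ℝ := ⟨a, b, c, d⟩

@[simp] theorem quat_re (a b c d : ℝ) : (quat a b c d).re = a := rfl
@[simp] theorem quat_imI (a b c d : ℝ) : (quat a b c d).imI = b := rfl
@[simp] theorem quat_imJ (a b c d : ℝ) : (quat a b c d).imJ = c := rfl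
@[simp] theorem quat_imK (a b c d : ℝ) : (quat a b c d).imK = d := rfl

end QuaternionUnits

section Dim
variable (ε : ℝ)

/-- An octonion is a pair of quaternions. -/
def cdEquiv : CD ε ≃ₗ[ℝ] Quaternion ℝ × Quaternion ℝ where
  toFun x := (x.fst, x.snd)
  invFun x := ⟨x.1, x.2⟩
  map_add' _ _ := rfl
  map_smul' _ _ := rfl
  left_inv _ := rfl
  right_inv _ := rfl

instance : Module.Finite ℝ (CD ε) := Module.Finite.equiv (cdEquiv ε).symm

instance : Module.Free ℝ (CD ε) := Module.Free.of_equiv (cdEquiv ε).symm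

theorem finrank_cd : Module.finrank ℝ (CD ε) = 8 := by
  rw [(cdEquiv ε).finrank_eq, Module.finrank_prod, Quaternion.finrank_eq_four]

/-- Fourteen coordinates of a derivation. -/
def derCoord : derAlg ε →ₗ[ℝ] Fin 14 → ℝ where
  toFun D := ![(D.1 ⟨qi, 0⟩).fst.imJ, (D.1 ⟨qi, 0⟩).fst.imK, (D.1 ⟨qi, 0⟩).snd.re,
    (D.1 ⟨qi, 0⟩).snd.imI, (D.1 ⟨qi, 0⟩).snd.imJ, (D.1 ⟨qi, 0⟩).snd.imK,
    (D.1 ⟨qj, 0⟩).fst.imK, (D.1 ⟨qj, 0⟩).snd.re,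
    (D.1 ⟨qj, 0⟩).snd.imI, (D.1 ⟨qj, 0⟩).snd.imJ, (D.1 ⟨qj, 0⟩).snd.imK,
    (D.1 ⟨0, 1⟩).snd.imI, (D.1 ⟨0, 1⟩).snd.imJ, (D.1 ⟨0, 1⟩).snd.imK]
  map_add' D E := by simp
  map_smul' r D := by simp

variable {ε}

theorem cd_eq_generators (x : CD ε) : x = x.fst.re • 1 + x.fst.imI • ⟨qi, 0⟩ +
    x.fst.imJ • ⟨qj, 0⟩ + x.fst.imK • (⟨qi, 0⟩ * ⟨qj, 0⟩) + x.snd.re • ⟨0, 1⟩ +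
    x.snd.imI • (⟨qi, 0⟩ * ⟨0, 1⟩) + x.snd.imJ • (⟨qj, 0⟩ * ⟨0, 1⟩) +
    x.snd.imK • ((⟨qi, 0⟩ * ⟨qj, 0⟩) * ⟨0, 1⟩) := by
  apply CD.ext <;> ext <;> simp

/-- The units `i`, `j` and `ℓ` generate the algebra. -/
theorem der_eq_zero_of_generators {D : derAlg ε} (hi : D.1 ⟨qi, 0⟩ = 0) (hj : D.1 ⟨qj, 0⟩ = 0)
    (hl : D.1 ⟨0, 1⟩ = 0) : D = 0 := by
  apply Subtype.ext
  ext1 x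
  rw [cd_eq_generators x]
  simp only [map_add, map_smul, derAlg_mul, hi, hj, hl, der_one D.2, smul_zero, mul_zero, zero_mul,
    add_zero]
  simp

/-- The relation between the values of a derivation at two elements whose anticommutator is
real. -/
theorem der_anticomm (D : derAlg ε) {x y : CD ε} {r : ℝ} (h : x * y + y * x = r • 1) :
    D.1 x * y + x * D.1 y + (D.1 y * x + y * D.1 x) = 0 := by
  rw [← derAlg_mul, ← derAlg_mul, ← map_add, h, map_smul, der_one D.2, smul_zero]

/-- The values at `i`, `j`, `ℓ` comprise 24 numbers. Their three real parts vanish, and seven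
relations come from differentiating the anticommutators of `i, j, ℓ` and of `k = ij` with `ℓ`;
fourteen coordinates are left. This bounds the dimension from above. -/
theorem derCoord_injective (hε : ε ≠ 0) : Function.Injective (derCoord ε) := by
  rw [← LinearMap.ker_eq_bot, LinearMap.ker_eq_bot']
  intro D hD
  have hc := fun k => congrFun hD k
  have c0 := hc 0; have c1 := hc 1; have c2 := hc 2; have c3 := hc 3; have c4 := hc 4
  have c5 := hc 5; have c6 := hc 6; have c7 := hc 7; have c8 := hc 8; have c9 := hc 9
  have c10 := hc 10; have c11 := hc 11; have c12 := hc 12; have c13 := hc 13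
  clear hc hD
  change (D.1 ⟨qi, 0⟩).fst.imJ = 0 at c0
  change (D.1 ⟨qi, 0⟩).fst.imK = 0 at c1
  change (D.1 ⟨qi, 0⟩).snd.re = 0 at c2
  change (D.1 ⟨qi, 0⟩).snd.imI = 0 at c3
  change (D.1 ⟨qi, 0⟩).snd.imJ = 0 at c4
  change (D.1 ⟨qi, 0⟩).snd.imK = 0 at c5
  change (D.1 ⟨qj, 0⟩).fst.imK = 0 at c6
  change (D.1 ⟨qj, 0⟩).snd.re = 0 at c7
  change (D.1 ⟨qj, 0⟩).snd.imI = 0 at c8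
  change (D.1 ⟨qj, 0⟩).snd.imJ = 0 at c9
  change (D.1 ⟨qj, 0⟩).snd.imK = 0 at c10
  change (D.1 ⟨0, 1⟩).snd.imI = 0 at c11
  change (D.1 ⟨0, 1⟩).snd.imJ = 0 at c12
  change (D.1 ⟨0, 1⟩).snd.imK = 0 at c13
  have re : ∀ {x : CD ε}, x = 0 → x.fst.re = 0 := fun h => by rw [h]; rfl
  have hii := re (der_anticomm D (x := ⟨qi, 0⟩) (y := ⟨qi, 0⟩) (r := -2)
    (by apply CD.ext <;> ext <;> simp; norm_num))
  have hi0 := der_re D.2 ⟨qi, 0⟩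
  have hi : D.1 ⟨qi, 0⟩ = 0 := by
    apply CD.ext <;> ext <;> simp_all
  have hj0 := der_re D.2 ⟨qj, 0⟩
  have hjj := re (der_anticomm D (x := ⟨qj, 0⟩) (y := ⟨qj, 0⟩) (r := -2)
    (by apply CD.ext <;> ext <;> simp; norm_num))
  have hij := re (der_anticomm D (x := ⟨qi, 0⟩) (y := ⟨qj, 0⟩) (r := 0)
    (by apply CD.ext <;> ext <;> simp))
  have hj : D.1 ⟨qj, 0⟩ = 0 := by
    apply CD.ext <;> ext <;> simp_all
  have hk : D.1 ⟨qk, 0⟩ = 0 := by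
    have h : (⟨qk, 0⟩ : CD ε) = ⟨qi, 0⟩ * ⟨qj, 0⟩ := by
      apply CD.ext <;> ext <;> simp
    rw [h, derAlg_mul, hi, hj, zero_mul, mul_zero, add_zero]
  have hl0 := der_re D.2 ⟨0, 1⟩
  have hli := re (der_anticomm D (x := ⟨qi, 0⟩) (y := ⟨0, 1⟩) (r := 0)
    (by apply CD.ext <;> ext <;> simp))
  have hlj := re (der_anticomm D (x := ⟨qj, 0⟩) (y := ⟨0, 1⟩) (r := 0)
    (by apply CD.ext <;> ext <;> simp))
  have hlk := re (der_anticomm D (x := ⟨qk, 0⟩) (y := ⟨0, 1⟩) (r := 0)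
    (by apply CD.ext <;> ext <;> simp))
  have hll := re (der_anticomm D (x := ⟨0, 1⟩) (y := ⟨0, 1⟩) (r := 2 * ε)
    (by apply CD.ext <;> ext <;> simp; ring))
  have hl : D.1 ⟨0, 1⟩ = 0 := by
    apply CD.ext <;> ext <;> simp_all
  exact der_eq_zero_of_generators hi hj hl

/-- The first of the octonions used in `derParam`. -/
def derParamI (ε : ℝ) : (Fin 14 → ℝ) →ₗ[ℝ] CD ε where
  toFun g := ⟨quat 0 0 (g 0) (g 1), quat (g 2) (g 3) (g 4) (g 5)⟩
  map_add' g g' := by apply CD.ext <;> ext <;> simp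
  map_smul' r g := by apply CD.ext <;> ext <;> simp

/-- The second of the octonions used in `derParam`. -/
def derParamJ (ε : ℝ) : (Fin 14 → ℝ) →ₗ[ℝ] CD ε where
  toFun g := ⟨quat 0 0 0 (g 6), quat (g 7) (g 8) (g 9) (g 10)⟩
  map_add' g g' := by apply CD.ext <;> ext <;> simp
  map_smul' r g := by apply CD.ext <;> ext <;> simp

/-- The third of the octonions used in `derParam`. -/
def derParamL (ε : ℝ) : (Fin 14 → ℝ) →ₗ[ℝ] CD ε where
  toFun g := ⟨0, quat 0 (g 11) (g 12) (g 13)⟩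
  map_add' g g' := by apply CD.ext <;> ext <;> simp
  map_smul' r g := by apply CD.ext <;> ext <;> simp

/-- A fourteen-parameter family of inner derivations. -/
def derParam (ε : ℝ) : (Fin 14 → ℝ) →ₗ[ℝ] derAlg ε :=
  innerDer ε ⟨qi, 0⟩ ∘ₗ derParamI ε + innerDer ε ⟨qj, 0⟩ ∘ₗ derParamJ ε +
    innerDer ε ⟨0, 1⟩ ∘ₗ derParamL ε

/-- Fourteen independent inner derivations bound the dimension from below. The values at `i`, `j`,
`ℓ` form a linear system for the parameters, in which the last three come out multiplied by `ε`. -/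
theorem derParam_injective (hε : ε ≠ 0) : Function.Injective (derParam ε) := by
  rw [← LinearMap.ker_eq_bot, LinearMap.ker_eq_bot']
  intro g hg
  have hi := congrArg (fun D : derAlg ε => D.1 ⟨qi, 0⟩) hg
  have hj := congrArg (fun D : derAlg ε => D.1 ⟨qj, 0⟩) hg
  have hl := congrArg (fun D : derAlg ε => D.1 ⟨0, 1⟩) hg
  simp only [derParam, derParamI, derParamJ, derParamL, LinearMap.comp_apply, LinearMap.coe_mk,
    AddHom.coe_mk, Submodule.coe_add, LinearMap.add_apply,
    innerDer_apply, assoc, Submodule.coe_zero, LinearMap.zero_apply, CD.ext_iff,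
    Quaternion.ext_iff] at hi hj hl
  simp at hi hj hl
  have canc : ∀ {x : ℝ}, ε * x = 0 → x = 0 := fun h => (mul_eq_zero.mp h).resolve_left hε
  obtain ⟨⟨i1, i2⟩, i3, i4, i5, i6⟩ := hi
  obtain ⟨⟨j1, j2⟩, j3, j4, j5, j6⟩ := hj
  obtain ⟨_, l4, l5, l6⟩ := hl
  funext k
  fin_cases k
  · change g 0 = 0; linarith
  · change g 1 = 0; linarith
  · change g 2 = 0; linarith
  · change g 3 = 0; linarith
  · change g 4 = 0; linarith
  · change g 5 = 0; linarith
  · change g 6 = 0; linarith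
  · change g 7 = 0; linarith
  · change g 8 = 0; linarith
  · change g 9 = 0; linarith
  · change g 10 = 0; linarith
  · exact canc (x := g 11) (by linarith)
  · exact canc (x := g 12) (by linarith)
  · exact canc (x := g 13) (by linarith)

instance : Module.Finite ℝ (derAlg ε) :=
  inferInstanceAs (Module.Finite ℝ ↥(derAlg ε))

theorem finrank_derAlg (hε : ε ≠ 0) : Module.finrank ℝ (derAlg ε) = 14 := by
  refine le_antisymm ?_ ?_
  · simpa using LinearMap.finrank_le_finrank_of_injective (derCoord_injective hε)
  · simpa using LinearMap.finrank_le_finrank_of_injective (derParam_injective hε)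

end Dim

section Albert

theorem H3_star (X : H3) (i j : Fin 3) : star (X.1 i j) = X.1 j i := by
  have h := congrFun (congrFun (show X.1ᴴ = X.1 from X.2) j) i
  rwa [Matrix.conjTranspose_apply] at h

theorem eq_re_of_star_eq {ε : ℝ} {x : CD ε} (h : star x = x) : x = x.fst.re • 1 := by
  have h2 := CD.add_star x
  rw [h, ← two_smul ℝ, mul_smul] at h2
  exact smul_right_injective _ (two_ne_zero' ℝ) h2

theorem H3_diag (X : H3) (i : Fin 3) : X.1 i i = (X.1 i i).fst.re • 1 :=
  eq_re_of_star_eq (H3_star X i i)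

/-- The Hermitian matrix with given diagonal and upper triangular entries. -/
def mkH3 (a : Fin 3 → ℝ) (x y z : Oct) : H3 :=
  ⟨!![a 0 • 1, x, y; star x, a 1 • 1, z; star y, star z, a 2 • 1], by
    change _ᴴ = _
    ext1 i j
    fin_cases i <;> fin_cases j <;> simp [Matrix.conjTranspose_apply]⟩

/-- Coordinates on the Albert algebra. -/
def albertEquiv : H3 ≃ₗ[ℝ] (Fin 3 → ℝ) × Oct × Oct × Oct where
  toFun X := (fun i => (X.1 i i).fst.re, X.1 0 1, X.1 0 2, X.1 1 2)
  invFun v := mkH3 v.1 v.2.1 v.2.2.1 v.2.2.2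
  map_add' X Y := rfl
  map_smul' r X := rfl
  left_inv X := by
    apply Subtype.ext
    ext1 i j
    fin_cases i <;> fin_cases j <;>
      first | exact (H3_diag X _).symm | exact H3_star X _ _ | rfl
  right_inv v := by
    refine Prod.ext (funext fun i => ?_) rfl
    fin_cases i <;> simp [mkH3]

instance : Module.Finite ℝ H3 := Module.Finite.equiv albertEquiv.symm

theorem finrank_H3 : Module.finrank ℝ H3 = 27 := by
  rw [albertEquiv.finrank_eq]
  simp only [Module.finrank_prod, finrank_cd, Module.finrank_fin_fun]

theorem finrank_boostRot : Module.finrank ℝ boostRot = 64 := by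
  have h : boostRot = LinearMap.ker (Matrix.traceLinearMap (Fin 3) ℝ Oct) := by
    ext M
    exact Iff.rfl
  have hs : LinearMap.range (Matrix.traceLinearMap (Fin 3) ℝ Oct) = ⊤ := by
    rw [LinearMap.range_eq_top]
    exact fun x => ⟨Matrix.single 0 0 x, Matrix.trace_single_eq_same (0 : Fin 3) x⟩
  have h2 := LinearMap.finrank_range_add_finrank_ker (Matrix.traceLinearMap (Fin 3) ℝ Oct)
  rw [hs, ← h, finrank_top, Module.finrank_matrix, finrank_cd, Fintype.card_fin] at h2
  exact Nat.add_left_cancel (n := 8) h2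

theorem finrank_Tower : Module.finrank ℝ Tower = 56 := by
  simp only [Module.finrank_prod, finrank_H3, Module.finrank_self]

theorem finrank_Theta : Module.finrank ℝ Theta = 133 := by
  simp only [Module.finrank_prod, finrank_H3, Module.finrank_self, finrank_boostRot,
    finrank_derAlg (show (-1 : ℝ) ≠ 0 by norm_num)]

end Albert

section Skew

/-- The anti-Hermitian elements of `𝕆' ⊗ 𝕆`. -/
def skewOO : Submodule ℝ OO where
  carrier := {x | star x = -x}
  add_mem' {x y} hx hy := by
    change star (x + y) = -(x + y)
    rw [star_add, show star x = -x from hx, show star y = -y from hy, neg_add]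
  zero_mem' := by simp
  smul_mem' r x hx := by
    change star (r • x) = -(r • x)
    rw [star_smul, show star x = -x from hx, star_trivial, smul_neg]

/-- The imaginary octonions. -/
def imCD (ε : ℝ) : Submodule ℝ (CD ε) := LinearMap.ker (reMul ε 1)

theorem mem_imCD {ε : ℝ} {x : CD ε} : x ∈ imCD ε ↔ x.fst.re = 0 := by
  rw [imCD, LinearMap.mem_ker, reMul_apply, one_mul]

theorem finrank_imCD (ε : ℝ) : Module.finrank ℝ (imCD ε) = 7 := by
  have hs : LinearMap.range (reMul ε 1) = ⊤ := by
    rw [LinearMap.range_eq_top]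
    exact fun r => ⟨r • 1, by rw [reMul_apply]; simp⟩
  have h2 := LinearMap.finrank_range_add_finrank_ker (reMul ε 1)
  rw [hs, finrank_top, finrank_cd, Module.finrank_self, ← imCD] at h2
  omega

/-- The embedding of pairs of imaginary elements into `𝕆' ⊗ 𝕆`. -/
def imSum : (imCD 1 × imCD (-1)) →ₗ[ℝ] OO :=
  ((TensorProduct.mk ℝ SplitOct Oct).flip 1 ∘ₗ (imCD 1).subtype ∘ₗ LinearMap.fst ℝ _ _ +
    TensorProduct.mk ℝ SplitOct Oct 1 ∘ₗ (imCD (-1)).subtype ∘ₗ LinearMap.snd ℝ _ _)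

theorem imSum_apply (v : imCD 1 × imCD (-1)) :
    imSum v = v.1.1 ⊗ₜ[ℝ] (1 : Oct) + (1 : SplitOct) ⊗ₜ[ℝ] v.2.1 := rfl

/-- Contraction with the real part of the second factor. -/
def contrRight : OO →ₗ[ℝ] SplitOct :=
  (TensorProduct.rid ℝ SplitOct).toLinearMap ∘ₗ
    TensorProduct.map (LinearMap.id : SplitOct →ₗ[ℝ] SplitOct) (reMul (-1) 1)

/-- Contraction with the real part of the first factor. -/
def contrLeft : OO →ₗ[ℝ] Oct :=
  (TensorProduct.lid ℝ Oct).toLinearMap ∘ₗ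
    TensorProduct.map (reMul 1 1) (LinearMap.id : Oct →ₗ[ℝ] Oct)

theorem contrRight_tmul (a : SplitOct) (b : Oct) : contrRight (a ⊗ₜ[ℝ] b) = b.fst.re • a := by
  simp [contrRight, reMul_apply]

theorem contrLeft_tmul (a : SplitOct) (b : Oct) : contrLeft (a ⊗ₜ[ℝ] b) = a.fst.re • b := by
  simp [contrLeft, reMul_apply]

theorem imSum_injective : Function.Injective imSum := by
  rw [← LinearMap.ker_eq_bot, LinearMap.ker_eq_bot']
  intro v hv
  rw [imSum_apply] at hv
  have h1 := mem_imCD.mp v.1.2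
  have h2 := mem_imCD.mp v.2.2
  have e1 := congrArg contrRight hv
  have e2 := congrArg contrLeft hv
  rw [map_add, contrRight_tmul, contrRight_tmul, h2, map_zero] at e1
  rw [map_add, contrLeft_tmul, contrLeft_tmul, h1, map_zero] at e2
  refine Prod.ext (Subtype.ext ?_) (Subtype.ext ?_)
  · simpa using e1
  · simpa using e2

theorem range_imSum : LinearMap.range imSum = skewOO := by
  ext x
  constructor
  · rintro ⟨v, rfl⟩
    have h1 := star_tmul_one (CD.star_eq_neg_iff.mpr (mem_imCD.mp v.1.2))
    have h2 := star_one_tmul (CD.star_eq_neg_iff.mpr (mem_imCD.mp v.2.2))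
    change star (imSum v) = -imSum v
    rw [imSum_apply, star_add, h1, h2, neg_add]
  · intro hx
    obtain ⟨q, p, hq, hp, h⟩ := exists_of_star_eq_neg hx
    exact ⟨(⟨q, mem_imCD.mpr hq⟩, ⟨p, mem_imCD.mpr hp⟩), h.symm⟩

theorem finrank_skewOO : Module.finrank ℝ skewOO = 14 := by
  rw [← range_imSum, LinearMap.finrank_range_of_inj imSum_injective, Module.finrank_prod,
    finrank_imCD, finrank_imCD]

/-- Coordinates on the anti-Hermitian tracefree matrices. -/
def sa3Equiv : sa3 ≃ₗ[ℝ] (OO × OO × OO) × skewOO × skewOO where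
  toFun A := ((A.1 0 1, A.1 0 2, A.1 1 2), ⟨A.1 0 0, sa3_star A 0 0⟩, ⟨A.1 1 1, sa3_star A 1 1⟩)
  invFun v := offDiag 0 1 (by decide) v.1.1 + offDiag 0 2 (by decide) v.1.2.1 +
    offDiag 1 2 (by decide) v.1.2.2 + onDiag 0 2 v.2.1.1 v.2.1.2 + onDiag 1 2 v.2.2.1 v.2.2.2
  map_add' A B := rfl
  map_smul' r A := rfl
  left_inv A := (sa3_decomposition A).symm
  right_inv v := by
    refine Prod.ext (Prod.ext ?_ (Prod.ext ?_ ?_)) (Prod.ext (Subtype.ext ?_) (Subtype.ext ?_)) <;>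
      simp [offDiag_val, onDiag]

instance : Module.Finite ℝ sa3 := Module.Finite.equiv sa3Equiv.symm

/-- Three free off-diagonal entries in dimension `64` and two free diagonal entries in dimension
`14` give `220`; the two algebras of derivations add `28`. -/
theorem finrank_E8 : Module.finrank ℝ E8 = 248 := by
  have h : Module.finrank ℝ sa3 = 220 := by
    rw [sa3Equiv.finrank_eq]
    simp only [Module.finrank_prod, finrank_skewOO, Module.finrank_tensorProduct, finrank_cd]
  rw [Module.finrank_prod, Module.finrank_prod, h, finrank_derAlg one_ne_zero,
    finrank_derAlg (show (-1 : ℝ) ≠ 0 by norm_num)]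

end Skew

/-! ### Nested elements as derivations of `𝕆'` -/

open SplitOct

/-- The embedding of the derivations of `𝕆'` into `𝔢₈`. -/
def leftHom : derAlg 1 →ₗ[ℝ] E8 :=
  LinearMap.inr ℝ sa3 (derAlg 1 × derAlg (-1)) ∘ₗ LinearMap.inl ℝ (derAlg 1) (derAlg (-1))

/-- The embedding of the derivations of `𝕆` into `𝔢₈`. -/
def rightHom : derAlg (-1) →ₗ[ℝ] E8 :=
  LinearMap.inr ℝ sa3 (derAlg 1 × derAlg (-1)) ∘ₗ LinearMap.inr ℝ (derAlg 1) (derAlg (-1))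

theorem leftHom_apply (d : derAlg 1) : leftHom d = (0, d, 0) := rfl

theorem rightHom_apply (e : derAlg (-1)) : rightHom e = (0, 0, e) := rfl

theorem derMat_zero_right (d : derAlg 1) (e : derAlg (-1)) : derMat d e 0 = 0 := by
  simpa using derMat_smul_right 0 d e 0

theorem bracket_matHom (A B : sa3) : ⁅matHom A, matHom B⁆ =
    (matComm A B, (1 / 3 : ℝ) • matLeft A.1 B.1, (1 / 3 : ℝ) • matRight A.1 B.1) := by
  rw [matHom_apply, matHom_apply, bracket_mk]
  simp only [derMat_zero, derComm_zero_left, add_zero, sub_zero, zero_add]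

theorem leftHom_matHom (d : derAlg 1) (A : sa3) :
    ⁅leftHom d, matHom A⁆ = matHom (derMat d 0 A) := by
  rw [leftHom_apply, matHom_apply, der_bracket, derComm_zero_right, derComm_zero_right, matHom_apply]

theorem rightHom_matHom (e : derAlg (-1)) (A : sa3) :
    ⁅rightHom e, matHom A⁆ = matHom (derMat 0 e A) := by
  rw [rightHom_apply, matHom_apply, der_bracket, derComm_zero_right, derComm_zero_right,
    matHom_apply]

theorem leftHom_leftHom (d d' : derAlg 1) : ⁅leftHom d, leftHom d'⁆ = leftHom (derComm d d') := by
  rw [leftHom_apply, leftHom_apply, der_bracket, derMat_zero_right, derComm_zero_right,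
    leftHom_apply]

theorem rightHom_leftHom (e : derAlg (-1)) (d : derAlg 1) : ⁅rightHom e, leftHom d⁆ = 0 := by
  rw [rightHom_apply, leftHom_apply, der_bracket, derMat_zero_right, derComm_zero_right,
    derComm_zero_left]
  rfl

theorem diagElt_bracket (a : Fin 3 → ℝ) (ha : ∑ i, a i = 0) (p q : SplitOct) :
    ∃ X : sa3, X.1 = tracefree (Matrix.diagonal fun i =>
      (a i * a i) • ((p.imPart * q.imPart - q.imPart * p.imPart) ⊗ₜ[ℝ] (1 : Oct))) ∧
      ⁅diagElt a ha p, diagElt a ha q⁆ = (X, ((1 / 3) * ∑ i, a i * a i) • innerDer 1 p q, 0) := by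
  refine ⟨_, ?_, bracket_matHom _ _ |>.trans (Prod.ext rfl (Prod.ext ?_ ?_))⟩
  · rw [matComm_val, Matrix.diagonal_mul_diagonal, Matrix.diagonal_mul_diagonal, Matrix.diagonal_sub]
    congr 2
    funext i
    simp only [smul_mul_assoc, mul_smul_comm, OO_tmul_mul, mul_one, TensorProduct.sub_tmul]
    module
  · change (1 / 3 : ℝ) • matLeft _ _ = _
    rw [matLeft_diagonal, mul_smul, Finset.sum_smul]
    congr 1
    refine Finset.sum_congr rfl fun i _ => ?_
    change leftDer 1 (-1) _ ((Matrix.diagonal fun i => a i • (q.imPart ⊗ₜ[ℝ] (1 : Oct))) i i) = _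
    rw [Matrix.diagonal_apply_eq, map_smul, map_smul, LinearMap.smul_apply, leftDer_tmul,
      innerDer_imPart, mul_one, CD.re_one, one_smul, mul_smul]
  · change (1 / 3 : ℝ) • matRight _ _ = _
    rw [matRight_diagonal, Finset.sum_eq_zero, smul_zero]
    intro i _
    change rightDer 1 (-1) _ ((Matrix.diagonal fun i => a i • (q.imPart ⊗ₜ[ℝ] (1 : Oct))) i i) = _
    rw [Matrix.diagonal_apply_eq, map_smul, map_smul, LinearMap.smul_apply, rightDer_tmul,
      innerDer_one_left, smul_zero, smul_zero, smul_zero]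

/-- The squared weights of `D`, `E`, `F` add up to `(2, 2, 2)`, so the matrix parts sum to a scalar
matrix, which the tracefree projection removes. Each square sum is `2`, so the derivation has
coefficient `(1/4) · 3 · (2/3)`. -/
theorem nested_eq (p q : SplitOct) : nested p q = leftHom ((1 / 2 : ℝ) • innerDer 1 p q) := by
  obtain ⟨X, hX, h1⟩ := diagElt_bracket ![1, -1, 0] (by simp [Fin.sum_univ_three]) p q
  obtain ⟨Y, hY, h2⟩ := diagElt_bracket ![0, 1, -1] (by simp [Fin.sum_univ_three]) p q
  obtain ⟨Z, hZ, h3⟩ := diagElt_bracket ![-1, 0, 1] (by simp [Fin.sum_univ_three]) p q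
  rw [nested, D, E, F, D, E, F, h1, h2, h3, leftHom_apply]
  refine Prod.ext (Subtype.ext ?_) (Prod.ext ?_ ?_)
  · change (1 / 2 : ℝ) • ((1 / 2 : ℝ) • X.1 + (1 / 2 : ℝ) • Y.1 + (1 / 2 : ℝ) • Z.1) = 0
    rw [hX, hY, hZ]
    ext m n
    simp only [Matrix.smul_apply, Matrix.add_apply, tracefree_apply, Matrix.trace_diagonal,
      Fin.sum_univ_three, Matrix.diagonal_apply, Matrix.zero_apply]
    generalize (p.imPart * q.imPart - q.imPart * p.imPart) ⊗ₜ[ℝ] (1 : Oct) = t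
    fin_cases m <;> fin_cases n <;> simp
    all_goals module
  · simp only [Fin.sum_univ_three]
    simp
    module
  · simp

/-! ### Matrices with labels -/

theorem label_mul (P Q : SplitOct) (M N : Mat3 Oct) :
    label P M * label Q N = label (P * Q) (M * N) := by
  ext i j
  simp only [label, Matrix.mul_apply, Matrix.map_apply, OO_tmul_mul, TensorProduct.tmul_sum]

theorem label_smul_left (r : ℝ) (Q : SplitOct) (M : Mat3 Oct) : label (r • Q) M = r • label Q M := by
  ext i j
  simp [label, TensorProduct.smul_tmul']

theorem label_sub (Q : SplitOct) (M N : Mat3 Oct) : label Q (M - N) = label Q M - label Q N := by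
  rw [sub_eq_add_neg, label_add, label_neg_right, sub_eq_add_neg]

theorem tracefree_label (Q : SplitOct) (M : Mat3 Oct) :
    tracefree (label Q M) = label Q (tracefree M) := by
  rw [tracefree, tracefree, label_sub, trace_label]
  congr 1
  ext i j
  rw [label, Matrix.map_apply, Matrix.diagonal_apply, Matrix.diagonal_apply]
  split_ifs
  · rw [TensorProduct.tmul_smul]
  · rw [TensorProduct.tmul_zero]

theorem matLeft_label (P Q : SplitOct) (M N : Mat3 Oct) :
    matLeft (label P M) (label Q N) = (M * N).trace.fst.re • innerDer 1 P Q := by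
  have h : (M * N).trace.fst.re = ∑ i, ∑ j, (M i j * N j i).fst.re := by
    simp only [Matrix.trace, Matrix.diag, Matrix.mul_apply, Fin.sum_univ_three, CD.add_fst,
      Quaternion.re_add]
  rw [h, matLeft, Finset.sum_smul]
  refine Finset.sum_congr rfl fun i _ => ?_
  rw [Finset.sum_smul]
  refine Finset.sum_congr rfl fun j _ => ?_
  rw [label, label, Matrix.map_apply, Matrix.map_apply, leftDer_tmul]

theorem matRight_label (P Q : SplitOct) (M N : Mat3 Oct) (h : (P * Q).fst.re = 0) :
    matRight (label P M) (label Q N) = 0 :=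
  Finset.sum_eq_zero fun i _ => Finset.sum_eq_zero fun j _ => by
    rw [label, label, Matrix.map_apply, Matrix.map_apply, rightDer_tmul, h, zero_smul]

theorem matLeft_add_left (A B C : Mat3 OO) : matLeft (A + B) C = matLeft A C + matLeft B C := by
  simp only [matLeft, Matrix.add_apply, map_add, LinearMap.add_apply, Finset.sum_add_distrib]

theorem matRight_add_left (A B C : Mat3 OO) :
    matRight (A + B) C = matRight A C + matRight B C := by
  simp only [matRight, Matrix.add_apply, map_add, LinearMap.add_apply, Finset.sum_add_distrib]

theorem re_trace_mul_comm (M N : Mat3 Oct) : (M * N).trace.fst.re = (N * M).trace.fst.re := by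
  have h : ∀ M N : Mat3 Oct, (M * N).trace.fst.re = ∑ i, ∑ j, (M i j * N j i).fst.re :=
    fun M N => by
      simp only [Matrix.trace, Matrix.diag, Matrix.mul_apply, Fin.sum_univ_three, CD.add_fst,
        Quaternion.re_add]
  rw [h, h, Finset.sum_comm]
  simp only [CD.re_mul_comm]

theorem trace_H3 (X : H3) : X.1.trace = tr X • 1 := by
  refine eq_re_of_star_eq ?_
  rw [← Matrix.trace_conjTranspose, show X.1ᴴ = X.1 from X.2]

theorem tracefree_H3 (X : H3) : tracefree X.1 = X.1 - (1 / 3 * tr X) • (1 : Mat3 Oct) := by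
  rw [tracefree, trace_H3]
  congr 1
  ext1 i j
  rw [Matrix.diagonal_apply, Matrix.smul_apply, Matrix.one_apply]
  split_ifs
  · rw [smul_smul]
  · rw [smul_zero]

theorem tr_one3 : tr one3 = 3 := by
  change (1 : Mat3 Oct).trace.fst.re = 3
  rw [Matrix.trace, Fin.sum_univ_three]
  simp
  norm_num

theorem labMat_val {Q : SplitOct} (hQ : Q.fst.re = 0) (X : H3) :
    (labMat Q X).1 = label Q (tracefree X.1) := by
  change label Q.imPart _ = _
  rw [CD.imPart_of_re hQ]

theorem lab_eq (Q : SplitOct) (X : H3) : lab Q X =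
    matHom (labMat Q X) + leftHom ((1 / 6 * tr X) • innerDer 1 (Q * L) L) := by
  change matHom (labMat Q X) + _ = _
  rw [G, nested_eq, ← map_smul, ← map_smul, ← map_smul]
  congr 2
  module

theorem lab_mk (Q : SplitOct) (X : H3) :
    lab Q X = (labMat Q X, (1 / 6 * tr X) • innerDer 1 (Q * L) L, 0) := by
  rw [lab_eq, matHom_apply, leftHom_apply]
  simp

theorem der_imPart {ε : ℝ} (d : derAlg ε) (x : CD ε) : d.1 x.imPart = d.1 x := by
  rw [CD.imPart_eq, map_sub, map_smul, der_one d.2, smul_zero, sub_zero]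

theorem imPart_der {ε : ℝ} (d : derAlg ε) (x : CD ε) : (d.1 x).imPart = d.1 x :=
  CD.imPart_of_re (der_re d.2 x)

theorem derTensor_left (d : derAlg 1) (Q : SplitOct) (x : Oct) :
    derTensor d 0 (Q ⊗ₜ[ℝ] x) = d.1 Q ⊗ₜ[ℝ] x := by
  rw [derTensor_tmul]
  simp

theorem derTensor_right (e : derAlg (-1)) (Q : SplitOct) (x : Oct) :
    derTensor 0 e (Q ⊗ₜ[ℝ] x) = Q ⊗ₜ[ℝ] e.1 x := by
  rw [derTensor_tmul]
  simp

theorem label_zero_left (M : Mat3 Oct) : label 0 M = 0 := by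
  simpa using label_smul_left 0 (0 : SplitOct) M

theorem map_derTensor_label (d : derAlg 1) (Q : SplitOct) (M : Mat3 Oct) :
    (label Q M).map (derTensor d 0) = label (d.1 Q) M := by
  ext1 i j
  exact derTensor_left d Q (M i j)

/-- A derivation of `𝕆'` annihilating `L` acts on labels. -/
theorem leftHom_lab {d : derAlg 1} (hd : d.1 L = 0) (Q : SplitOct) (X : H3) :
    ⁅leftHom d, lab Q X⁆ = lab (d.1 Q) X := by
  -- Since `d` kills `L`, the Leibniz rule carries `D_{QL, L}` to `D_{d(Q)L, L}`: the trace part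
  -- follows the label.
  rw [lab_eq, lab_eq, bracket_add, leftHom_matHom, leftHom_leftHom, derComm_smul_right,
    derComm_innerDer, hd, map_zero, add_zero, derAlg_mul, hd, mul_zero, add_zero]
  congr 2
  apply Subtype.ext
  change (label Q.imPart _).map (derTensor d 0) = label (d.1 Q).imPart _
  rw [map_derTensor_label, der_imPart, imPart_der]

theorem e6Act_der_val (e : derAlg (-1)) (X : H3) : (e6Act (0, e) X).1 = X.1.map e.1 := by
  change (0 : Mat3 Oct) * X.1 + X.1 * (0 : Mat3 Oct)ᴴ + X.1.map e.1 = _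
  simp

theorem tr_e6Act_der (e : derAlg (-1)) (X : H3) : tr (e6Act (0, e) X) = 0 := by
  change (e6Act (0, e) X).1.trace.fst.re = 0
  rw [e6Act_der_val, Matrix.trace, Fin.sum_univ_three]
  simp [der_re e.2]

theorem rightHom_lab (e : derAlg (-1)) (Q : SplitOct) (X : H3) :
    ⁅rightHom e, lab Q X⁆ = lab Q (e6Act (0, e) X) := by
  rw [lab_eq, lab_eq, bracket_add, rightHom_matHom, rightHom_leftHom, tr_e6Act_der, mul_zero,
    zero_smul, map_zero]
  congr 2
  apply Subtype.ext
  change (label Q.imPart _).map (derTensor 0 e) = label Q.imPart _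
  rw [tracefree_H3, tracefree_H3, tr_e6Act_der, e6Act_der_val, mul_zero, zero_smul, sub_zero]
  ext1 i j
  change derTensor 0 e (_ ⊗ₜ[ℝ] _) = _ ⊗ₜ[ℝ] e.1 (X.1 i j)
  rw [derTensor_right, Matrix.sub_apply, Matrix.smul_apply, Matrix.one_apply]
  split_ifs <;> simp [der_one e.2]

theorem e6Act_mat_val (M : boostRot) (X : H3) :
    (e6Act (M, 0) X).1 = M.1 * X.1 + X.1 * M.1ᴴ := by
  change M.1 * X.1 + X.1 * M.1ᴴ + X.1.map (0 : Module.End ℝ Oct) = _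
  rw [show X.1.map (0 : Module.End ℝ Oct) = 0 from rfl, add_zero]

theorem e6Act_add (M : boostRot) (e : derAlg (-1)) (X : H3) :
    e6Act (M, e) X = e6Act (M, 0) X + e6Act (0, e) X := by
  apply Subtype.ext
  rw [Submodule.coe_add, e6Act_mat_val, e6Act_der_val]
  rfl

/-- The action on labels of the elements of `𝔢₈` representing the boosts and rotations. -/
theorem boostRot_lab {A : sa3} {U R : SplitOct} {M : boostRot}
    (hA : A.1 = label 1 ((1 / 2 : ℝ) • (M.1 - M.1ᴴ)) + label U ((1 / 2 : ℝ) • (M.1 + M.1ᴴ)))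
    (hUR : U * R = R) (hRU : R * U = -R) (hR : R.fst.re = 0)
    (hd : (innerDer 1 (R * L) L).1 U = (-4 : ℝ) • R)
    (hi : innerDer 1 U R = innerDer 1 (R * L) L) (X : H3) :
    ⁅matHom A, lab R X⁆ = lab R (e6Act (M, 0) X) := by
  have hM : M.1.trace = 0 := M.2
  have hMt : M.1ᴴ.trace = 0 := by rw [Matrix.trace_conjTranspose, hM, star_zero]
  have hMX : (M.1ᴴ * X.1).trace.fst.re = (X.1 * M.1ᴴ).trace.fst.re := re_trace_mul_comm _ _
  have htr : tr (e6Act (M, 0) X) = (M.1 * X.1).trace.fst.re + (X.1 * M.1ᴴ).trace.fst.re := by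
    change (e6Act (M, 0) X).1.trace.fst.re = _
    rw [e6Act_mat_val, Matrix.trace_add, CD.add_fst, Quaternion.re_add]
  rw [lab_eq, lab_mk, bracket_add, bracket_matHom, bracket_swap (matHom A) (leftHom _),
    leftHom_matHom, matHom_apply]
  refine Prod.ext (Subtype.ext ?_) (Prod.ext ?_ ?_)
  · change (matComm A _).1 + -(A.1.map (derTensor _ 0)) = (labMat R _).1
    -- The derivation attached to the trace of `X` moves `U` to a multiple of `R`. It restores the
    -- term `(tr X / 3) (M + M†)` that is lost when `X` is replaced by its tracefree part.
    have hmap : A.1.map (derTensor ((1 / 6 * tr X) • innerDer 1 (R * L) L) 0) =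
        label R ((-1 / 3 * tr X) • (M.1 + M.1ᴴ)) := by
      rw [hA, Matrix.map_add _ (map_add _), map_derTensor_label, map_derTensor_label,
        der_one (Subtype.mem _), Submodule.coe_smul, LinearMap.smul_apply, hd, smul_smul,
        label_zero_left, label_smul_left, label_smul, label_smul]
      module
    -- The rotation part contributes a commutator. For the boost part, `U R = R = -R U` turns the
    -- commutator into an anticommutator. Their sum is the shape `M X + X M†`.
    have hcomm : A.1 * label R (tracefree X.1) - label R (tracefree X.1) * A.1 =
        label R (M.1 * X.1 + X.1 * M.1ᴴ - (1 / 3 * tr X) • (M.1 + M.1ᴴ)) := by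
      rw [hA, add_mul, mul_add, label_mul, label_mul, label_mul, label_mul, hUR, hRU, one_mul,
        mul_one, label_neg_left, ← sub_eq_add_neg, ← sub_eq_zero]
      rw [show ∀ a b c d e : Mat3 OO, a + b - (c - d) - e = a - c + (b + d) - e from
        fun a b c d e => by abel, ← label_sub, ← label_add, ← label_add, ← label_sub, tracefree_H3]
      rw [← label_zero R]
      congr 1
      simp only [mul_sub, sub_mul, smul_mul_assoc, mul_smul_comm, mul_one, one_mul, mul_add, add_mul]
      module
    have ht : (M.1 + M.1ᴴ).trace = 0 := by rw [Matrix.trace_add, hM, hMt, add_zero]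
    rw [matComm_val, labMat_val hR, labMat_val hR, hcomm, hmap, tracefree_label, e6Act_mat_val,
      tracefree_sub, tracefree_smul, tracefree_of_trace ht, ← sub_eq_add_neg, ← label_sub]
    congr 1
    module
  · change (1 / 3 : ℝ) • matLeft A.1 _ + -0 = _
    rw [labMat_val hR, hA, matLeft_add_left, matLeft_label, matLeft_label, innerDer_one_left, hi,
      smul_zero, zero_add, neg_zero, add_zero, smul_smul, tracefree_H3, htr]
    congr 1
    simp only [mul_sub, smul_mul_assoc, add_mul, mul_smul_comm, mul_one, Matrix.trace_sub, Matrix.trace_smul,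
      Matrix.trace_add, hM, hMt, CD.sub_fst, CD.smul_fst, CD.add_fst, Quaternion.re_sub, Quaternion.re_add,
      Quaternion.re_smul, hMX]
    simp
    ring
  · change (1 / 3 : ℝ) • matRight A.1 _ + -0 = 0
    rw [labMat_val hR, hA, matRight_add_left, matRight_label _ _ _ _ (by rw [one_mul, hR]),
      matRight_label _ _ _ _ (by rw [hUR, hR])]
    simp

theorem phi0_val (φ : E6) : (phi0 φ).1.1 =
    label 1 ((1 / 2 : ℝ) • (φ.1.1 - φ.1.1ᴴ)) + label L ((1 / 2 : ℝ) • (φ.1.1 + φ.1.1ᴴ)) := rfl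

theorem phi0_eq (φ : E6) : phi0 φ = matHom (phi0 φ).1 + rightHom φ.2 := by
  rw [matHom_apply, rightHom_apply]
  refine Prod.ext ?_ (Prod.ext ?_ ?_)
  · exact (add_zero _).symm
  · exact (add_zero _).symm
  · exact (zero_add _).symm

theorem phi0_lab {R : SplitOct} (hLR : L * R = R) (hRL : R * L = -R) (hR : R.fst.re = 0)
    (hd : (innerDer 1 (R * L) L).1 L = (-4 : ℝ) • R) (φ : E6) (X : H3) :
    ⁅phi0 φ, lab R X⁆ = lab R (e6Act φ X) := by
  rw [phi0_eq, add_bracket, rightHom_lab, boostRot_lab (phi0_val φ) hLR hRL hR hd, ← map_add,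
    ← e6Act_add]
  rw [hRL, map_neg, LinearMap.neg_apply, innerDer_swap]

/-- On these labels `L` acts with the opposite sign. Writing the same matrix with `-L` in place of
`L` changes the sign of the Hermitian part of `M`, that is, replaces `M` by `-M†`. -/
theorem phi0_lab_dual {R : SplitOct} (hLR : L * R = -R) (hRL : R * L = R) (hR : R.fst.re = 0)
    (hd : (innerDer 1 (R * L) L).1 L = (4 : ℝ) • R) (φ : E6) (X : H3) :
    ⁅phi0 φ, lab R X⁆ = lab R (e6Act (e6Dual φ) X) := by
  have hA : (phi0 φ).1.1 = label 1 ((1 / 2 : ℝ) • ((e6Dual φ).1.1 - (e6Dual φ).1.1ᴴ)) +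
      label (-L) ((1 / 2 : ℝ) • ((e6Dual φ).1.1 + (e6Dual φ).1.1ᴴ)) := by
    have h : (e6Dual φ).1.1 = -φ.1.1ᴴ := rfl
    rw [phi0_val, h, Matrix.conjTranspose_neg, Matrix.conjTranspose_conjTranspose, label_neg_left,
      ← label_neg_right]
    congr 2 <;> module
  rw [phi0_eq, add_bracket, rightHom_lab, boostRot_lab hA (by rw [neg_mul, hLR, neg_neg])
    (by rw [mul_neg, hRL]) hR (by rw [map_neg, hd]; module), ← map_add, ← e6Act_add (e6Dual φ).1]
  · rfl
  · rw [hRL, map_neg, LinearMap.neg_apply, innerDer_swap, neg_neg]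

theorem phi0_leftHom {d : derAlg 1} (hd : d.1 L = 0) (φ : E6) : ⁅phi0 φ, leftHom d⁆ = 0 := by
  rw [phi0_eq, add_bracket, rightHom_leftHom, add_zero, bracket_swap, leftHom_matHom, neg_eq_zero,
    ← map_zero matHom]
  congr 1
  apply Subtype.ext
  change (phi0 φ).1.1.map (derTensor d 0) = 0
  rw [phi0_val, Matrix.map_add _ (map_add _), map_derTensor_label, map_derTensor_label,
    der_one d.2, hd, label_zero_left, label_zero_left, add_zero]

/-! ### Brackets of two labelled elements -/

theorem jordan_val (X Y : H3) : (jordan X Y).1 = (1 / 2 : ℝ) • (X.1 * Y.1 + Y.1 * X.1) := rfl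

theorem freud_val (X Y : H3) : (freud X Y).1 = (jordan X Y).1 -
    (1 / 2 : ℝ) • (tr X • Y.1 + tr Y • X.1) +
    ((1 / 2 : ℝ) * (tr X * tr Y - tr (jordan X Y))) • (1 : Mat3 Oct) := rfl

theorem tr_eq (X : H3) : tr X = X.1.trace.fst.re := rfl

theorem tr_jordan (X Y : H3) : tr (jordan X Y) = (X.1 * Y.1).trace.fst.re := by
  rw [tr_eq, jordan_val, Matrix.trace_smul, Matrix.trace_add, CD.smul_fst, CD.add_fst,
    Quaternion.re_smul, Quaternion.re_add, re_trace_mul_comm Y.1, smul_eq_mul]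
  ring

theorem tr_freud (X Y : H3) : tr (freud X Y) = 1 / 2 * (tr X * tr Y - tr (jordan X Y)) := by
  rw [freud, map_add, map_sub, map_smul, map_smul, map_add, map_smul, map_smul, tr_one3]
  simp only [smul_eq_mul]
  ring

theorem re_trace_tracefree_mul (X Y : H3) : (tracefree X.1 * tracefree Y.1).trace.fst.re =
    tr (jordan X Y) - 1 / 3 * (tr X * tr Y) := by
  rw [tr_jordan, tracefree_H3, tracefree_H3]
  have h1 := tr_one3
  rw [tr_eq] at h1
  change (1 : Mat3 Oct).trace.fst.re = 3 at h1
  simp only [mul_sub, sub_mul, smul_mul_assoc, mul_smul_comm, mul_one, one_mul, Matrix.trace_sub,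
    Matrix.trace_smul, CD.sub_fst, CD.smul_fst, Quaternion.re_sub, Quaternion.re_smul, smul_eq_mul,
    ← tr_eq, h1]
  ring

theorem tracefree_symm_mul (X Y : H3) :
    tracefree (tracefree X.1 * tracefree Y.1 + tracefree Y.1 * tracefree X.1) =
      (2 : ℝ) • tracefree (jordan X Y).1 - (2 / 3 * tr X) • tracefree Y.1 -
        (2 / 3 * tr Y) • tracefree X.1 := by
  have h1 : tracefree (1 : Mat3 Oct) = 0 := by
    have h := tracefree_H3 one3
    rw [tr_one3] at h
    change tracefree (1 : Mat3 Oct) = (1 : Mat3 Oct) - _ at h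
    rw [h]
    module
  have h2 : tracefree X.1 * tracefree Y.1 + tracefree Y.1 * tracefree X.1 =
      (2 : ℝ) • (jordan X Y).1 - (2 / 3 * tr X) • Y.1 - (2 / 3 * tr Y) • X.1 +
        (2 / 9 * (tr X * tr Y)) • (1 : Mat3 Oct) := by
    rw [tracefree_H3, tracefree_H3, jordan_val]
    simp only [mul_sub, sub_mul, smul_mul_assoc, mul_smul_comm, mul_one, one_mul]
    module
  rw [h2, tracefree_add, tracefree_sub, tracefree_sub, tracefree_smul, tracefree_smul,
    tracefree_smul, tracefree_smul, h1, smul_zero, add_zero]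

theorem tracefree_freud (X Y : H3) : tracefree (freud X Y).1 = tracefree (jordan X Y).1 -
    (1 / 2 : ℝ) • (tr X • tracefree Y.1 + tr Y • tracefree X.1) := by
  rw [tracefree_H3 (freud X Y), tr_freud, freud_val, tracefree_H3, tracefree_H3, tracefree_H3]
  module

/-- The bracket of labelled elements whose labels anticommute. -/
theorem lab_bracket {Q R : SplitOct} (hQ : Q.fst.re = 0) (hR : R.fst.re = 0)
    (hQR : (Q * R).fst.re = 0) (h : R * Q = -(Q * R)) (X Y : H3) : ∃ Z : sa3,
    Z.1 = label (Q * R) ((2 : ℝ) • tracefree (jordan X Y).1 - (2 / 3 * tr X) • tracefree Y.1 -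
        (2 / 3 * tr Y) • tracefree X.1) +
      (1 / 6 * tr X) • label ((innerDer 1 (Q * L) L).1 R) (tracefree Y.1) -
      (1 / 6 * tr Y) • label ((innerDer 1 (R * L) L).1 Q) (tracefree X.1) ∧
    ⁅lab Q X, lab R Y⁆ = (Z, (1 / 36 * (tr X * tr Y)) •
        derComm (innerDer 1 (Q * L) L) (innerDer 1 (R * L) L) +
      (1 / 3 * (tr (jordan X Y) - 1 / 3 * (tr X * tr Y))) • innerDer 1 Q R, 0) := by
  refine ⟨⁅lab Q X, lab R Y⁆.1, ?_, Prod.ext rfl ?_⟩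
  rotate_left
  · rw [lab_mk, lab_mk, bracket_mk]
    refine Prod.ext ?_ ?_
    · simp only
      rw [labMat_val hQ, labMat_val hR, matLeft_label, re_trace_tracefree_mul, derComm_smul_left,
        derComm_smul_right]
      module
    · simp only
      rw [labMat_val hQ, labMat_val hR, matRight_label _ _ _ _ hQR, derComm_zero_left, smul_zero,
        add_zero]
  · rw [lab_mk, lab_mk, bracket_mk]
    change (matComm _ _).1 + (labMat R Y).1.map (derTensor _ 0) -
      (labMat Q X).1.map (derTensor _ 0) = _
    rw [matComm_val, labMat_val hQ, labMat_val hR, map_derTensor_label, map_derTensor_label,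
      label_mul, label_mul, h, label_neg_left, sub_neg_eq_add, ← label_add, tracefree_label,
      tracefree_symm_mul, Submodule.coe_smul, Submodule.coe_smul, LinearMap.smul_apply,
      LinearMap.smul_apply, label_smul_left, label_smul_left]

/-- Labelled elements whose bracket is given by the Freudenthal product. -/
theorem lab_bracket_freud {Q R S : SplitOct} (hQ : Q.fst.re = 0) (hR : R.fst.re = 0)
    (hS : S.fst.re = 0) (hQR : Q * R = S) (hRQ : R * Q = -S)
    (h1 : (innerDer 1 (Q * L) L).1 R = (-2 : ℝ) • S)
    (h2 : (innerDer 1 (R * L) L).1 Q = (2 : ℝ) • S)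
    (h3 : innerDer 1 Q R = (-1 / 2 : ℝ) • innerDer 1 (S * L) L)
    (h4 : derComm (innerDer 1 (Q * L) L) (innerDer 1 (R * L) L) =
      (4 : ℝ) • innerDer 1 (S * L) L) (X Y : H3) :
    ⁅lab Q X, lab R Y⁆ = lab S ((2 : ℝ) • freud X Y) := by
  obtain ⟨Z, hZ, h⟩ := lab_bracket hQ hR (by rw [hQR, hS]) (by rw [hQR, hRQ]) X Y
  rw [h, lab_mk]
  refine Prod.ext (Subtype.ext ?_) (Prod.ext ?_ rfl)
  · simp only
    -- The matrix commutator gives the mixed terms `tr X · Y₀` and `tr Y · X₀` the coefficient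
    -- `-2/3`; the derivation parts of the two elements add the `-1/3` needed for twice the
    -- Freudenthal product.
    rw [hZ, labMat_val hS, h1, h2, hQR, Submodule.coe_smul, tracefree_smul, tracefree_freud,
      label_smul_left, label_smul_left, label_smul]
    simp only [label_sub, label_smul, label_add]
    module
  · simp only
    -- The coefficient of `tr X tr Y` is `4/36 + 1/18 = 1/6`, that of `tr (X ∘ Y)` is `-1/6`, in
    -- agreement with the trace of the Freudenthal product.
    rw [h3, h4, map_smul, tr_freud, smul_eq_mul]
    module

/-- Labelled elements whose bracket is given by the trace of the Jordan product. -/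
theorem lab_bracket_trace {Q R : SplitOct} (hQ : Q.fst.re = 0) (hR : R.fst.re = 0)
    (hQR : Q * R = 0) (hRQ : R * Q = 0) (h1 : (innerDer 1 (Q * L) L).1 R = 0)
    (h2 : (innerDer 1 (R * L) L).1 Q = 0)
    (h4 : derComm (innerDer 1 (Q * L) L) (innerDer 1 (R * L) L) = (4 : ℝ) • innerDer 1 Q R)
    (X Y : H3) : ⁅lab Q X, lab R Y⁆ = tr (jordan X Y) • leftHom ((1 / 3 : ℝ) • innerDer 1 Q R) := by
  obtain ⟨Z, hZ, h⟩ := lab_bracket hQ hR (by rw [hQR]; rfl) (by rw [hQR, hRQ, neg_zero]) X Y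
  rw [h, ← map_smul leftHom, leftHom_apply]
  refine Prod.ext (Subtype.ext ?_) (Prod.ext ?_ rfl)
  · simp only
    rw [hZ, h1, h2, hQR]
    simp only [label_zero_left, smul_zero, add_zero, sub_zero]
    rfl
  · simp only
    -- Here `4/36` cancels the `-1/9` coming from the tracefree parts, so only `tr (X ∘ Y)` remains.
    rw [h4]
    module

theorem der_ext {ε : ℝ} {D E : derAlg ε} (hi : D.1 ⟨qi, 0⟩ = E.1 ⟨qi, 0⟩)
    (hj : D.1 ⟨qj, 0⟩ = E.1 ⟨qj, 0⟩)
    (hl : D.1 ⟨0, 1⟩ = E.1 ⟨0, 1⟩) : D = E := by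
  rw [← sub_eq_zero]
  apply der_eq_zero_of_generators
  · exact sub_eq_zero.mpr hi
  · exact sub_eq_zero.mpr hj
  · exact sub_eq_zero.mpr hl

/-- The split octonion with the given components. -/
def oct (a b c d e f g h : ℝ) : SplitOct := ⟨quat a b c d, quat e f g h⟩

/-- Explicit coordinates turn every later identity among labels into rational arithmetic. -/
theorem oct_mul (a b c d e f g h a' b' c' d' e' f' g' h' : ℝ) :
    oct a b c d e f g h * oct a' b' c' d' e' f' g' h' =
    oct (a*a' - b*b' - c*c' - d*d' + (e*e'+f*f'+g*g'+h*h'))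
     (a*b' + b*a' + c*d' - d*c' + (e'*f - f'*e - g'*h + h'*g))
     (a*c' - b*d' + c*a' + d*b' + (e'*g + f'*h - g'*e - h'*f))
     (a*d' + b*c' - c*b' + d*a' + (e'*h - f'*g + g'*f - h'*e))
     (e'*a - f'*b - g'*c - h'*d + (e*a' + f*b' + g*c' + h*d'))
     (e'*b + f'*a + g'*d - h'*c + (-e*b' + f*a' - g*d' + h*c'))
     (e'*c - f'*d + g'*a + h'*b + (-e*c' + f*d' + g*a' - h*b'))
     (e'*d + f'*c - g'*b + h'*a + (-e*d' - f*c' + g*b' + h*a')) := by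
  apply CD.ext <;> ext <;> simp [oct] <;> ring

theorem oct_add (a b c d e f g h a' b' c' d' e' f' g' h' : ℝ) :
    oct a b c d e f g h + oct a' b' c' d' e' f' g' h' =
    oct (a+a') (b+b') (c+c') (d+d') (e+e') (f+f') (g+g') (h+h') := by
  apply CD.ext <;> ext <;> simp [oct]

theorem oct_sub (a b c d e f g h a' b' c' d' e' f' g' h' : ℝ) :
    oct a b c d e f g h - oct a' b' c' d' e' f' g' h' =
    oct (a-a') (b-b') (c-c') (d-d') (e-e') (f-f') (g-g') (h-h') := by
  apply CD.ext <;> ext <;> simp [oct]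

theorem oct_smul (r a b c d e f g h : ℝ) :
    r • oct a b c d e f g h =
    oct (r*a) (r*b) (r*c) (r*d) (r*e) (r*f) (r*g) (r*h) := by
  apply CD.ext <;> ext <;> simp [oct]
theorem oct_neg (a b c d e f g h : ℝ) :
    -oct a b c d e f g h =
    oct (-a) (-b) (-c) (-d) (-e) (-f) (-g) (-h) := by
  apply CD.ext <;> ext <;> simp [oct]

theorem I_oct : I = oct 0 1 0 0 0 0 0 0 := by apply CD.ext <;> ext <;> simp [oct, I]
theorem J_oct : J = oct 0 0 1 0 0 0 0 0 := by apply CD.ext <;> ext <;> simp [oct, J]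
theorem K_oct : K = oct 0 0 0 1 0 0 0 0 := by apply CD.ext <;> ext <;> simp [oct, K]
theorem L_oct : L = oct 0 0 0 0 1 0 0 0 := by apply CD.ext <;> ext <;> simp [oct, L]
theorem IL_oct : IL = oct 0 0 0 0 0 1 0 0 := by apply CD.ext <;> ext <;> simp [oct, IL]
theorem JL_oct : JL = oct 0 0 0 0 0 0 1 0 := by apply CD.ext <;> ext <;> simp [oct, JL]
theorem KL_oct : KL = oct 0 0 0 0 0 0 0 1 := by apply CD.ext <;> ext <;> simp [oct, KL]
theorem Ip_oct : Ip = oct 0 (1/2) 0 0 0 (1/2) 0 0 := by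
  rw [Ip, I_oct, IL_oct, oct_add, oct_smul]; norm_num
theorem Im_oct : Im = oct 0 (1/2) 0 0 0 (-1/2) 0 0 := by
  rw [Im, I_oct, IL_oct, oct_sub, oct_smul]; norm_num
theorem Jp_oct : Jp = oct 0 0 (1/2) 0 0 0 (1/2) 0 := by
  rw [Jp, J_oct, JL_oct, oct_add, oct_smul]; norm_num
theorem Jm_oct : Jm = oct 0 0 (1/2) 0 0 0 (-1/2) 0 := by
  rw [Jm, J_oct, JL_oct, oct_sub, oct_smul]; norm_num
theorem Kp_oct : Kp = oct 0 0 0 (1/2) 0 0 0 (1/2) := by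
  rw [Kp, K_oct, KL_oct, oct_add, oct_smul]; norm_num
theorem Km_oct : Km = oct 0 0 0 (1/2) 0 0 0 (-1/2) := by
  rw [Km, K_oct, KL_oct, oct_sub, oct_smul]; norm_num

theorem split_der_ext {D E : derAlg 1} (hi : D.1 I = E.1 I) (hj : D.1 J = E.1 J)
    (hl : D.1 L = E.1 L) : D = E := der_ext hi hj hl

theorem zero_oct : (0 : SplitOct) = oct 0 0 0 0 0 0 0 0 := by
  apply CD.ext <;> ext <;> simp [oct]

theorem oct_re (a b c d e f g h : ℝ) : (oct a b c d e f g h).fst.re = a := rfl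

/-! ### The derivations of `𝕆'` annihilating `L` -/

/-- The derivation underlying `A_Ip`. -/
def dIp : derAlg 1 := (2 / 3 : ℝ) • innerDer 1 Jp Km

/-- The derivation underlying `A_Im`. -/
def dIm : derAlg 1 := (2 / 3 : ℝ) • innerDer 1 Jm Kp

/-- The derivation underlying `A_Jp`. -/
def dJp : derAlg 1 := (2 / 3 : ℝ) • innerDer 1 Kp Im

/-- The derivation underlying `A_Jm`. -/
def dJm : derAlg 1 := (2 / 3 : ℝ) • innerDer 1 Km Ip

/-- The derivation underlying `A_Kp`. -/
def dKp : derAlg 1 := (2 / 3 : ℝ) • innerDer 1 Ip Jm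

/-- The derivation underlying `A_Km`. -/
def dKm : derAlg 1 := (2 / 3 : ℝ) • innerDer 1 Im Jp

/-- The derivation underlying `A_L`. -/
def dL : derAlg 1 := (-1 / 3 : ℝ) • (innerDer 1 I IL - innerDer 1 J JL)

/-- The derivation underlying `G_L`. -/
def dG : derAlg 1 := innerDer 1 K KL

/-- The four nested terms are the bilinear expansion of a single inner derivation in two null
labels. In this form `derComm_innerDer` computes all brackets with it. -/
theorem A_Ip_eq : A_Ip = leftHom dIp := by
  rw [A_Ip, A_I, A_IL, nested_eq, nested_eq, nested_eq, nested_eq, dIp, Jp, Km]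
  simp only [← map_sub leftHom, ← map_add leftHom, ← map_smul leftHom]
  congr 1
  simp only [map_smul, map_add, map_sub, LinearMap.smul_apply, LinearMap.add_apply]
  module

theorem A_Im_eq : A_Im = leftHom dIm := by
  rw [A_Im, A_I, A_IL, nested_eq, nested_eq, nested_eq, nested_eq, dIm, Jm, Kp]
  simp only [← map_sub leftHom, ← map_smul leftHom]
  congr 1
  simp only [map_smul, map_add, map_sub, LinearMap.smul_apply, LinearMap.sub_apply]
  module

theorem A_Jp_eq : A_Jp = leftHom dJp := by
  rw [A_Jp, A_J, A_JL, nested_eq, nested_eq, nested_eq, nested_eq, dJp, Kp, Im]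
  simp only [← map_sub leftHom, ← map_add leftHom, ← map_smul leftHom]
  congr 1
  simp only [map_smul, map_add, map_sub, LinearMap.smul_apply, LinearMap.add_apply]
  module

theorem A_Jm_eq : A_Jm = leftHom dJm := by
  rw [A_Jm, A_J, A_JL, nested_eq, nested_eq, nested_eq, nested_eq, dJm, Km, Ip]
  simp only [← map_sub leftHom, ← map_smul leftHom]
  congr 1
  simp only [map_smul, map_add, map_sub, LinearMap.smul_apply, LinearMap.sub_apply]
  module

theorem A_Kp_eq : A_Kp = leftHom dKp := by
  rw [A_Kp, A_K, A_KL, nested_eq, nested_eq, nested_eq, nested_eq, dKp, Ip, Jm]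
  simp only [← map_sub leftHom, ← map_add leftHom, ← map_smul leftHom]
  congr 1
  simp only [map_smul, map_add, map_sub, LinearMap.smul_apply, LinearMap.add_apply]
  module

theorem A_Km_eq : A_Km = leftHom dKm := by
  rw [A_Km, A_K, A_KL, nested_eq, nested_eq, nested_eq, nested_eq, dKm, Im, Jp]
  simp only [← map_sub leftHom, ← map_smul leftHom]
  congr 1
  simp only [map_smul, map_add, map_sub, LinearMap.smul_apply, LinearMap.sub_apply]
  module

theorem A_L_eq : A_L = leftHom dL := by
  rw [A_L, nested_eq, nested_eq, dL, ← map_sub leftHom, ← map_smul leftHom]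
  congr 1
  module

theorem G_L_eq : G_L = leftHom dG := by
  rw [G_L, nested_eq, dG, ← map_smul leftHom]
  congr 1
  module

section Table

attribute [local simp] oct_mul oct_add oct_sub oct_smul oct_neg I_oct J_oct K_oct L_oct IL_oct
  JL_oct KL_oct Ip_oct Im_oct Jp_oct Jm_oct Kp_oct Km_oct innerDer_apply assoc zero_oct oct_re

@[simp] theorem dIp_L : dIp.1 L = 0 := by norm_num [dIp]

@[simp] theorem dIp_Kp : dIp.1 Kp = (-2 : ℝ) • Jp := by norm_num [dIp]

@[simp] theorem dIp_Km : dIp.1 Km = 0 := by norm_num [dIp]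

@[simp] theorem dIm_L : dIm.1 L = 0 := by norm_num [dIm]

@[simp] theorem dIm_Kp : dIm.1 Kp = 0 := by norm_num [dIm]

@[simp] theorem dIm_Km : dIm.1 Km = (-2 : ℝ) • Jm := by norm_num [dIm]

@[simp] theorem dJp_L : dJp.1 L = 0 := by norm_num [dJp]

@[simp] theorem dJp_Kp : dJp.1 Kp = 0 := by norm_num [dJp]

@[simp] theorem dJp_Km : dJp.1 Km = (2 : ℝ) • Im := by norm_num [dJp]

@[simp] theorem dJm_L : dJm.1 L = 0 := by norm_num [dJm]

@[simp] theorem dJm_Kp : dJm.1 Kp = (2 : ℝ) • Ip := by norm_num [dJm]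

@[simp] theorem dJm_Km : dJm.1 Km = 0 := by norm_num [dJm]

@[simp] theorem dKp_L : dKp.1 L = 0 := by norm_num [dKp]

@[simp] theorem dKp_Ip : dKp.1 Ip = 0 := by norm_num [dKp]

@[simp] theorem dKp_Im : dKp.1 Im = (2 : ℝ) • Jm := by norm_num [dKp]

@[simp] theorem dKp_Jp : dKp.1 Jp = (-2 : ℝ) • Ip := by norm_num [dKp]

@[simp] theorem dKp_Jm : dKp.1 Jm = 0 := by norm_num [dKp]

@[simp] theorem dKp_Kp : dKp.1 Kp = 0 := by norm_num [dKp]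

@[simp] theorem dKp_Km : dKp.1 Km = 0 := by norm_num [dKp]

@[simp] theorem dKm_L : dKm.1 L = 0 := by norm_num [dKm]

@[simp] theorem dKm_Ip : dKm.1 Ip = (2 : ℝ) • Jp := by norm_num [dKm]

@[simp] theorem dKm_Im : dKm.1 Im = 0 := by norm_num [dKm]

@[simp] theorem dKm_Jp : dKm.1 Jp = 0 := by norm_num [dKm]

@[simp] theorem dKm_Jm : dKm.1 Jm = (-2 : ℝ) • Im := by norm_num [dKm]

@[simp] theorem dKm_Kp : dKm.1 Kp = 0 := by norm_num [dKm]

@[simp] theorem dKm_Km : dKm.1 Km = 0 := by norm_num [dKm]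

@[simp] theorem dL_L : dL.1 L = 0 := by norm_num [dL]

@[simp] theorem dL_Ip : dL.1 Ip = (-2 : ℝ) • Ip := by norm_num [dL]

@[simp] theorem dL_Im : dL.1 Im = (2 : ℝ) • Im := by norm_num [dL]

@[simp] theorem dL_Jp : dL.1 Jp = (2 : ℝ) • Jp := by norm_num [dL]

@[simp] theorem dL_Jm : dL.1 Jm = (-2 : ℝ) • Jm := by norm_num [dL]

@[simp] theorem dL_Kp : dL.1 Kp = 0 := by norm_num [dL]

@[simp] theorem dL_Km : dL.1 Km = 0 := by norm_num [dL]

@[simp] theorem dG_L : dG.1 L = 0 := by norm_num [dG]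

@[simp] theorem dG_Ip : dG.1 Ip = (-2 : ℝ) • Ip := by norm_num [dG]

@[simp] theorem dG_Im : dG.1 Im = (2 : ℝ) • Im := by norm_num [dG]

@[simp] theorem dG_Jp : dG.1 Jp = (-2 : ℝ) • Jp := by norm_num [dG]

@[simp] theorem dG_Jm : dG.1 Jm = (2 : ℝ) • Jm := by norm_num [dG]

@[simp] theorem dG_Kp : dG.1 Kp = (4 : ℝ) • Kp := by norm_num [dG]

@[simp] theorem dG_Km : dG.1 Km = (-4 : ℝ) • Km := by norm_num [dG]

theorem Ip_re : Ip.fst.re = 0 := by norm_num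

theorem Im_re : Im.fst.re = 0 := by norm_num

theorem Jp_re : Jp.fst.re = 0 := by norm_num

theorem Jm_re : Jm.fst.re = 0 := by norm_num

theorem Kp_re : Kp.fst.re = 0 := by norm_num

theorem Km_re : Km.fst.re = 0 := by norm_num

theorem phi0_lab_Im (φ : E6) (X : H3) : ⁅phi0 φ, lab Im X⁆ = lab Im (e6Act φ X) :=
  phi0_lab (by norm_num) (by norm_num) Im_re (by norm_num) φ X

theorem phi0_lab_Jm (φ : E6) (X : H3) : ⁅phi0 φ, lab Jm X⁆ = lab Jm (e6Act φ X) :=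
  phi0_lab (by norm_num) (by norm_num) Jm_re (by norm_num) φ X

theorem phi0_lab_Km (φ : E6) (X : H3) : ⁅phi0 φ, lab Km X⁆ = lab Km (e6Act φ X) :=
  phi0_lab (by norm_num) (by norm_num) Km_re (by norm_num) φ X

theorem phi0_lab_Ip (φ : E6) (X : H3) :
    ⁅phi0 φ, lab Ip X⁆ = lab Ip (e6Act (e6Dual φ) X) :=
  phi0_lab_dual (by norm_num) (by norm_num) Ip_re (by norm_num) φ X

theorem phi0_lab_Jp (φ : E6) (X : H3) :
    ⁅phi0 φ, lab Jp X⁆ = lab Jp (e6Act (e6Dual φ) X) :=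
  phi0_lab_dual (by norm_num) (by norm_num) Jp_re (by norm_num) φ X

/-- Rests on `K₋ I₋ = J₊`. Likewise `J₊ K₊ = I₋`, `J₋ K₋ = I₊` and `K₊ I₊ = J₋` in the next three
statements; these give the four Freudenthal products in the actions on the two towers. -/
theorem lab_Km_Im (X Y : H3) : ⁅lab Km X, lab Im Y⁆ = lab Jp ((2 : ℝ) • freud X Y) := by
  refine lab_bracket_freud Km_re Im_re Jp_re ?_ ?_ ?_ ?_ ?_ ?_ X Y
  · norm_num
  · norm_num
  · norm_num
  · norm_num
  · apply split_der_ext <;> norm_num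
  · apply split_der_ext <;> norm_num [derComm_apply]

theorem lab_Jp_Kp (X Y : H3) : ⁅lab Jp X, lab Kp Y⁆ = lab Im ((2 : ℝ) • freud X Y) := by
  refine lab_bracket_freud Jp_re Kp_re Im_re ?_ ?_ ?_ ?_ ?_ ?_ X Y
  · norm_num
  · norm_num
  · norm_num
  · norm_num
  · apply split_der_ext <;> norm_num
  · apply split_der_ext <;> norm_num [derComm_apply]

theorem lab_Jm_Km (X Y : H3) : ⁅lab Jm X, lab Km Y⁆ = lab Ip ((2 : ℝ) • freud X Y) := by
  refine lab_bracket_freud Jm_re Km_re Ip_re ?_ ?_ ?_ ?_ ?_ ?_ X Y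
  · norm_num
  · norm_num
  · norm_num
  · norm_num
  · apply split_der_ext <;> norm_num
  · apply split_der_ext <;> norm_num [derComm_apply]

theorem lab_Kp_Ip (X Y : H3) : ⁅lab Kp X, lab Ip Y⁆ = lab Jm ((2 : ℝ) • freud X Y) := by
  refine lab_bracket_freud Kp_re Ip_re Jm_re ?_ ?_ ?_ ?_ ?_ ?_ X Y
  · norm_num
  · norm_num
  · norm_num
  · norm_num
  · apply split_der_ext <;> norm_num
  · apply split_der_ext <;> norm_num [derComm_apply]

/-- Null labels with different letters and opposite signs have product zero, so the bracket has no
matrix part. The derivation left over gives the trace terms of Freudenthal's action. -/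
theorem lab_Jp_Km (X Y : H3) :
    ⁅lab Jp X, lab Km Y⁆ = (1 / 2 * tr (jordan X Y)) • A_Ip := by
  rw [lab_bracket_trace Jp_re Km_re, A_Ip_eq, dIp, ← map_smul leftHom, ← map_smul leftHom]
  · congr 1
    module
  · norm_num
    exact zero_oct.symm
  · norm_num
    exact zero_oct.symm
  · norm_num
  · norm_num
  · apply split_der_ext <;> norm_num [derComm_apply]

theorem lab_Kp_Im (X Y : H3) :
    ⁅lab Kp X, lab Im Y⁆ = (1 / 2 * tr (jordan X Y)) • A_Jp := by
  rw [lab_bracket_trace Kp_re Im_re, A_Jp_eq, dJp, ← map_smul leftHom, ← map_smul leftHom]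
  · congr 1
    module
  · norm_num
    exact zero_oct.symm
  · norm_num
    exact zero_oct.symm
  · norm_num
  · norm_num
  · apply split_der_ext <;> norm_num [derComm_apply]

theorem lab_Km_Ip (X Y : H3) :
    ⁅lab Km X, lab Ip Y⁆ = (1 / 2 * tr (jordan X Y)) • A_Jm := by
  rw [lab_bracket_trace Km_re Ip_re, A_Jm_eq, dJm, ← map_smul leftHom, ← map_smul leftHom]
  · congr 1
    module
  · norm_num
    exact zero_oct.symm
  · norm_num
    exact zero_oct.symm
  · norm_num
  · norm_num
  · apply split_der_ext <;> norm_num [derComm_apply]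

theorem lab_Jm_Kp (X Y : H3) :
    ⁅lab Jm X, lab Kp Y⁆ = (1 / 2 * tr (jordan X Y)) • A_Im := by
  rw [lab_bracket_trace Jm_re Kp_re, A_Im_eq, dIm, ← map_smul leftHom, ← map_smul leftHom]
  · congr 1
    module
  · norm_num
    exact zero_oct.symm
  · norm_num
    exact zero_oct.symm
  · norm_num
  · norm_num
  · apply split_der_ext <;> norm_num [derComm_apply]

end Table

/-! ### The action of `𝔢₇` on the two towers -/

theorem jordan_comm (X Y : H3) : jordan X Y = jordan Y X := by
  apply Subtype.ext
  rw [jordan_val, jordan_val, add_comm]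

theorem freud_comm (X Y : H3) : freud X Y = freud Y X := by
  rw [freud, freud, jordan_comm, mul_comm (tr X), add_comm (tr X • Y)]

theorem lab_smul_left (r : ℝ) (Q : SplitOct) (X : H3) : lab (r • Q) X = r • lab Q X := by
  rw [lab_eq, lab_eq, smul_add, ← map_smul, ← map_smul]
  congr 2
  · apply Subtype.ext
    change label (r • Q).imPart _ = r • label Q.imPart _
    rw [← label_smul_left, CD.imPart_eq, CD.imPart_eq, smul_sub, smul_smul]
    rfl
  · rw [smul_mul_assoc]
    simp only [map_smul, LinearMap.smul_apply]
    module

theorem lab_zero_left (X : H3) : lab 0 X = 0 := by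
  simpa using lab_smul_left 0 0 X

theorem theta0_mk (φ : E6) (ρ : ℝ) (A B : H3) : theta0 (φ, ρ, A, B) =
    phi0 φ + (1 / 6 * ρ) • G_L + lab Km A - lab Kp B := rfl

theorem towerP_mk (X Y : H3) (p q : ℝ) : towerP (X, Y, p, q) =
    lab Im X + lab Jp Y - (1 / 2 * p) • A_Ip - (1 / 2 * q) • A_Jp := rfl

theorem towerM_mk (X Y : H3) (p q : ℝ) : towerM (X, Y, p, q) =
    lab Jm X - lab Ip Y - (1 / 2 * p) • A_Jm + (1 / 2 * q) • A_Im := rfl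

theorem freudAct_mk (φ : E6) (ρ : ℝ) (A B X Y : H3) (p q : ℝ) :
    freudAct (φ, ρ, A, B) (X, Y, p, q) =
    (e6Act φ X + (1 / 3 * ρ) • X + (2 : ℝ) • freud B Y + q • A,
      (2 : ℝ) • freud A X + e6Act (e6Dual φ) Y - (1 / 3 * ρ) • Y + p • B,
      tr (jordan A Y) - ρ * p, tr (jordan B X) + ρ * q) := rfl

/-- The labels `J₊` and `K₋` have weights `-2` and `-4` under `dG`, and weights add. Divided by `6`,
this is the term `-ρ p` of Freudenthal's action. -/
theorem derComm_dG_dIp : derComm dG dIp = (-6 : ℝ) • dIp := by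
  rw [dIp, derComm_smul_right, derComm_innerDer, dG_Jp, dG_Km]
  simp only [map_smul, LinearMap.smul_apply]
  module

theorem derComm_dG_dJp : derComm dG dJp = (6 : ℝ) • dJp := by
  rw [dJp, derComm_smul_right, derComm_innerDer, dG_Kp, dG_Im]
  simp only [map_smul, LinearMap.smul_apply]
  module

theorem derComm_dG_dJm : derComm dG dJm = (-6 : ℝ) • dJm := by
  rw [dJm, derComm_smul_right, derComm_innerDer, dG_Km, dG_Ip]
  simp only [map_smul, LinearMap.smul_apply]
  module

theorem derComm_dG_dIm : derComm dG dIm = (6 : ℝ) • dIm := by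
  rw [dIm, derComm_smul_right, derComm_innerDer, dG_Jm, dG_Kp]
  simp only [map_smul, LinearMap.smul_apply]
  module

theorem lab_leftHom {d : derAlg 1} (hd : d.1 L = 0) (Q : SplitOct) (X : H3) :
    ⁅lab Q X, leftHom d⁆ = -lab (d.1 Q) X := by
  rw [bracket_swap, leftHom_lab hd]

/-- Each term of Freudenthal's action is one type of bracket: `φ` and `φ'` come from `phi0`, `ρ`
from the weights of `dG`, Freudenthal products from labels of equal sign, traces from labels of
opposite sign, and `q A`, `p B` from `dJp` and `dIp` acting on `K₋` and `K₊`. -/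
theorem theta0_towerP (Θ : Theta) (P : Tower) :
    ⁅theta0 Θ, towerP P⁆ = towerP (freudAct Θ P) := by
  obtain ⟨φ, ρ, A, B⟩ := Θ
  obtain ⟨X, Y, p, q⟩ := P
  have h1 : ⁅lab Kp B, lab Jp Y⁆ = -lab Im ((2 : ℝ) • freud B Y) := by
    rw [bracket_swap, lab_Jp_Kp, freud_comm]
  have h2 : ⁅lab Km A, lab Jp Y⁆ = -((1 / 2 * tr (jordan A Y)) • A_Ip) := by
    rw [bracket_swap, lab_Jp_Km, jordan_comm]
  rw [theta0_mk, towerP_mk, freudAct_mk, towerP_mk]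
  simp only [add_bracket, sub_bracket, bracket_add, bracket_sub, smul_bracket, bracket_smul]
  rw [h1, h2, lab_Km_Im, lab_Kp_Im, phi0_lab_Im, phi0_lab_Jp, A_Ip_eq, A_Jp_eq, G_L_eq,
    phi0_leftHom dIp_L, phi0_leftHom dJp_L]
  simp only [leftHom_lab dG_L, lab_leftHom dIp_L, lab_leftHom dJp_L, leftHom_leftHom,
    derComm_dG_dIp, derComm_dG_dJp, dG_Im, dG_Jp, dIp_Km, dIp_Kp, dJp_Km, dJp_Kp, lab_smul_left,
    lab_zero_left, map_add, map_sub, map_smul]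
  module

theorem theta0_towerM (Θ : Theta) (P : Tower) :
    ⁅theta0 Θ, towerM P⁆ = towerM (freudAct Θ P) := by
  obtain ⟨φ, ρ, A, B⟩ := Θ
  obtain ⟨X, Y, p, q⟩ := P
  have h1 : ⁅lab Km A, lab Jm X⁆ = -lab Ip ((2 : ℝ) • freud A X) := by
    rw [bracket_swap, lab_Jm_Km, freud_comm]
  have h2 : ⁅lab Kp B, lab Jm X⁆ = -((1 / 2 * tr (jordan B X)) • A_Im) := by
    rw [bracket_swap, lab_Jm_Kp, jordan_comm]
  rw [theta0_mk, towerM_mk, freudAct_mk, towerM_mk]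
  simp only [add_bracket, sub_bracket, bracket_add, bracket_sub, smul_bracket, bracket_smul]
  rw [h1, h2, lab_Km_Ip, lab_Kp_Ip, phi0_lab_Jm, phi0_lab_Ip, A_Im_eq, A_Jm_eq, G_L_eq,
    phi0_leftHom dIm_L, phi0_leftHom dJm_L]
  simp only [leftHom_lab dG_L, lab_leftHom dIm_L, lab_leftHom dJm_L, leftHom_leftHom,
    derComm_dG_dIm, derComm_dG_dJm, dG_Ip, dG_Jm, dIm_Km, dIm_Kp, dJm_Km, dJm_Kp, lab_smul_left,
    lab_zero_left, map_add, map_sub, map_smul]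
  module

/-! ### The action of `𝔰𝔩(2, ℝ)` -/

theorem derComm_dL_dIp : derComm dL dIp = (2 : ℝ) • dIp := by
  rw [dIp, derComm_smul_right, derComm_innerDer, dL_Jp, dL_Km]
  simp only [map_smul, map_zero, LinearMap.smul_apply]
  module

theorem derComm_dL_dJp : derComm dL dJp = (2 : ℝ) • dJp := by
  rw [dJp, derComm_smul_right, derComm_innerDer, dL_Kp, dL_Im]
  simp only [map_smul, map_zero, LinearMap.zero_apply]
  module

theorem derComm_dL_dIm : derComm dL dIm = (-2 : ℝ) • dIm := by
  rw [dIm, derComm_smul_right, derComm_innerDer, dL_Jm, dL_Kp]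
  simp only [map_smul, map_zero, LinearMap.smul_apply]
  module

theorem derComm_dL_dJm : derComm dL dJm = (-2 : ℝ) • dJm := by
  rw [dJm, derComm_smul_right, derComm_innerDer, dL_Km, dL_Ip]
  simp only [map_smul, map_zero, LinearMap.zero_apply]
  module

theorem derComm_dL_dKp : derComm dL dKp = (-4 : ℝ) • dKp := by
  rw [dKp, derComm_smul_right, derComm_innerDer, dL_Ip, dL_Jm]
  simp only [map_smul, LinearMap.smul_apply]
  module

theorem derComm_dL_dKm : derComm dL dKm = (4 : ℝ) • dKm := by
  rw [dKm, derComm_smul_right, derComm_innerDer, dL_Im, dL_Jp]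
  simp only [map_smul, LinearMap.smul_apply]
  module

/-- The form in which the bracket of `dKp` and `dKm` presents itself, since these map null labels to
null labels. -/
theorem dL_eq : dL = (-2 / 3 : ℝ) • (innerDer 1 Im Ip - innerDer 1 Jm Jp) := by
  rw [dL, Ip, Im, Jp, Jm]
  simp only [map_smul, map_add, map_sub, LinearMap.smul_apply, LinearMap.sub_apply,
    innerDer_self, innerDer_swap IL I, innerDer_swap JL J]
  module

theorem derComm_dKp_dKm : derComm dKp dKm = (2 : ℝ) • dL := by
  rw [dKm, derComm_smul_right, derComm_innerDer, dKp_Im, dKp_Jp, dL_eq, innerDer_swap Jm Jp]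
  simp only [map_smul, LinearMap.smul_apply]
  rw [innerDer_swap Jm Jp]
  module

theorem derComm_dKp_dIp : derComm dKp dIp = (2 : ℝ) • dJm := by
  rw [dIp, derComm_smul_right, derComm_innerDer, dKp_Jp, dKp_Km, dJm, innerDer_swap Km]
  simp only [map_smul, map_zero, LinearMap.smul_apply]
  module

theorem derComm_dKp_dJp : derComm dKp dJp = (-2 : ℝ) • dIm := by
  rw [dJp, derComm_smul_right, derComm_innerDer, dKp_Kp, dKp_Im, dIm, innerDer_swap Jm]
  simp only [map_smul, map_zero, LinearMap.zero_apply]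
  module

theorem derComm_dKp_dIm : derComm dKp dIm = 0 := by
  rw [dIm, derComm_smul_right, derComm_innerDer, dKp_Jm, dKp_Kp]
  simp

theorem derComm_dKp_dJm : derComm dKp dJm = 0 := by
  rw [dJm, derComm_smul_right, derComm_innerDer, dKp_Km, dKp_Ip]
  simp

theorem derComm_dKm_dIp : derComm dKm dIp = 0 := by
  rw [dIp, derComm_smul_right, derComm_innerDer, dKm_Jp, dKm_Km]
  simp

theorem derComm_dKm_dJp : derComm dKm dJp = 0 := by
  rw [dJp, derComm_smul_right, derComm_innerDer, dKm_Kp, dKm_Im]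
  simp

theorem derComm_dKm_dJm : derComm dKm dJm = (-2 : ℝ) • dIp := by
  rw [dJm, derComm_smul_right, derComm_innerDer, dKm_Km, dKm_Ip, dIp, innerDer_swap Jp]
  simp only [map_smul, map_zero, LinearMap.zero_apply]
  module

theorem derComm_dKm_dIm : derComm dKm dIm = (2 : ℝ) • dJp := by
  rw [dIm, derComm_smul_right, derComm_innerDer, dKm_Jm, dKm_Kp, dJp, innerDer_swap Kp]
  simp only [map_smul, map_zero, LinearMap.smul_apply]
  module

theorem A_L_towerP (P : Tower) : ⁅A_L, towerP P⁆ = (2 : ℝ) • towerP P := by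
  obtain ⟨X, Y, p, q⟩ := P
  rw [towerP_mk, A_Ip_eq, A_Jp_eq, A_L_eq]
  simp only [bracket_add, bracket_sub, bracket_smul, leftHom_lab dL_L, leftHom_leftHom, dL_Im, dL_Jp,
    derComm_dL_dIp, derComm_dL_dJp, lab_smul_left, map_smul]
  module

theorem A_L_towerM (P : Tower) : ⁅A_L, towerM P⁆ = (-2 : ℝ) • towerM P := by
  obtain ⟨X, Y, p, q⟩ := P
  rw [towerM_mk, A_Im_eq, A_Jm_eq, A_L_eq]
  simp only [bracket_add, bracket_sub, bracket_smul, leftHom_lab dL_L, leftHom_leftHom, dL_Ip, dL_Jm,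
    derComm_dL_dIm, derComm_dL_dJm, lab_smul_left, map_smul]
  module

theorem A_Kp_towerP (P : Tower) : ⁅A_Kp, towerP P⁆ = (2 : ℝ) • towerM P := by
  obtain ⟨X, Y, p, q⟩ := P
  rw [towerP_mk, towerM_mk, A_Ip_eq, A_Jp_eq, A_Im_eq, A_Jm_eq, A_Kp_eq]
  simp only [bracket_add, bracket_sub, bracket_smul, leftHom_lab dKp_L, leftHom_leftHom, dKp_Im,
    dKp_Jp, derComm_dKp_dIp, derComm_dKp_dJp, lab_smul_left, map_smul]
  module

theorem A_Kp_towerM (P : Tower) : ⁅A_Kp, towerM P⁆ = 0 := by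
  obtain ⟨X, Y, p, q⟩ := P
  rw [towerM_mk, A_Im_eq, A_Jm_eq, A_Kp_eq]
  simp only [bracket_add, bracket_sub, bracket_smul, leftHom_lab dKp_L, leftHom_leftHom, dKp_Ip,
    dKp_Jm, derComm_dKp_dIm, derComm_dKp_dJm, lab_zero_left, map_zero]
  module

theorem A_Km_towerP (P : Tower) : ⁅A_Km, towerP P⁆ = 0 := by
  obtain ⟨X, Y, p, q⟩ := P
  rw [towerP_mk, A_Ip_eq, A_Jp_eq, A_Km_eq]
  simp only [bracket_add, bracket_sub, bracket_smul, leftHom_lab dKm_L, leftHom_leftHom, dKm_Im,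
    dKm_Jp, derComm_dKm_dIp, derComm_dKm_dJp, lab_zero_left, map_zero]
  module

theorem A_Km_towerM (P : Tower) : ⁅A_Km, towerM P⁆ = (-2 : ℝ) • towerP P := by
  obtain ⟨X, Y, p, q⟩ := P
  rw [towerP_mk, towerM_mk, A_Ip_eq, A_Jp_eq, A_Im_eq, A_Jm_eq, A_Km_eq]
  simp only [bracket_add, bracket_sub, bracket_smul, leftHom_lab dKm_L, leftHom_leftHom, dKm_Ip,
    dKm_Jm, derComm_dKm_dIm, derComm_dKm_dJm, lab_smul_left, map_smul]
  module

theorem sl2Map_apply (g : LieAlgebra.SpecialLinear.sl (Fin 2) ℝ) : sl2Map g =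
    (1 / 2 * g.1 0 0) • A_L - (1 / 2 * g.1 0 1) • A_Km + (1 / 2 * g.1 1 0) • A_Kp := rfl

theorem sl2_apply_one_one (g : LieAlgebra.SpecialLinear.sl (Fin 2) ℝ) : g.1 1 1 = -g.1 0 0 := by
  have h : g.1.trace = 0 := LinearMap.mem_ker.mp g.2
  rw [Matrix.trace_fin_two] at h
  linarith

/-- `A_L / 2` has eigenvalues `±1` on the towers, `A_{K₊} / 2` maps the first identically to the
second and annihilates the second, and `-A_{K₋} / 2` does the reverse. -/
theorem sl2Map_doublet (g : LieAlgebra.SpecialLinear.sl (Fin 2) ℝ) (v : Fin 2 → ℝ) (P : Tower) :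
    ⁅sl2Map g, v 0 • towerP P + v 1 • towerM P⁆ =
      (g.1.mulVec v) 0 • towerP P + (g.1.mulVec v) 1 • towerM P := by
  rw [sl2Map_apply]
  simp only [add_bracket, sub_bracket, bracket_add, smul_bracket, bracket_smul, A_L_towerP,
    A_L_towerM, A_Kp_towerP, A_Kp_towerM, A_Km_towerP, A_Km_towerM, Matrix.mulVec,
    dotProduct, Fin.sum_univ_two, sl2_apply_one_one]
  module

theorem sl2Map_bracket (g h : LieAlgebra.SpecialLinear.sl (Fin 2) ℝ) :
    sl2Map ⁅g, h⁆ = ⁅sl2Map g, sl2Map h⁆ := by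
  have hgh : ∀ i j, (⁅g, h⁆ : LieAlgebra.SpecialLinear.sl (Fin 2) ℝ).1 i j =
      (g.1 * h.1 - h.1 * g.1) i j := fun i j => rfl
  have h1 : derComm dKm dKp = (-2 : ℝ) • dL := by
    rw [derComm_swap, derComm_dKp_dKm]
    module
  have h2 : ∀ d : derAlg 1, derComm d d = 0 := fun d => by
    apply Subtype.ext
    exact sub_self _
  rw [sl2Map_apply, sl2Map_apply, sl2Map_apply, A_L_eq, A_Kp_eq, A_Km_eq, hgh, hgh, hgh]
  simp only [add_bracket, sub_bracket, bracket_add, bracket_sub, smul_bracket, bracket_smul,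
    leftHom_leftHom, h1, h2, derComm_dL_dKm, derComm_dL_dKp, derComm_dKp_dKm, derComm_swap dKm dL,
    derComm_swap dKp dL, Matrix.sub_apply, Matrix.mul_apply, Fin.sum_univ_two, sl2_apply_one_one,
    map_smul, map_neg, map_zero]
  module

/-- Coordinates on `𝔰𝔩(2, ℝ)`. -/
def slEquiv : LieAlgebra.SpecialLinear.sl (Fin 2) ℝ ≃ₗ[ℝ] ℝ × ℝ × ℝ where
  toFun g := (g.1 0 0, g.1 0 1, g.1 1 0)
  invFun v := ⟨!![v.1, v.2.1; v.2.2, -v.1],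
    LinearMap.mem_ker.mpr (by
    rw [Matrix.traceLinearMap_apply, Matrix.trace_fin_two]
    simp)⟩
  map_add' g h := rfl
  map_smul' r g := rfl
  left_inv g := by
    apply Subtype.ext
    ext i j
    fin_cases i <;> fin_cases j <;> first | rfl | exact (sl2_apply_one_one g).symm
  right_inv v := rfl

theorem sl2Map_symm (a b c : ℝ) : sl2Map (slEquiv.symm (a, b, c)) =
    (1 / 2 * a) • A_L - (1 / 2 * b) • A_Km + (1 / 2 * c) • A_Kp := rfl

theorem range_sl2Map : LinearMap.range sl2Map = sl2 := by
  apply le_antisymm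
  · rintro _ ⟨g, rfl⟩
    have hK : A_K ∈ sl2 := Submodule.subset_span (by simp)
    have hKL : A_KL ∈ sl2 := Submodule.subset_span (by simp)
    have hL : A_L ∈ sl2 := Submodule.subset_span (by simp)
    rw [sl2Map_apply, A_Km, A_Kp]
    exact sl2.add_mem (sl2.sub_mem (sl2.smul_mem _ hL)
      (sl2.smul_mem _ (sl2.smul_mem _ (sl2.sub_mem hK hKL))))
      (sl2.smul_mem _ (sl2.smul_mem _ (sl2.add_mem hK hKL)))
  · rw [sl2, Submodule.span_le]
    rintro x (rfl | rfl | rfl)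
    -- Solves `A_K = A_{K₊} + A_{K₋}`; `A_{K₋}` enters `sl2Map` with a minus sign.
    · refine ⟨slEquiv.symm (0, -2, 2), ?_⟩
      rw [sl2Map_symm, A_Km, A_Kp]
      module
    · refine ⟨slEquiv.symm (0, 2, 2), ?_⟩
      rw [sl2Map_symm, A_Km, A_Kp]
      module
    · refine ⟨slEquiv.symm (2, 0, 0), ?_⟩
      rw [sl2Map_symm]
      module

theorem leftHom_injective : Function.Injective leftHom := by
  intro d d' h
  exact congrArg (fun x : E8 => x.2.1) h

theorem sl2Map_injective : Function.Injective sl2Map := by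
  rw [← LinearMap.ker_eq_bot, LinearMap.ker_eq_bot']
  intro g hg
  rw [sl2Map_apply, A_L_eq, A_Km_eq, A_Kp_eq, ← map_smul leftHom, ← map_smul leftHom,
    ← map_smul leftHom, ← map_sub leftHom, ← map_add leftHom, ← map_zero leftHom] at hg
  have hd := leftHom_injective hg
  have h : ∀ Q, (1 / 2 * g.1 0 0) • dL.1 Q - (1 / 2 * g.1 0 1) • dKm.1 Q +
      (1 / 2 * g.1 1 0) • dKp.1 Q = 0 := fun Q => congrArg (fun d : derAlg 1 => d.1 Q) hd
  have h1 := h Im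
  have h2 := h Ip
  simp only [dL_Im, dKm_Im, dKp_Im, dL_Ip, dKm_Ip, dKp_Ip, smul_zero, sub_zero, add_zero] at h1 h2
  have e1 := congrArg (fun z : SplitOct => z.fst.imI) h1
  have e2 := congrArg (fun z : SplitOct => z.fst.imJ) h1
  have e3 := congrArg (fun z : SplitOct => z.fst.imJ) h2
  simp [Im, Jm, Ip, Jp, I, J, IL, JL] at e1 e2 e3
  apply slEquiv.injective
  rw [map_zero]
  exact Prod.ext e1 (Prod.ext e3 e2)

theorem finrank_sl2 : Module.finrank ℝ sl2 = 3 := by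
  rw [← range_sl2Map, LinearMap.finrank_range_of_inj sl2Map_injective, slEquiv.finrank_eq]
  simp

/-! ### Independence of labels -/

/-- Contraction of the first factor of `𝕆' ⊗ 𝕆` with a linear form. -/
def contr (f : SplitOct →ₗ[ℝ] ℝ) : OO →ₗ[ℝ] Oct :=
  (TensorProduct.lid ℝ Oct).toLinearMap ∘ₗ TensorProduct.map f (LinearMap.id : Oct →ₗ[ℝ] Oct)

theorem contr_tmul (f : SplitOct →ₗ[ℝ] ℝ) (a : SplitOct) (b : Oct) :
    contr f (a ⊗ₜ[ℝ] b) = f a • b := by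
  simp [contr]

theorem map_contr_label (f : SplitOct →ₗ[ℝ] ℝ) (Q : SplitOct) (M : Mat3 Oct) :
    (label Q M).map (contr f) = f Q • M := by
  ext1 i j
  exact contr_tmul f Q (M i j)

/-- The coefficient of `1`. -/
def coeffOne : SplitOct →ₗ[ℝ] ℝ where
  toFun x := x.fst.re
  map_add' _ _ := rfl
  map_smul' _ _ := rfl

/-- The coefficient of `L`. -/
def coeffL : SplitOct →ₗ[ℝ] ℝ where
  toFun x := x.snd.re
  map_add' _ _ := rfl
  map_smul' _ _ := rfl

theorem coeffOne_apply (x : SplitOct) : coeffOne x = x.fst.re := rfl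

theorem coeffL_apply (x : SplitOct) : coeffL x = x.snd.re := rfl

/-- The coefficients of the null labels. -/
def coeffIp : SplitOct →ₗ[ℝ] ℝ where
  toFun x := x.fst.imI + x.snd.imI
  map_add' x y := by simp; ring
  map_smul' r x := by simp; ring

def coeffIm : SplitOct →ₗ[ℝ] ℝ where
  toFun x := x.fst.imI - x.snd.imI
  map_add' x y := by simp; ring
  map_smul' r x := by simp; ring

def coeffJp : SplitOct →ₗ[ℝ] ℝ where
  toFun x := x.fst.imJ + x.snd.imJ
  map_add' x y := by simp; ring
  map_smul' r x := by simp; ring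

def coeffJm : SplitOct →ₗ[ℝ] ℝ where
  toFun x := x.fst.imJ - x.snd.imJ
  map_add' x y := by simp; ring
  map_smul' r x := by simp; ring

def coeffKp : SplitOct →ₗ[ℝ] ℝ where
  toFun x := x.fst.imK + x.snd.imK
  map_add' x y := by simp; ring
  map_smul' r x := by simp; ring

def coeffKm : SplitOct →ₗ[ℝ] ℝ where
  toFun x := x.fst.imK - x.snd.imK
  map_add' x y := by simp; ring
  map_smul' r x := by simp; ring

section
attribute [local simp] Ip_oct Im_oct Jp_oct Jm_oct Kp_oct Km_oct L_oct oct

@[simp] theorem coeffIp_Ip : coeffIp Ip = 1 := by norm_num [coeffIp]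
@[simp] theorem coeffIp_Jm : coeffIp Jm = 0 := by norm_num [coeffIp]
@[simp] theorem coeffJm_Ip : coeffJm Ip = 0 := by norm_num [coeffJm]
@[simp] theorem coeffJm_Jm : coeffJm Jm = 1 := by norm_num [coeffJm]
@[simp] theorem coeffIm_Im : coeffIm Im = 1 := by norm_num [coeffIm]
@[simp] theorem coeffIm_Jp : coeffIm Jp = 0 := by norm_num [coeffIm]
@[simp] theorem coeffJp_Im : coeffJp Im = 0 := by norm_num [coeffJp]
@[simp] theorem coeffJp_Jp : coeffJp Jp = 1 := by norm_num [coeffJp]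
@[simp] theorem coeffKp_Kp : coeffKp Kp = 1 := by norm_num [coeffKp]
@[simp] theorem coeffKp_Km : coeffKp Km = 0 := by norm_num [coeffKp]
@[simp] theorem coeffKp_one : coeffKp 1 = 0 := by norm_num [coeffKp]
@[simp] theorem coeffKp_L : coeffKp L = 0 := by norm_num [coeffKp]
@[simp] theorem coeffKm_Kp : coeffKm Kp = 0 := by norm_num [coeffKm]
@[simp] theorem coeffKm_Km : coeffKm Km = 1 := by norm_num [coeffKm]
@[simp] theorem coeffKm_one : coeffKm 1 = 0 := by norm_num [coeffKm]
@[simp] theorem coeffKm_L : coeffKm L = 0 := by norm_num [coeffKm]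
@[simp] theorem coeffL_Kp : coeffL Kp = 0 := by norm_num [coeffL_apply]
@[simp] theorem coeffL_Km : coeffL Km = 0 := by norm_num [coeffL_apply]
@[simp] theorem coeffL_one : coeffL 1 = 0 := by norm_num [coeffL_apply]
@[simp] theorem coeffL_L : coeffL L = 1 := by norm_num [coeffL_apply]
@[simp] theorem coeffOne_Kp : coeffOne Kp = 0 := by norm_num [coeffOne_apply]
@[simp] theorem coeffOne_Km : coeffOne Km = 0 := by norm_num [coeffOne_apply]
@[simp] theorem coeffOne_one : coeffOne 1 = 1 := by norm_num [coeffOne_apply]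
@[simp] theorem coeffOne_L : coeffOne L = 0 := by norm_num [coeffOne_apply]

end

section
attribute [local simp] oct_mul oct_add oct_sub oct_smul oct_neg L_oct Ip_oct Im_oct Jp_oct Jm_oct
  Kp_oct Km_oct innerDer_apply assoc

theorem innerDer_Ip_L : (innerDer 1 (Ip * L) L).1 L = (4 : ℝ) • Ip := by norm_num
theorem innerDer_Jp_L : (innerDer 1 (Jp * L) L).1 L = (4 : ℝ) • Jp := by norm_num
theorem innerDer_Kp_L : (innerDer 1 (Kp * L) L).1 L = (4 : ℝ) • Kp := by norm_num
theorem innerDer_Im_L : (innerDer 1 (Im * L) L).1 L = (-4 : ℝ) • Im := by norm_num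
theorem innerDer_Jm_L : (innerDer 1 (Jm * L) L).1 L = (-4 : ℝ) • Jm := by norm_num
theorem innerDer_Km_L : (innerDer 1 (Km * L) L).1 L = (-4 : ℝ) • Km := by norm_num

end

theorem H3_eq_zero {X : H3} (h1 : tracefree X.1 = 0) (h2 : tr X = 0) : X = 0 := by
  rw [tracefree_H3, h2, mul_zero, zero_smul, sub_zero] at h1
  exact Subtype.ext h1

/-- The four components can be read off separately: the tracefree parts from the matrix, the traces
from the value of the derivation at `L`, which the elements `A` annihilate, and then `p` and `q`
from the values at `K₊` and `K₋`. -/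
theorem towerP_injective : Function.Injective towerP := by
  rw [← LinearMap.ker_eq_bot, LinearMap.ker_eq_bot']
  rintro ⟨X, Y, p, q⟩ h
  rw [towerP_mk, A_Ip_eq, A_Jp_eq, lab_mk, lab_mk, ← map_smul leftHom, ← map_smul leftHom] at h
  have hm : (labMat Im X).1 + (labMat Jp Y).1 - 0 - 0 = 0 := congrArg (fun x : E8 => x.1.1) h
  have hd : ∀ Q, (1 / 6 * tr X) • (innerDer 1 (Im * L) L).1 Q +
      (1 / 6 * tr Y) • (innerDer 1 (Jp * L) L).1 Q - (1 / 2 * p) • dIp.1 Q -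
      (1 / 2 * q) • dJp.1 Q = 0 := fun Q => congrArg (fun x : E8 => x.2.1.1 Q) h
  rw [labMat_val Im_re, labMat_val Jp_re, sub_zero, sub_zero] at hm
  have m1 := congrArg (fun M : Mat3 OO => M.map (contr coeffIm)) hm
  have m2 := congrArg (fun M : Mat3 OO => M.map (contr coeffJp)) hm
  simp only [Matrix.map_add _ (map_add _), map_contr_label] at m1 m2
  simp at m1 m2
  have hL := hd L
  rw [innerDer_Im_L, innerDer_Jp_L, dIp_L, dJp_L] at hL
  have l1 := congrArg coeffIm hL
  have l2 := congrArg coeffJp hL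
  simp at l1 l2
  have hX := H3_eq_zero m1 l1
  have hY := H3_eq_zero m2 l2
  have hp := congrArg coeffJp (hd Kp)
  have hq := congrArg coeffIm (hd Km)
  simp [l1, l2] at hp hq
  rw [hX, hY, hp, hq]
  rfl

theorem towerM_injective : Function.Injective towerM := by
  rw [← LinearMap.ker_eq_bot, LinearMap.ker_eq_bot']
  rintro ⟨X, Y, p, q⟩ h
  rw [towerM_mk, A_Im_eq, A_Jm_eq, lab_mk, lab_mk, ← map_smul leftHom, ← map_smul leftHom] at h
  have hm : (labMat Jm X).1 - (labMat Ip Y).1 - 0 + 0 = 0 := congrArg (fun x : E8 => x.1.1) h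
  have hd : ∀ Q, (1 / 6 * tr X) • (innerDer 1 (Jm * L) L).1 Q -
      (1 / 6 * tr Y) • (innerDer 1 (Ip * L) L).1 Q - (1 / 2 * p) • dJm.1 Q +
      (1 / 2 * q) • dIm.1 Q = 0 := fun Q => congrArg (fun x : E8 => x.2.1.1 Q) h
  rw [labMat_val Jm_re, labMat_val Ip_re, sub_zero, add_zero] at hm
  have m1 := congrArg (fun M : Mat3 OO => M.map (contr coeffJm)) hm
  have m2 := congrArg (fun M : Mat3 OO => M.map (contr coeffIp)) hm
  simp only [Matrix.map_sub _ (map_sub _), map_contr_label] at m1 m2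
  simp at m1 m2
  have hL := hd L
  rw [innerDer_Jm_L, innerDer_Ip_L, dIm_L, dJm_L] at hL
  have l1 := congrArg coeffJm hL
  have l2 := congrArg coeffIp hL
  simp at l1 l2
  have hX := H3_eq_zero m1 l1
  have hY := H3_eq_zero m2 l2
  have hp := congrArg coeffIp (hd Kp)
  have hq := congrArg coeffJm (hd Km)
  simp [l1, l2] at hp hq
  rw [hX, hY, hp, hq]
  rfl

/-- The coefficients of `1` and `L` in the matrix are the two parts of `M`, those of `K₋` and `K₊`
the tracefree parts of `A` and `-B`. The value of the derivation at `L` gives the traces, and then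
that at `I₋` gives `ρ`. -/
theorem theta0_injective : Function.Injective theta0 := by
  rw [← LinearMap.ker_eq_bot, LinearMap.ker_eq_bot']
  rintro ⟨⟨M, e⟩, ρ, A, B⟩ h
  rw [theta0_mk, phi0_eq, G_L_eq, lab_mk, lab_mk, ← map_smul leftHom] at h
  have hm : (phi0 (M, e)).1.1 + 0 + 0 + (labMat Km A).1 - (labMat Kp B).1 = 0 :=
    congrArg (fun x : E8 => x.1.1) h
  have hd : ∀ Q, 0 + 0 + (1 / 6 * ρ) • dG.1 Q + (1 / 6 * tr A) • (innerDer 1 (Km * L) L).1 Q -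
      (1 / 6 * tr B) • (innerDer 1 (Kp * L) L).1 Q = 0 :=
    fun Q => congrArg (fun x : E8 => x.2.1.1 Q) h
  have he : 0 + e + 0 + 0 - 0 = 0 := congrArg (fun x : E8 => x.2.2) h
  simp only [zero_add, add_zero, sub_zero] at he
  rw [labMat_val Km_re, labMat_val Kp_re, phi0_val, add_zero, add_zero] at hm
  have m1 := congrArg (fun M : Mat3 OO => M.map (contr coeffOne)) hm
  have m2 := congrArg (fun M : Mat3 OO => M.map (contr coeffL)) hm
  have m3 := congrArg (fun M : Mat3 OO => M.map (contr coeffKm)) hm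
  have m4 := congrArg (fun M : Mat3 OO => M.map (contr coeffKp)) hm
  simp only [Matrix.map_add _ (map_add _), Matrix.map_sub _ (map_sub _), map_contr_label,
    coeffOne_one, coeffOne_L, coeffOne_Km, coeffOne_Kp, coeffL_one, coeffL_L, coeffL_Km, coeffL_Kp,
    coeffKm_one, coeffKm_L, coeffKm_Km, coeffKm_Kp, coeffKp_one, coeffKp_L, coeffKp_Km, coeffKp_Kp,
    zero_smul, one_smul, add_zero, zero_add, sub_zero, zero_sub, Matrix.map_zero _ (map_zero _),
    neg_eq_zero] at m1 m2 m3 m4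
  have hM : M = 0 := by
    apply Subtype.ext
    change M.1 = 0
    have h2 : M.1 = (1 / 2 : ℝ) • (M.1 - M.1ᴴ) + (1 / 2 : ℝ) • (M.1 + M.1ᴴ) := by module
    rw [h2, m1, m2, add_zero]
  have hL := hd L
  rw [innerDer_Km_L, innerDer_Kp_L, dG_L] at hL
  have l1 := congrArg coeffKm hL
  have l2 := congrArg coeffKp hL
  simp at l1 l2
  have hρ := congrArg coeffIm (hd Im)
  simp [l1, l2] at hρ
  rw [hM, he, hρ, H3_eq_zero m3 l1, H3_eq_zero m4 l2]
  rfl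

/-! ### The range of `theta0` -/

theorem contr_star {f : SplitOct →ₗ[ℝ] ℝ} {r : ℝ} (hf : ∀ a, f (star a) = r • f a) (x : OO) :
    contr f (star x) = r • star (contr f x) := by
  induction x using OO_induct with
  | hadd x y hx hy => rw [star_add, map_add, hx, hy, map_add, star_add, smul_add]
  | h a b => rw [TensorProduct.star_tmul, contr_tmul, contr_tmul, hf, star_smul, star_trivial (f a),
      smul_assoc]

/-- A form invariant under conjugation extracts an anti-Hermitian octonionic matrix, an odd one a
Hermitian matrix. So the coefficient of `1` is a rotation, that of `L` a boost, and those of `K₊`,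
`K₋` lie in the Albert algebra. -/
theorem conjTranspose_map_contr {f : SplitOct →ₗ[ℝ] ℝ} {r : ℝ} (hf : ∀ a, f (star a) = r • f a)
    (A : sa3) : r • (A.1.map (contr f))ᴴ = -A.1.map (contr f) := by
  ext1 i j
  rw [Matrix.smul_apply, Matrix.conjTranspose_apply, Matrix.neg_apply, Matrix.map_apply,
    Matrix.map_apply, ← contr_star hf, sa3_star, map_neg]

theorem trace_map_contr (f : SplitOct →ₗ[ℝ] ℝ) (A : sa3) : (A.1.map (contr f)).trace = 0 := by
  have h := congrArg (contr f) A.2.2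
  rw [map_zero, Matrix.trace, map_sum] at h
  exact h

theorem coeffOne_star (a : SplitOct) : coeffOne (star a) = (1 : ℝ) • coeffOne a := by
  simp [coeffOne_apply]

theorem coeffL_star (a : SplitOct) : coeffL (star a) = (-1 : ℝ) • coeffL a := by
  simp [coeffL_apply]

theorem coeffKp_star (a : SplitOct) : coeffKp (star a) = (-1 : ℝ) • coeffKp a := by
  simp [coeffKp, add_comm]

theorem coeffKm_star (a : SplitOct) : coeffKm (star a) = (-1 : ℝ) • coeffKm a := by
  simp [coeffKm]
  ring

theorem K_eq : K = Kp + Km := by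
  rw [Kp, Km]
  module

theorem KL_eq : KL = Kp - Km := by
  rw [Kp, Km]
  module

theorem HO_expand {t : OO} (ht : t ∈ HO) : t = (1 : SplitOct) ⊗ₜ[ℝ] contr coeffOne t +
    L ⊗ₜ[ℝ] contr coeffL t + Km ⊗ₜ[ℝ] contr coeffKm t + Kp ⊗ₜ[ℝ] contr coeffKp t := by
  induction ht using Submodule.span_induction with
  | mem t h =>
    obtain ⟨P, hP, x, rfl⟩ := h
    have hP' : P = coeffOne P • 1 + coeffL P • L + coeffKm P • Km + coeffKp P • Kp := by
      induction hP using Submodule.span_induction with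
      | mem P h =>
        rcases h with rfl | rfl | rfl | rfl
        · simp
        · rw [K_eq]
          simp [add_comm]
        · rw [KL_eq]
          simp
          abel
        · simp
      | zero => simp
      | add P Q _ _ hP hQ =>
        simp only [map_add, add_smul]
        linear_combination (norm := abel) hP + hQ
      | smul r P _ hP =>
        simp only [map_smul, smul_assoc]
        linear_combination (norm := module) r • hP
    simp only [contr_tmul]
    conv_lhs => rw [hP']
    simp only [TensorProduct.add_tmul, TensorProduct.smul_tmul]
  | zero => simp
  | add s t _ _ hs ht =>
    simp only [map_add, TensorProduct.tmul_add]
    linear_combination (norm := abel) hs + ht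
  | smul r t _ ht =>
    simp only [map_smul, TensorProduct.tmul_smul]
    linear_combination (norm := module) r • ht

theorem label_apply_mem_HO {Q : SplitOct} (hQ : Q ∈ Submodule.span ℝ {1, K, KL, L})
    (M : Mat3 Oct) (i j : Fin 3) : label Q M i j ∈ HO :=
  Submodule.subset_span ⟨Q, hQ, M i j, rfl⟩

theorem Kp_mem : Kp ∈ Submodule.span ℝ {K, KL, L} := by
  rw [Kp]
  exact Submodule.smul_mem _ _ (Submodule.add_mem _ (Submodule.subset_span (by simp))
    (Submodule.subset_span (by simp)))

theorem Km_mem : Km ∈ Submodule.span ℝ {K, KL, L} := by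
  rw [Km]
  exact Submodule.smul_mem _ _ (Submodule.sub_mem _ (Submodule.subset_span (by simp))
    (Submodule.subset_span (by simp)))

theorem L_mem : L ∈ Submodule.span ℝ {K, KL, L} := Submodule.subset_span (by simp)

theorem nested_mem_e7 {P Q : SplitOct} (hP : P ∈ Submodule.span ℝ {K, KL, L})
    (hQ : Q ∈ Submodule.span ℝ {K, KL, L}) : nested P Q ∈ e7 :=
  Submodule.mem_sup_right (Submodule.subset_span ⟨P, hP, Q, hQ, rfl⟩)

theorem span_le_span_one : Submodule.span ℝ {K, KL, L} ≤ Submodule.span ℝ {1, K, KL, L} :=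
  Submodule.span_mono (Set.subset_insert _ _)

theorem lab_mem_e7 {Q : SplitOct} (hQ : Q ∈ Submodule.span ℝ {K, KL, L}) (hQ0 : Q.fst.re = 0)
    (hQL : Q * L ∈ Submodule.span ℝ {K, KL, L}) (X : H3) : lab Q X ∈ e7 := by
  rw [lab_eq, map_smul]
  refine e7.add_mem (Submodule.mem_sup_left ⟨fun i j => ?_, rfl⟩) (e7.smul_mem _ ?_)
  · change (labMat Q X).1 i j ∈ HO
    rw [labMat_val hQ0]
    exact label_apply_mem_HO (span_le_span_one hQ) _ i j
  · have h := nested_mem_e7 hQL L_mem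
    rw [nested_eq, map_smul] at h
    exact (Submodule.smul_mem_iff _ (by norm_num)).mp h

theorem theta0_mem_e7 (Θ : Theta) : theta0 Θ ∈ e7 := by
  obtain ⟨φ, ρ, A, B⟩ := Θ
  rw [theta0_mk]
  have hp : Kp * L = Kp := by norm_num [Kp_oct, L_oct, oct_mul]
  have hm : Km * L = -Km := by norm_num [Km_oct, L_oct, oct_mul, oct_neg]
  refine e7.sub_mem (e7.add_mem (e7.add_mem (Submodule.mem_sup_left ⟨fun i j => ?_, rfl⟩)
    (e7.smul_mem _ (e7.smul_mem _ (nested_mem_e7 (Submodule.subset_span (by simp))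
      (Submodule.subset_span (by simp)))))) (lab_mem_e7 Km_mem Km_re ?_ A))
    (lab_mem_e7 Kp_mem Kp_re ?_ B)
  · rw [phi0_val, Matrix.add_apply]
    exact HO.add_mem (label_apply_mem_HO (Submodule.subset_span (by simp)) _ i j)
      (label_apply_mem_HO (Submodule.subset_span (by simp)) _ i j)
  · rw [hm]
    exact Submodule.neg_mem _ Km_mem
  · rw [hp]
    exact Kp_mem

theorem labMat_of_val {Q : SplitOct} (hQ : Q.fst.re = 0) {X : H3} (hX : X.1.trace = 0) :
    (labMat Q X).1 = label Q X.1 := by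
  rw [labMat_val hQ, tracefree_of_trace hX]

theorem lab_of_trace (Q : SplitOct) {X : H3} (hX : X.1.trace = 0) :
    lab Q X = matHom (labMat Q X) := by
  rw [lab_eq, tr_eq, hX, CD.re_zero, mul_zero, zero_smul, map_zero, add_zero]

theorem conjTranspose_eq_of_neg {M : Mat3 Oct} (h : (-1 : ℝ) • Mᴴ = -M) : Mᴴ = M := by
  rwa [neg_one_smul, neg_inj] at h

theorem e7Mat_le_range : e7Mat ≤ LinearMap.range theta0 := by
  rintro ⟨A, d, e⟩ ⟨hA, hd⟩
  change d = 0 at hd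
  change ∀ i j, A.1 i j ∈ HO at hA
  have hN := conjTranspose_map_contr coeffOne_star A
  rw [one_smul] at hN
  have hH := conjTranspose_eq_of_neg (conjTranspose_map_contr coeffL_star A)
  have hC := conjTranspose_eq_of_neg (conjTranspose_map_contr coeffKm_star A)
  have hD := conjTranspose_eq_of_neg (conjTranspose_map_contr coeffKp_star A)
  have tN := trace_map_contr coeffOne A
  have tH := trace_map_contr coeffL A
  have tC := trace_map_contr coeffKm A
  have tD := trace_map_contr coeffKp A
  have hexp : A.1 = label 1 (A.1.map (contr coeffOne)) + label L (A.1.map (contr coeffL)) +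
      label Km (A.1.map (contr coeffKm)) + label Kp (A.1.map (contr coeffKp)) := by
    ext1 i j
    exact HO_expand (hA i j)
  generalize A.1.map (contr coeffOne) = N at *
  generalize A.1.map (contr coeffL) = H at *
  generalize A.1.map (contr coeffKm) = C at *
  generalize A.1.map (contr coeffKp) = D at *
  have hC0 : ((⟨C, hC⟩ : H3)).1.trace = 0 := tC
  have hD0 : ((-⟨D, hD⟩ : H3)).1.trace = 0 := by
    change (-D).trace = 0
    rw [Matrix.trace_neg, tD, neg_zero]
  have hNH : (N + H).trace = 0 := by rw [Matrix.trace_add, tN, tH, add_zero]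
  -- `N` and `H` are the anti-Hermitian and Hermitian parts of `N + H`; the sign of `D` offsets the
  -- minus sign in front of the `K₊` term.
  refine ⟨((⟨N + H, hNH⟩, e), 0, ⟨C, hC⟩, -⟨D, hD⟩), ?_⟩
  rw [theta0_mk, phi0_eq, lab_of_trace Km hC0, lab_of_trace Kp hD0, mul_zero, zero_smul, add_zero,
    hd]
  have hval : (phi0 (⟨N + H, hNH⟩, e)).1 + labMat Km ⟨C, hC⟩ - labMat Kp (-⟨D, hD⟩) = A := by
    apply Subtype.ext
    rw [Submodule.coe_sub, Submodule.coe_add, labMat_of_val Km_re hC0, labMat_of_val Kp_re hD0,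
      phi0_val, hexp]
    change label 1 ((1 / 2 : ℝ) • (N + H - (N + H)ᴴ)) + label L ((1 / 2 : ℝ) • (N + H + (N + H)ᴴ)) +
      label Km C - label Kp (-D) = _
    rw [Matrix.conjTranspose_add, hN, hH, label_neg_right, sub_neg_eq_add]
    congr 3
    · congr 1
      module
    · congr 1
      module
  have hsum : ∀ U V W : sa3, matHom U + rightHom e + matHom V - matHom W =
      matHom (U + V - W) + rightHom e := fun U V W => by
    rw [map_sub, map_add]
    abel
  rw [hsum, hval, matHom_apply, rightHom_apply]
  simp

/-- The identity has no tracefree part, so its labelled copy is a pure derivation. Traces of `A` and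
`B` are thus what puts the elements `(P ∘ L) 𝓘` into the image of `theta0`. -/
theorem lab_one3 (Q : SplitOct) : lab Q one3 = leftHom ((1 / 2 : ℝ) • innerDer 1 (Q * L) L) := by
  rw [lab_eq, tr_one3]
  have h : labMat Q one3 = 0 := by
    apply Subtype.ext
    change label Q.imPart (tracefree one3.1) = 0
    rw [tracefree_H3, tr_one3]
    change label Q.imPart ((1 : Mat3 Oct) - (1 / 3 * 3 : ℝ) • (1 : Mat3 Oct)) = 0
    norm_num [label_zero]
  rw [h, map_zero, zero_add]
  norm_num

theorem range_theta0 : LinearMap.range theta0 = e7 := by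
  apply le_antisymm
  · rintro _ ⟨Θ, rfl⟩
    exact theta0_mem_e7 Θ
  · refine sup_le e7Mat_le_range (Submodule.span_le.mpr ?_)
    rintro _ ⟨P, hP, Q, hQ, rfl⟩
    have hp : Kp * L = Kp := by norm_num [Kp_oct, L_oct, oct_mul]
    have hm : Km * L = -Km := by norm_num [Km_oct, L_oct, oct_mul, oct_neg]
    have h0 : phi0 (0, 0) = 0 := map_zero phi0
    -- Signs: `K₋ L = -K₋` negates the copy of `𝓘` with label `K₋`, while `K₊ L = K₊` but `theta0`
    -- subtracts the `K₊` term. Hence `-one3` in both cases.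
    have h1 : nested Km L ∈ LinearMap.range theta0 := by
      refine ⟨((0, 0), 0, -one3, 0), ?_⟩
      rw [theta0_mk, map_neg, lab_one3, hm, nested_eq]
      simp [h0]
    have h2 : nested Kp L ∈ LinearMap.range theta0 := by
      refine ⟨((0, 0), 0, 0, -one3), ?_⟩
      rw [theta0_mk, map_neg, lab_one3, hp, nested_eq]
      simp [h0]
    have h3 : nested K KL ∈ LinearMap.range theta0 := by
      refine ⟨((0, 0), 3, 0, 0), ?_⟩
      rw [theta0_mk, G_L, h0, map_zero, map_zero]
      module
    have hadd : ∀ P P' Q, nested (P + P') Q = nested P Q + nested P' Q := fun P P' Q => by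
      rw [nested_eq, nested_eq, nested_eq, ← map_add leftHom, map_add, LinearMap.add_apply, smul_add]
    have hsmul : ∀ (r : ℝ) P Q, nested (r • P) Q = r • nested P Q := fun r P Q => by
      rw [nested_eq, nested_eq, ← map_smul leftHom, smul_comm, map_smul (innerDer 1) r P,
        LinearMap.smul_apply]
    have hswap : ∀ P Q, nested P Q = -nested Q P := fun P Q => by
      rw [nested_eq, nested_eq, innerDer_swap, smul_neg, map_neg]
    have hself : ∀ P, nested P P = 0 := fun P => by
      rw [nested_eq, innerDer_self, smul_zero, map_zero]
    have h4 : nested K L ∈ LinearMap.range theta0 := by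
      rw [K_eq, hadd]
      exact Submodule.add_mem _ h2 h1
    have h5 : nested KL L ∈ LinearMap.range theta0 := by
      rw [KL_eq, sub_eq_add_neg, hadd, ← neg_one_smul ℝ Km, hsmul]
      exact Submodule.add_mem _ h2 (Submodule.smul_mem _ _ h1)
    have hgen : ∀ P ∈ ({K, KL, L} : Set SplitOct), ∀ Q ∈ ({K, KL, L} : Set SplitOct),
        nested P Q ∈ LinearMap.range theta0 := by
      rintro P (rfl | rfl | rfl) Q (rfl | rfl | rfl)
      · rw [hself]
        exact Submodule.zero_mem _
      · exact h3
      · exact h4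
      · rw [hswap]
        exact Submodule.neg_mem _ h3
      · rw [hself]
        exact Submodule.zero_mem _
      · exact h5
      · rw [hswap]
        exact Submodule.neg_mem _ h4
      · rw [hswap]
        exact Submodule.neg_mem _ h5
      · rw [hself]
        exact Submodule.zero_mem _
    have hleft : ∀ P ∈ Submodule.span ℝ {K, KL, L}, ∀ Q ∈ ({K, KL, L} : Set SplitOct),
        nested P Q ∈ LinearMap.range theta0 := by
      intro P hP Q hQ
      induction hP using Submodule.span_induction with
      | mem P h => exact hgen P h Q hQ
      | zero => rw [nested_eq, map_zero, LinearMap.zero_apply, smul_zero, map_zero]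
                exact Submodule.zero_mem _
      | add P P' _ _ hP hP' => rw [hadd]
                               exact Submodule.add_mem _ hP hP'
      | smul r P _ hP => rw [hsmul]
                         exact Submodule.smul_mem _ _ hP
    change nested P Q ∈ LinearMap.range theta0
    induction hQ using Submodule.span_induction with
    | mem Q h => exact hleft P hP Q h
    | zero => rw [nested_eq, map_zero, smul_zero, map_zero]
              exact Submodule.zero_mem _
    | add Q Q' _ _ hQ hQ' => rw [hswap, hadd, neg_add, ← hswap, ← hswap]
                             exact Submodule.add_mem _ hQ hQ'
    | smul r Q _ hQ =>
      rw [hswap] at hQ ⊢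
      rw [hsmul]
      exact Submodule.neg_mem _ (Submodule.smul_mem _ _ ((Submodule.neg_mem_iff _).mp hQ))

theorem finrank_e7 : Module.finrank ℝ e7 = 133 := by
  rw [← range_theta0, LinearMap.finrank_range_of_inj theta0_injective, finrank_Theta]

/-! ### The decomposition of `𝔢₈` -/

theorem dG_eq : dG = (-2 : ℝ) • innerDer 1 Kp Km := by
  rw [dG, Kp, Km]
  simp only [map_smul, map_add, map_sub, LinearMap.smul_apply, LinearMap.add_apply,
    innerDer_self, innerDer_swap KL K]
  module

theorem derComm_dG {d : derAlg 1} (hp : d.1 Kp = 0) (hm : d.1 Km = 0) : derComm d dG = 0 := by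
  rw [dG_eq, derComm_smul_right, derComm_innerDer, hp, hm]
  simp

/-- On the side of `𝕆'`, the image of `theta0` involves only `L`, `K₊` and `K₋`; this includes `dG`,
a multiple of `D_{K₊, K₋}`. -/
theorem leftHom_theta0 {d : derAlg 1} (hL : d.1 L = 0) (hp : d.1 Kp = 0) (hm : d.1 Km = 0)
    (Θ : Theta) : ⁅leftHom d, theta0 Θ⁆ = 0 := by
  obtain ⟨φ, ρ, A, B⟩ := Θ
  rw [theta0_mk, bracket_sub, bracket_add, bracket_add, bracket_smul, bracket_swap, phi0_leftHom hL,
    G_L_eq, leftHom_leftHom, derComm_dG hp hm, leftHom_lab hL, leftHom_lab hL, hp, hm,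
    lab_zero_left, lab_zero_left]
  simp

theorem A_L_theta0 (Θ : Theta) : ⁅A_L, theta0 Θ⁆ = 0 := by
  rw [A_L_eq, leftHom_theta0 dL_L dL_Kp dL_Km]

theorem A_Kp_theta0 (Θ : Theta) : ⁅A_Kp, theta0 Θ⁆ = 0 := by
  rw [A_Kp_eq, leftHom_theta0 dKp_L dKp_Kp dKp_Km]

theorem A_Km_theta0 (Θ : Theta) : ⁅A_Km, theta0 Θ⁆ = 0 := by
  rw [A_Km_eq, leftHom_theta0 dKm_L dKm_Kp dKm_Km]

/-- The sum of `𝔢₇`, `𝔰𝔩(2, ℝ)` and the two towers. -/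
def decomp : (Theta × (ℝ × ℝ × ℝ) × Tower × Tower) →ₗ[ℝ] E8 :=
  theta0.coprod ((sl2Map ∘ₗ slEquiv.symm.toLinearMap).coprod (towerP.coprod towerM))

theorem decomp_apply (Θ : Theta) (a b c : ℝ) (P Q : Tower) : decomp (Θ, (a, b, c), P, Q) =
    theta0 Θ + ((1 / 2 * a) • A_L - (1 / 2 * b) • A_Km + (1 / 2 * c) • A_Kp) +
      towerP P + towerM Q := by
  rw [add_assoc, add_assoc]
  rfl

theorem A_L_A_Km : ⁅A_L, A_Km⁆ = (4 : ℝ) • A_Km := by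
  rw [A_L_eq, A_Km_eq, leftHom_leftHom, derComm_dL_dKm, map_smul]

theorem A_L_A_Kp : ⁅A_L, A_Kp⁆ = (-4 : ℝ) • A_Kp := by
  rw [A_L_eq, A_Kp_eq, leftHom_leftHom, derComm_dL_dKp, map_smul]

theorem A_L_decomp (Θ : Theta) (a b c : ℝ) (P Q : Tower) :
    ⁅A_L, decomp (Θ, (a, b, c), P, Q)⁆ =
      decomp (0, (0, 4 * b, -4 * c), (2 : ℝ) • P, (-2 : ℝ) • Q) := by
  rw [decomp_apply, decomp_apply]
  simp only [bracket_add, bracket_sub, bracket_smul, A_L_theta0, A_L_towerP, A_L_towerM, A_L_A_Km,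
    A_L_A_Kp, bracket_self, map_zero, map_smul]
  module

theorem A_Km_decomp (Θ : Theta) (a b c : ℝ) (P Q : Tower) :
    ⁅A_Km, decomp (Θ, (a, b, c), P, Q)⁆ =
      decomp (0, (-2 * c, 4 * a, 0), (-2 : ℝ) • Q, 0) := by
  have h1 : ⁅A_Km, A_Kp⁆ = (-2 : ℝ) • A_L := by
    rw [A_Kp_eq, A_Km_eq, A_L_eq, leftHom_leftHom, derComm_swap, derComm_dKp_dKm, map_neg, map_smul]
    module
  rw [decomp_apply, decomp_apply]
  simp only [bracket_add, bracket_sub, bracket_smul, A_Km_theta0, A_Km_towerP, A_Km_towerM,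
    bracket_self, map_zero, map_smul, bracket_swap A_Km A_L, A_L_A_Km, h1]
  module

theorem sl2Map_slEquiv_eq_zero {a b c : ℝ}
    (h : (1 / 2 * a) • A_L - (1 / 2 * b) • A_Km + (1 / 2 * c) • A_Kp = 0) :
    a = 0 ∧ b = 0 ∧ c = 0 := by
  rw [← sl2Map_symm] at h
  have h2 := (map_eq_zero_iff sl2Map sl2Map_injective).mp h
  rw [LinearEquiv.map_eq_zero_iff] at h2
  simpa using h2

/-- The eigenvalues of `ad A_L` separate the towers and `A_{K±}` from the rest. Inside the
eigenvalue `0`, the element `A_{K₋}` commutes with `𝔢₇` but not with `A_L`. -/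
theorem decomp_injective : Function.Injective decomp := by
  rw [← LinearMap.ker_eq_bot, LinearMap.ker_eq_bot']
  rintro ⟨Θ, ⟨a, b, c⟩, P, Q⟩ h0
  have h1 := congrArg (fun x => ⁅A_L, x⁆) h0
  simp only [A_L_decomp, bracket_zero] at h1
  have h2 := congrArg (fun x => ⁅A_L, x⁆) h1
  simp only [A_L_decomp, bracket_zero] at h2
  have h3 := congrArg (fun x => ⁅A_L, x⁆) h2
  simp only [A_L_decomp, bracket_zero] at h3
  have h4 := congrArg (fun x => ⁅A_L, x⁆) h3
  simp only [A_L_decomp, bracket_zero] at h4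
  rw [decomp_apply] at h0 h1 h2 h3 h4
  simp only [map_smul, map_zero] at h1 h2 h3 h4
  -- The polynomial `x/3 + x²/6 - x³/48 - x⁴/96` is `1` at `2` and `0` at `0`, `-2`, `4`, `-4`;
  -- applied to `ad A_L` it projects onto the eigenvalue `2`. Replacing `x` by `-x` gives the
  -- projection for `-2`.
  have hP : towerP P = 0 := by
    linear_combination (norm := module) (1 / 3 : ℝ) • h1 + (1 / 6 : ℝ) • h2 + (-1 / 48 : ℝ) • h3 + (-1 / 96 : ℝ) • h4
  have hQ : towerM Q = 0 := by
    linear_combination (norm := module) (-1 / 3 : ℝ) • h1 + (1 / 6 : ℝ) • h2 + (1 / 48 : ℝ) • h3 + (-1 / 96 : ℝ) • h4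
  simp only [hP, hQ, smul_zero, add_zero] at h0 h1
  have hK := congrArg (fun x => ⁅A_Km, x⁆) h0
  have hd := A_Km_decomp Θ a b c 0 0
  rw [decomp_apply, decomp_apply] at hd
  simp only [smul_zero, map_zero, add_zero, zero_add] at hd
  simp only [hd, bracket_zero] at hK
  obtain ⟨hc, ha, -⟩ := sl2Map_slEquiv_eq_zero hK
  simp only [zero_add] at h1
  obtain ⟨-, hb, -⟩ := sl2Map_slEquiv_eq_zero h1
  have ha : a = 0 := by linarith
  have hb : b = 0 := by linarith
  have hc : c = 0 := by linarith
  rw [ha, hb, hc] at h0 ⊢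
  have hΘ : theta0 Θ = 0 := by linear_combination (norm := module) h0
  rw [(map_eq_zero_iff theta0 theta0_injective).mp hΘ,
    (map_eq_zero_iff towerP towerP_injective).mp hP, (map_eq_zero_iff towerM towerM_injective).mp hQ]
  rfl

theorem decomp_surjective : Function.Surjective decomp := by
  refine (LinearMap.injective_iff_surjective_of_finrank_eq_finrank ?_).mp decomp_injective
  rw [finrank_E8, Module.finrank_prod (M := Theta), finrank_Theta, Module.finrank_prod,
    Module.finrank_prod (M := Tower), finrank_Tower]
  simp

theorem isInternal_of_finrank {ι V : Type} [Fintype ι] [DecidableEq ι] [AddCommGroup V]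
    [Module ℝ V] [FiniteDimensional ℝ V] (A : ι → Submodule ℝ V) (hA : ⨆ i, A i = ⊤)
    (h : ∑ i, Module.finrank ℝ (A i) = Module.finrank ℝ V) : DirectSum.IsInternal A := by
  have hsurj : Function.Surjective (DirectSum.coeLinearMap A) := by
    rw [← LinearMap.range_eq_top, DirectSum.range_coeLinearMap, hA]
  exact ⟨(LinearMap.injective_iff_surjective_of_finrank_eq_finrank
    ((Module.finrank_directSum (R := ℝ) fun i => A i).trans h)).mpr hsurj, hsurj⟩

theorem isInternal_decomp : DirectSum.IsInternal ![e7, sl2, LinearMap.range towerP,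
    LinearMap.range towerM] := by
  apply isInternal_of_finrank
  · rw [eq_top_iff]
    rintro x -
    obtain ⟨⟨Θ, ⟨a, b, c⟩, P, Q⟩, rfl⟩ := decomp_surjective x
    have hmem : ∀ i, ∀ x ∈ ![e7, sl2, LinearMap.range towerP, LinearMap.range towerM] i,
        x ∈ ⨆ i, ![e7, sl2, LinearMap.range towerP, LinearMap.range towerM] i :=
      fun i x hx => Submodule.mem_iSup_of_mem i hx
    rw [decomp_apply, ← sl2Map_symm]
    exact Submodule.add_mem _ (Submodule.add_mem _ (Submodule.add_mem _
      (hmem 0 _ (theta0_mem_e7 Θ))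
      (hmem 1 _ (range_sl2Map ▸ LinearMap.mem_range_self sl2Map _)))
      (hmem 2 _ (LinearMap.mem_range_self towerP P))) (hmem 3 _ (LinearMap.mem_range_self towerM Q))
  · rw [Fin.sum_univ_four, finrank_E8]
    change Module.finrank ℝ e7 + Module.finrank ℝ sl2 + Module.finrank ℝ (LinearMap.range towerP) +
      Module.finrank ℝ (LinearMap.range towerM) = 248
    rw [finrank_e7, finrank_sl2, LinearMap.finrank_range_of_inj towerP_injective,
      LinearMap.finrank_range_of_inj towerM_injective, finrank_Tower]

/-- An element commuting with `A_L` and `A_{K₋}` lies in `𝔢₇`. -/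
theorem mem_e7_of_commute {x : E8} (h1 : ⁅A_L, x⁆ = 0) (h2 : ⁅A_Km, x⁆ = 0) : x ∈ e7 := by
  obtain ⟨⟨Θ, ⟨a, b, c⟩, P, Q⟩, rfl⟩ := decomp_surjective x
  rw [A_L_decomp, map_eq_zero_iff decomp decomp_injective] at h1
  rw [A_Km_decomp, map_eq_zero_iff decomp decomp_injective] at h2
  simp at h1 h2
  obtain ⟨⟨hb, hc⟩, hP, hQ⟩ := h1
  rw [decomp_apply, h2.1.2, hb, hc, hP, hQ, ← range_theta0]
  exact ⟨Θ, by simp⟩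

/-- By `mem_e7_of_commute`, `𝔢₇` is a centralizer, and centralizers are closed under the bracket by
the Jacobi identity. -/
theorem bracket_mem_e7 {x y : E8} (hx : x ∈ e7) (hy : y ∈ e7) : ⁅x, y⁆ ∈ e7 := by
  rw [← range_theta0] at hx hy
  obtain ⟨Θ, rfl⟩ := hx
  obtain ⟨Θ', rfl⟩ := hy
  apply mem_e7_of_commute
  · rw [jacobi, A_L_theta0, A_L_theta0, bracket_zero, zero_bracket, add_zero]
  · rw [jacobi, A_Km_theta0, A_Km_theta0, bracket_zero, zero_bracket, add_zero]

/-- No explicit bracket of Freudenthal's elements is needed: `towerP` is injective and intertwines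
the two actions, so the Jacobi identity in `𝔢₈` gives the commutator formula. -/
theorem exists_theta0_bracket (Θ₁ Θ₂ : Theta) : ∃ Θ₃ : Theta,
    ⁅theta0 Θ₁, theta0 Θ₂⁆ = theta0 Θ₃ ∧ ∀ P : Tower, freudAct Θ₃ P =
      freudAct Θ₁ (freudAct Θ₂ P) - freudAct Θ₂ (freudAct Θ₁ P) := by
  have h := bracket_mem_e7 (theta0_mem_e7 Θ₁) (theta0_mem_e7 Θ₂)
  rw [← range_theta0] at h
  obtain ⟨Θ₃, h⟩ := h
  refine ⟨Θ₃, h.symm, fun P => towerP_injective ?_⟩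
  have hj := jacobi (theta0 Θ₁) (theta0 Θ₂) (towerP P)
  simp only [theta0_towerP, ← h] at hj
  rw [map_sub, hj]
  abel

/-! ### The centralizer of `𝔢₇` -/

theorem G_L_theta0 (ρ : ℝ) : theta0 ((0, 0), ρ, 0, 0) = (1 / 6 * ρ) • G_L := by
  rw [theta0_mk, show phi0 (0, 0) = 0 from map_zero phi0, map_zero, map_zero]
  module

theorem labKm_theta0 (A : H3) : theta0 ((0, 0), 0, A, 0) = lab Km A := by
  rw [theta0_mk, show phi0 (0, 0) = 0 from map_zero phi0, map_zero]
  module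

theorem lab_Km_injective : Function.Injective (lab Km) := fun A B h => by
  rw [← labKm_theta0, ← labKm_theta0] at h
  exact congrArg (fun Θ : Theta => Θ.2.2.1) (theta0_injective h)

/-- An element of `𝔢₆` acting on the Albert algebra as a multiple of the identity vanishes. -/
theorem e6Act_faithful {φ : E6} {r : ℝ} (h : ∀ X, e6Act φ X = r • X) : φ = 0 ∧ r = 0 := by
  obtain ⟨M, e⟩ := φ
  have hM : M.1.trace = 0 := M.2
  have hval : ∀ X : H3, M.1 * X.1 + X.1 * M.1ᴴ + X.1.map e.1 = r • X.1 := fun X =>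
    congrArg Subtype.val (h X)
  -- At the identity matrix the hypothesis reads `M + M† = r 𝓘`. As `M` is tracefree, `r = 0` and
  -- `M` is anti-Hermitian.
  have h1 := hval one3
  change M.1 * (1 : Mat3 Oct) + (1 : Mat3 Oct) * M.1ᴴ + (1 : Mat3 Oct).map e.1 = r • (1 : Mat3 Oct) at h1
  have he1 : (1 : Mat3 Oct).map e.1 = 0 := by
    ext1 i j
    rw [Matrix.map_apply, Matrix.one_apply]
    split_ifs <;> simp [der_one e.2]
  rw [he1, mul_one, one_mul, add_zero] at h1
  have hr : r = 0 := by
    have ht := congrArg (fun N : Mat3 Oct => N.trace.fst.re) h1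
    have h3 : (1 : Mat3 Oct).trace.fst.re = 3 := tr_one3
    simp only [Matrix.trace_add, Matrix.trace_smul, Matrix.trace_conjTranspose, hM, CD.smul_fst,
      Quaternion.re_smul, h3, star_zero, add_zero, smul_eq_mul, CD.zero_fst,
      quaternion_re_zero] at ht
    linarith
  rw [hr, zero_smul] at h1
  have hanti : M.1ᴴ = -M.1 := eq_neg_of_add_eq_zero_right h1
  have hcomm : ∀ (X : H3) i j, (M.1 * X.1) i j - (X.1 * M.1) i j + e.1 (X.1 i j) = 0 := by
    intro X i j
    have h2 := congrFun (congrFun (hval X) i) j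
    rw [hr, zero_smul, hanti, mul_neg] at h2
    rw [sub_eq_add_neg]
    exact h2
  -- Commuting with the diagonal idempotents forces `M` to be diagonal.
  have hoff : ∀ i j, i ≠ j → M.1 i j = 0 := by
    intro i j hij
    have h2 := hcomm (mkH3 (Pi.single i 1) 0 0 0) i j
    fin_cases i <;> fin_cases j <;> simp_all [mkH3, Matrix.mul_apply, Fin.sum_univ_three]
  -- With `x = 1` these compare the diagonal entries of `M`, which then vanish by tracelessness;
  -- with general `x` the same relation says that the derivation is zero.
  have h01 := fun x => hcomm (mkH3 0 x 0 0) 0 1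
  have h12 := hcomm (mkH3 0 0 0 1) 1 2
  simp [mkH3, Matrix.mul_apply, Fin.sum_univ_three, der_one e.2] at h01 h12
  have h00 : M.1 1 1 = M.1 0 0 := by
    have h2 := h01 1
    rw [der_one e.2, mul_one, one_mul, add_zero, sub_eq_zero] at h2
    exact h2.symm
  have h22 : M.1 2 2 = M.1 0 0 := by rw [← h00, sub_eq_zero.mp h12]
  have h0 : M.1 0 0 = 0 := by
    rw [Matrix.trace_fin_three, h00, h22] at hM
    linear_combination (norm := module) (1 / 3 : ℝ) • hM
  have hM0 : M.1 = 0 := by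
    ext1 i j
    by_cases hij : i = j
    · subst hij
      fin_cases i
      exacts [h0, h00.trans h0, h22.trans h0]
    · exact hoff i j hij
  refine ⟨Prod.ext (Subtype.ext hM0) (Subtype.ext (LinearMap.ext fun x => ?_)), hr⟩
  simpa [h00, h0] using h01 x

theorem G_L_towerP (X Y : H3) (p q : ℝ) : ⁅G_L, towerP (X, Y, p, q)⁆ =
    towerP ((2 : ℝ) • X, (-2 : ℝ) • Y, -6 * p, 6 * q) := by
  rw [towerP_mk, towerP_mk, A_Ip_eq, A_Jp_eq, G_L_eq]
  simp only [bracket_add, bracket_sub, bracket_smul, leftHom_lab dG_L, leftHom_leftHom,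
    derComm_dG_dIp, derComm_dG_dJp, dG_Im, dG_Jp, lab_smul_left, map_smul]
  module

/-- Decompose an element of the centralizer. Its tower components are annihilated by all of `𝔢₇`,
and its `𝔢₇` component is central in `𝔢₇`; both must vanish. -/
theorem mem_sl2_iff (x : E8) : x ∈ sl2 ↔ ∀ y ∈ e7, ⁅x, y⁆ = 0 := by
  constructor
  · intro hx y hy
    rw [← range_theta0] at hy
    obtain ⟨Θ, rfl⟩ := hy
    rw [← range_sl2Map] at hx
    obtain ⟨g, rfl⟩ := hx
    rw [sl2Map_apply]
    simp only [add_bracket, sub_bracket, smul_bracket, A_L_theta0, A_Kp_theta0, A_Km_theta0,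
      smul_zero, sub_zero, add_zero]
  · intro h
    obtain ⟨⟨Θ, ⟨a, b, c⟩, P, Q⟩, rfl⟩ := decomp_surjective x
    have hx : ∀ Θ', ⁅theta0 Θ', decomp (Θ, (a, b, c), P, Q)⁆ = 0 := fun Θ' => by
      rw [bracket_swap, h _ (theta0_mem_e7 Θ'), neg_zero]
    have key : ∀ Θ', ⁅theta0 Θ', theta0 Θ⁆ = 0 ∧ freudAct Θ' P = 0 ∧ freudAct Θ' Q = 0 := by
      intro Θ'
      obtain ⟨Θ₃, h3, -⟩ := exists_theta0_bracket Θ' Θ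
      have h2 : ⁅theta0 Θ', decomp (Θ, (a, b, c), P, Q)⁆ =
          decomp (Θ₃, (0, 0, 0), freudAct Θ' P, freudAct Θ' Q) := by
        rw [decomp_apply, decomp_apply]
        simp only [bracket_add, bracket_sub, bracket_smul, theta0_towerP, theta0_towerM, h3,
          bracket_swap _ A_L, bracket_swap _ A_Km, bracket_swap _ A_Kp, A_L_theta0, A_Kp_theta0,
          A_Km_theta0]
        module
      rw [hx, eq_comm, map_eq_zero_iff decomp decomp_injective] at h2
      simp only [Prod.mk_eq_zero] at h2
      rw [h3, h2.1, map_zero]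
      exact ⟨rfl, h2.2.2⟩
    -- `G_L` acts on the tower with the nonzero weights `2`, `-2`, `-6`, `6`.
    have hPQ : ∀ P, freudAct ((0, 0), 1, 0, 0) P = 0 → P = 0 := by
      rintro ⟨X, Y, p, q⟩ h
      have h1 := theta0_towerP ((0, 0), 1, 0, 0) (X, Y, p, q)
      rw [h, map_zero, G_L_theta0, smul_bracket, G_L_towerP, ← map_smul,
        map_eq_zero_iff towerP towerP_injective] at h1
      simpa using h1
    -- Commuting with `G_L` eliminates `A` and `B`, whose labels have weights `-4` and `4`.
    -- Commuting with the elements of label `K₋` then makes `φ` act as the scalar `2ρ/3`, so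
    -- `e6Act_faithful` applies.
    have hΘ : Θ = 0 := by
      obtain ⟨φ, ρ, A, B⟩ := Θ
      have hG := (key ((0, 0), 1, 0, 0)).1
      rw [G_L_theta0, smul_bracket, theta0_mk, G_L_eq] at hG
      simp only [bracket_add, bracket_sub, bracket_smul, leftHom_lab dG_L, dG_Km, dG_Kp,
        lab_smul_left, bracket_swap (leftHom dG) (phi0 φ), phi0_leftHom dG_L, bracket_self] at hG
      have hAB : theta0 (0, 0, A, -B) = 0 := by
        rw [theta0_mk, map_zero, map_neg]
        linear_combination (norm := module) (-3 / 2 : ℝ) • hG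
      rw [map_eq_zero_iff theta0 theta0_injective] at hAB
      simp only [Prod.mk_eq_zero, neg_eq_zero, true_and] at hAB
      obtain ⟨rfl, rfl⟩ := hAB
      have hφ : ∀ X, e6Act φ X = (2 / 3 * ρ) • X := fun X => lab_Km_injective <| by
        have hX := (key ((0, 0), 0, X, 0)).1
        rw [labKm_theta0, theta0_mk, G_L_eq] at hX
        simp only [bracket_add, bracket_sub, bracket_smul, map_zero, bracket_zero,
          lab_leftHom dG_L, dG_Km, lab_smul_left, bracket_swap (lab Km X) (phi0 φ),
          phi0_lab_Km] at hX
        rw [map_smul]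
        linear_combination (norm := module) -hX
      obtain ⟨h1, h2⟩ := e6Act_faithful hφ
      rw [h1, show ρ = 0 by linarith]
      rfl
    rw [hΘ, hPQ P (key _).2.1, hPQ Q (key _).2.2, decomp_apply, ← sl2Map_symm, ← range_sl2Map,
      map_zero, map_zero, map_zero, zero_add, add_zero, add_zero]
    exact LinearMap.mem_range_self _ _

end

end MagicE8

theorem mainTheorem1 :
    -- `𝔢₈` is a Lie algebra of dimension 248
    ((∀ x : MagicE8.E8, ⁅x, x⁆ = 0) ∧
      (∀ x y z : MagicE8.E8, ⁅x, ⁅y, z⁆⁆ = ⁅⁅x, y⁆, z⁆ + ⁅y, ⁅x, z⁆⁆) ∧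
      Module.finrank ℝ MagicE8.E8 = 248) ∧
    -- `Θ ↦ Θ₀` identifies Freudenthal's `𝔢₇` with the 133-dimensional subalgebra `𝔢₇` of `𝔢₈`
    ((∀ x ∈ MagicE8.e7, ∀ y ∈ MagicE8.e7, ⁅x, y⁆ ∈ MagicE8.e7) ∧
      Module.finrank ℝ MagicE8.e7 = 133 ∧
      Function.Injective MagicE8.theta0 ∧
      LinearMap.range MagicE8.theta0 = MagicE8.e7 ∧
      (∀ Θ₁ Θ₂ : MagicE8.Theta, ∃ Θ₃ : MagicE8.Theta,
        ⁅MagicE8.theta0 Θ₁, MagicE8.theta0 Θ₂⁆ = MagicE8.theta0 Θ₃ ∧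
        ∀ P : MagicE8.Tower, MagicE8.freudAct Θ₃ P =
          MagicE8.freudAct Θ₁ (MagicE8.freudAct Θ₂ P) -
            MagicE8.freudAct Θ₂ (MagicE8.freudAct Θ₁ P))) ∧
    -- the span of `A_K`, `A_{KL}`, `A_L` is a copy of `𝔰𝔩(2, ℝ)` and is the centralizer of `𝔢₇`
    (Function.Injective MagicE8.sl2Map ∧
      LinearMap.range MagicE8.sl2Map = MagicE8.sl2 ∧
      (∀ g h, MagicE8.sl2Map ⁅g, h⁆ = ⁅MagicE8.sl2Map g, MagicE8.sl2Map h⁆) ∧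
      Module.finrank ℝ MagicE8.sl2 = 3 ∧
      (∀ x : MagicE8.E8, x ∈ MagicE8.sl2 ↔ ∀ y ∈ MagicE8.e7, ⁅x, y⁆ = 0)) ∧
    -- the two towers are copies of the 56-dimensional minimal representation of `𝔢₇`
    (Function.Injective MagicE8.towerP ∧ Function.Injective MagicE8.towerM ∧
      Module.finrank ℝ (LinearMap.range MagicE8.towerP) = 56 ∧
      Module.finrank ℝ (LinearMap.range MagicE8.towerM) = 56 ∧
      (∀ (Θ : MagicE8.Theta) (P : MagicE8.Tower),
        ⁅MagicE8.theta0 Θ, MagicE8.towerP P⁆ = MagicE8.towerP (MagicE8.freudAct Θ P) ∧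
        ⁅MagicE8.theta0 Θ, MagicE8.towerM P⁆ = MagicE8.towerM (MagicE8.freudAct Θ P))) ∧
    -- `248 = 133 + 3 + 56 + 56`
    DirectSum.IsInternal ![MagicE8.e7, MagicE8.sl2, LinearMap.range MagicE8.towerP,
      LinearMap.range MagicE8.towerM] ∧
    -- `𝒫₊` and `𝒫₋` form a doublet of `𝔰𝔩(2, ℝ)`
    (∀ P : MagicE8.Tower,
      ⁅MagicE8.A_L, MagicE8.towerP P⁆ = (2 : ℝ) • MagicE8.towerP P ∧
      ⁅MagicE8.A_L, MagicE8.towerM P⁆ = (-2 : ℝ) • MagicE8.towerM P ∧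
      ∀ (g : LieAlgebra.SpecialLinear.sl (Fin 2) ℝ) (v : Fin 2 → ℝ),
        ⁅MagicE8.sl2Map g, v 0 • MagicE8.towerP P + v 1 • MagicE8.towerM P⁆ =
          (g.1.mulVec v) 0 • MagicE8.towerP P + (g.1.mulVec v) 1 • MagicE8.towerM P) := by
  exact ⟨⟨MagicE8.bracket_self, MagicE8.jacobi, MagicE8.finrank_E8⟩,
    ⟨fun x hx y hy => MagicE8.bracket_mem_e7 hx hy, MagicE8.finrank_e7, MagicE8.theta0_injective,
      MagicE8.range_theta0, MagicE8.exists_theta0_bracket⟩,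
    ⟨MagicE8.sl2Map_injective, MagicE8.range_sl2Map, MagicE8.sl2Map_bracket, MagicE8.finrank_sl2,
      MagicE8.mem_sl2_iff⟩,
    ⟨MagicE8.towerP_injective, MagicE8.towerM_injective,
      (LinearMap.finrank_range_of_inj MagicE8.towerP_injective).trans MagicE8.finrank_Tower,
      (LinearMap.finrank_range_of_inj MagicE8.towerM_injective).trans MagicE8.finrank_Tower,
      fun Θ P => ⟨MagicE8.theta0_towerP Θ P, MagicE8.theta0_towerM Θ P⟩⟩,
    MagicE8.isInternal_decomp,
    fun P => ⟨MagicE8.A_L_towerP P, MagicE8.A_L_towerM P, fun g v => MagicE8.sl2Map_doublet g v P⟩⟩
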